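/- **Setting.** Let $n>1$ and let $M$ be a smooth manifold of dimension $4n+3$ with a quaternionic contact (QC) pseudohermitian structure: an $\mathbb R^3$-valued $1$-form $\eta=(\eta^1,\eta^2,\eta^3)$ whose kernel $H$ is a distribution of rank $4n$, almost complex structures $I_1,I_2,I_3$ on $H$ with $I_i^2=I_1I_2I_3=-\mathrm{Id}$, and a metric $g$ on $H$ with $2g(I_iX,Y)=d\eta^i(X,Y)$ for $X,Y\in H$. Let $\nabla$ be its Biquard connection, with torsion $T$, curvature $R$ and associated complement $V$ of $H$. That is, $\nabla$ preserves $H$, $V$, $g$ and $\mathrm{span}\{I_i\}$; $T(X,Y)\in V$ for $X,Y\in H$; for $v\in V$, $T(v,\cdot)$ restricts to an endomorphism of $H$ in $(\mathfrak{sp}(n)\oplus\mathfrak{sp}(1))^\perp\subset\mathfrak{gl}(H)$; and the map $V\to\mathrm{span}\{I_i\}$, $v\mapsto\sum_i\eta^i(v)I_i$, is parallel. Let $R_1,R_2,R_3$ be the Reeb fields, the frame of $V$ dual to $\eta$. The metric is extended to $TM$ by $g\oplus\sum_i(\eta^i)^2$. Near $q\in M$ fix an $Sp(n)Sp(1)$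 frame of $H$: an orthonormal frame $\xi_\alpha$, $\alpha=1,\dots,4n$, with $\xi_{4k+i+1}=I_i\xi_{4k+1}$. Complete it to a frame $\xi_a$ of $TM$ by $\xi_{4n+i}=R_i$, with dual coframe $\theta^a$. Indices $\alpha,\beta,\gamma,\dots$ are horizontal, $i,j,k,l$ are vertical ($1,2,3$), $a,b$ are arbitrary; repeated indices are summed; indices are raised and lowered with the metric; indices after a comma denote covariant derivatives. Put $$T^a{}_{bc}=\theta^a(T(\xi_b,\xi_c)),\quad R_{abc}{}^d=\theta^d(R(\xi_a,\xi_b)\xi_c),\quad R_{\alpha\beta}=R_{\gamma\alpha\beta}{}^\gamma,\quad S=R_\alpha{}^\alpha,\quad I_{i\alpha\beta}=g(\xi_\alpha,I_i\xi_\beta),$$ and let $\varepsilon=\eta^1\wedge\eta^2\wedge\eta^3$, so $\varepsilon_{123}=1$. Let $T^0_i$ and $b_i$ be the symmetric and skew parts of the endomorphism $T(R_i,\cdot)|_H$, and let $\tau=\sum_iT^0_iI_i$ and $\mu=-\tfrac13\sum_iI_ib_i$ (so that $T^0_i=\tfrac14(I_i\tau-\tau I_i)$ and $b_i=I_i\mu$).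 Define $$L_{\alpha\beta}=\tfrac12\tau_{\alpha\beta}+\mu_{\alpha\beta}+\tfrac{S}{32n(n+2)}g_{\alpha\beta},\qquad B_{ij}=R_{kl\alpha\beta}\,\varepsilon^{kl}{}_i\,I_j{}^{\alpha\beta},\qquad A_{i\alpha}{}^{j\beta}=2\varepsilon^{jk}{}_i\,I_{k\alpha}{}^\beta$$ (the operator $A$ is invertible), and let $Q$ be the symmetric $2$-tensor with $$Q_{\alpha\beta}=L_{\alpha\beta}+\tfrac{1}{8(n+2)}S\,g_{\alpha\beta},\quad Q_{\alpha i}=Q_{i\alpha}=-(A^{-1})_{i\alpha}{}^{j\beta}\,T_{\beta kl}\,\varepsilon_j{}^{kl},\quad Q_{ij}=-\tfrac1{32n}(B_{ij}+B_{ji}).$$ The order $o(A)$ of a multiindex counts each horizontal index once and each vertical index twice, and $F_{(A)}$ denotes the symmetrization of $F_A$ over all indices of $A$. **Theorem.** Suppose that the symmetrized covariant derivatives of $Q$ vanish to total order $4$ at $q$, i.e. $Q_{(ab,C)}(q)=0$ for every multiindex $abC$ (with $C$ possibly empty) such that $o(abC)\le4$. Then all of the following vanish at $q$: $$S,\ \tau_{\alpha\beta},\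 \mu_{\alpha\beta},\ L_{\alpha\beta},\ R_{\alpha\beta},\ T_{\alpha i\beta},\ T_{ijk},$$ $$T_{\alpha jk},\ S_{,\beta},\ \mu_{\alpha\beta,}{}^{\alpha},\ \tau_{\alpha\beta,}{}^{\alpha},$$ $$B_{ij},\ S_{,i},\ S_{,\alpha}{}^{\alpha},\ \tau_{\alpha\beta,}{}^{\alpha\beta},\ \mu_{\alpha\beta,}{}^{\alpha\beta},\ R_{\gamma i\beta}{}^{\gamma}{}_{,\alpha}I^{i\beta\alpha}.$$ -/

import Mathlib

open scoped Manifold ContDiff Topology Bundle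

noncomputable section

namespace QC

/-- The model space `ℝ^(4n+3)`. -/
abbrev Model (n : ℕ) : Type := EuclideanSpace ℝ (Fin (4 * n + 3))

/-- Horizontal indices `α, β, …`: the pair `(k, 0)` stands for `4k+1` and `(k, i)`, `i = 1, 2, 3`,
for `4k+i+1`. -/
abbrev HIdx (n : ℕ) : Type := Fin n × Fin 4

/-- All indices `a, b, …`: horizontal ones (`Sum.inl α`) and vertical ones (`Sum.inr i`). -/
abbrev Idx (n : ℕ) : Type := HIdx n ⊕ Fin 3

section Basic

variable (n : ℕ) (M : Type*) [TopologicalSpace M] [ChartedSpace (Model n) M]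

/-- (Not necessarily continuous) vector fields on `M`. -/
abbrev VF : Type _ := (x : M) → TangentSpace (𝓡 (4 * n + 3)) x

variable {n M} [IsManifold (𝓡 (4 * n + 3)) ∞ M]

/-- The vector field `X` is differentiable at `x`. -/
def VF.DiffAt (X : VF n M) (x : M) : Prop :=
  MDifferentiableAt (𝓡 (4 * n + 3)) (𝓡 (4 * n + 3)).tangent
    (fun y => (⟨y, X y⟩ : TangentBundle (𝓡 (4 * n + 3)) M)) x

/-- The vector field `X` is smooth on the set `U`. -/
def VF.SmoothOn (X : VF n M) (U : Set M) : Prop :=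
  ContMDiffOn (𝓡 (4 * n + 3)) (𝓡 (4 * n + 3)).tangent ∞
    (fun y => (⟨y, X y⟩ : TangentBundle (𝓡 (4 * n + 3)) M)) U

/-- Derivative `v f` of the function `f` in the direction of the tangent vector `v` at `x`. -/
def dirDeriv (f : M → ℝ) (x : M) (v : TangentSpace (𝓡 (4 * n + 3)) x) : ℝ :=
  mvfderiv (𝓡 (4 * n + 3)) f x v

/-- Exterior derivative of a `1`-form, evaluated on vector fields:
`dσ(X, Y) = X σ(Y) - Y σ(X) - σ([X, Y])`. -/
def extDeriv₁ (σ : (x : M) → TangentSpace (𝓡 (4 * n + 3)) x →L[ℝ] ℝ) (X Y : VF n M) (x : M) : ℝ :=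
  dirDeriv (fun y => σ y (Y y)) x (X x) - dirDeriv (fun y => σ y (X y)) x (Y x)
    - σ x (VectorField.mlieBracket (𝓡 (4 * n + 3)) X Y x)

variable (n M) in
/-- A quaternionic contact (QC) pseudohermitian structure on the `(4n+3)`-dimensional manifold `M`:
an `ℝ³`-valued `1`-form `η` whose kernel `H` has rank `4n`, almost complex structures `I i` on `H`
with the quaternion relations, and a metric `g` on `H` with `2 g(I i X, Y) = dη i (X, Y)` on `H`.

`I i` and `g` are tensors on `H`. They are given by smooth tensors on `TM`, of which only the
restriction to `H` is ever used and on which nothing is required outside of `H`. -/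
structure PseudohermitianStructure where
  η : Fin 3 → (x : M) → TangentSpace (𝓡 (4 * n + 3)) x →L[ℝ] ℝ
  I : Fin 3 → (x : M) → TangentSpace (𝓡 (4 * n + 3)) x →L[ℝ] TangentSpace (𝓡 (4 * n + 3)) x
  g : (x : M) → TangentSpace (𝓡 (4 * n + 3)) x →L[ℝ] TangentSpace (𝓡 (4 * n + 3)) x →L[ℝ] ℝ
  η_smooth : ∀ i, ContMDiff (𝓡 (4 * n + 3)) ((𝓡 (4 * n + 3)).prod 𝓘(ℝ, Model n →L[ℝ] ℝ)) ∞
    (fun x => Bundle.TotalSpace.mk' (Model n →L[ℝ] ℝ)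
      (E := fun x => TangentSpace (𝓡 (4 * n + 3)) x →L[ℝ] ℝ) x (η i x))
  I_smooth : ∀ i, ContMDiff (𝓡 (4 * n + 3)) ((𝓡 (4 * n + 3)).prod 𝓘(ℝ, Model n →L[ℝ] Model n)) ∞
    (fun x => Bundle.TotalSpace.mk' (Model n →L[ℝ] Model n)
      (E := fun x => TangentSpace (𝓡 (4 * n + 3)) x →L[ℝ] TangentSpace (𝓡 (4 * n + 3)) x) x (I i x))
  g_smooth : ContMDiff (𝓡 (4 * n + 3))
    ((𝓡 (4 * n + 3)).prod 𝓘(ℝ, Model n →L[ℝ] Model n →L[ℝ] ℝ)) ∞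
    (fun x => Bundle.TotalSpace.mk' (Model n →L[ℝ] Model n →L[ℝ] ℝ)
      (E := fun x => TangentSpace (𝓡 (4 * n + 3)) x →L[ℝ] TangentSpace (𝓡 (4 * n + 3)) x →L[ℝ] ℝ)
      x (g x))
  finrank_ker : ∀ x, Module.finrank ℝ
    (⨅ i, LinearMap.ker (η i x).toLinearMap :
      Submodule ℝ (TangentSpace (𝓡 (4 * n + 3)) x)) = 4 * n
  I_mem : ∀ i x v, (∀ j, η j x v = 0) → ∀ j, η j x (I i x v) = 0
  I_sq : ∀ i x v, (∀ j, η j x v = 0) → I i x (I i x v) = -v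
  I_mul : ∀ x v, (∀ j, η j x v = 0) → I 0 x (I 1 x (I 2 x v)) = -v
  g_symm : ∀ x v w, (∀ j, η j x v = 0) → (∀ j, η j x w = 0) → g x v w = g x w v
  g_pos : ∀ x v, (∀ j, η j x v = 0) → v ≠ 0 → 0 < g x v v
  compat : ∀ i x (X Y : VF n M), X.DiffAt x → Y.DiffAt x →
    (∀ j, η j x (X x) = 0) → (∀ j, η j x (Y x) = 0) →
    2 * g x (I i x (X x)) (Y x) = extDeriv₁ (η i) X Y x

/-- The horizontal space `H_x = ⋂ i, ker (η i)`. -/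
def PseudohermitianStructure.H (P : PseudohermitianStructure n M) (x : M) :
    Submodule ℝ (TangentSpace (𝓡 (4 * n + 3)) x) :=
  ⨅ i, LinearMap.ker (P.η i x).toLinearMap

/-- `A`, restricted to `H_x`, belongs to `sp(n)`: it is a `g`-skew endomorphism of `H_x` commuting
with the almost complex structures. -/
def PseudohermitianStructure.IsSpn (P : PseudohermitianStructure n M) (x : M)
    (A : TangentSpace (𝓡 (4 * n + 3)) x →ₗ[ℝ] TangentSpace (𝓡 (4 * n + 3)) x) : Prop :=
  (∀ v ∈ P.H x, A v ∈ P.H x) ∧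
  (∀ v ∈ P.H x, ∀ w ∈ P.H x, P.g x (A v) w = -P.g x v (A w)) ∧
  (∀ i, ∀ v ∈ P.H x, A (P.I i x v) = P.I i x (A v))

/-- `A`, restricted to `H_x`, belongs to `sp(1)`, the span of the almost complex structures. -/
def PseudohermitianStructure.IsSp1 (P : PseudohermitianStructure n M) (x : M)
    (A : TangentSpace (𝓡 (4 * n + 3)) x →ₗ[ℝ] TangentSpace (𝓡 (4 * n + 3)) x) : Prop :=
  ∃ c : Fin 3 → ℝ, ∀ v ∈ P.H x, A v = ∑ i, c i • P.I i x v

/-- The span `V_x` of three vector fields at `x`. -/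
def vertSpan (R : Fin 3 → VF n M) (x : M) : Submodule ℝ (TangentSpace (𝓡 (4 * n + 3)) x) :=
  Submodule.span ℝ (Set.range fun i => R i x)

/-- The Biquard connection of a QC pseudohermitian structure: the complement `V` of `H` (given by
its frame `reeb` dual to `η`, the Reeb fields) and the linear connection `cov` on `TM`
(`cov Y x v` is `∇_v Y` at `x`) that are characterized by

* `∇` preserves `H`, `V` and the metric `g` on `H`;
* `T(X, Y) ∈ V` for `X, Y ∈ H`;
* `∇` preserves the span of the almost complex structures;
* for `R ∈ V`, `T(R, ·)` maps `H` to `H` and, as an endomorphism of `H`, is orthogonal to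
  `sp(n) ⊕ sp(1)` in `gl(H)`;
* the isomorphism `φ : V → span {I i}`, `φ(R) = ∑ i, η i (R) I i`, is parallel. -/
structure BiquardConnection (P : PseudohermitianStructure n M) where
  reeb : Fin 3 → VF n M
  reeb_smooth : ∀ i, (reeb i).SmoothOn Set.univ
  η_reeb : ∀ i j x, P.η i x (reeb j x) = if i = j then 1 else 0
  cov : CovariantDerivative (𝓡 (4 * n + 3)) (Model n)
    (TangentSpace (𝓡 (4 * n + 3)) : M → Type _)
  cov_smooth : CovariantDerivative.ContMDiffCovariantDerivative cov ∞
  cov_H : ∀ x (Y : VF n M), Y.DiffAt x → (∀ᶠ y in 𝓝 x, Y y ∈ P.H y) →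
    ∀ v, cov Y x v ∈ P.H x
  cov_V : ∀ x (Y : VF n M), Y.DiffAt x → (∀ᶠ y in 𝓝 x, Y y ∈ vertSpan reeb y) →
    ∀ v, cov Y x v ∈ vertSpan reeb x
  cov_g : ∀ x (Y Z : VF n M), Y.DiffAt x → Z.DiffAt x → (∀ᶠ y in 𝓝 x, Y y ∈ P.H y) →
    (∀ᶠ y in 𝓝 x, Z y ∈ P.H y) → ∀ v,
    dirDeriv (fun y => P.g y (Y y) (Z y)) x v
      = P.g x (cov Y x v) (Z x) + P.g x (Y x) (cov Z x v)
  torsion_HH : ∀ x, ∀ v ∈ P.H x, ∀ w ∈ P.H x, cov.torsion x v w ∈ vertSpan reeb x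
  cov_Q : ∀ i x v, ∃ c : Fin 3 → ℝ, ∀ Y : VF n M, Y.DiffAt x → (∀ᶠ y in 𝓝 x, Y y ∈ P.H y) →
    cov (fun y => P.I i y (Y y)) x v - P.I i x (cov Y x v) = ∑ j, c j • P.I j x (Y x)
  torsion_VH : ∀ x, ∀ r ∈ vertSpan reeb x, ∀ v ∈ P.H x, cov.torsion x r v ∈ P.H x
  torsion_perp : ∀ x, ∀ r ∈ vertSpan reeb x,
    ∀ A : TangentSpace (𝓡 (4 * n + 3)) x →ₗ[ℝ] TangentSpace (𝓡 (4 * n + 3)) x,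
    P.IsSpn x A ∨ P.IsSp1 x A →
    ∀ e : HIdx n → TangentSpace (𝓡 (4 * n + 3)) x, (∀ α, e α ∈ P.H x) →
    (∀ α β, P.g x (e α) (e β) = if α = β then 1 else 0) →
    ∑ α, P.g x (cov.torsion x r (e α)) (A (e α)) = 0
  cov_φ : ∀ x (Z Y : VF n M), Z.DiffAt x → Y.DiffAt x →
    (∀ᶠ y in 𝓝 x, Z y ∈ vertSpan reeb y) → (∀ᶠ y in 𝓝 x, Y y ∈ P.H y) → ∀ v,
    cov (fun y => ∑ i, P.η i y (Z y) • P.I i y (Y y)) x v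
      = ∑ i, P.η i x (cov Z x v) • P.I i x (Y x) + ∑ i, P.η i x (Z x) • P.I i x (cov Y x v)

namespace BiquardConnection

variable {P : PseudohermitianStructure n M} (C : BiquardConnection P)

/-- Projection of a tangent vector to `H` along `V`. -/
def hor (x : M) (v : TangentSpace (𝓡 (4 * n + 3)) x) : TangentSpace (𝓡 (4 * n + 3)) x :=
  v - ∑ i, P.η i x v • C.reeb i x

/-- The metric `g ⊕ ∑ i, (η i)²` on `TM`. -/
def metric (x : M) (v w : TangentSpace (𝓡 (4 * n + 3)) x) : ℝ :=
  P.g x (C.hor x v) (C.hor x w) + ∑ i, P.η i x v * P.η i x w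

/-- Curvature `R(X, Y)Z = ∇_X ∇_Y Z - ∇_Y ∇_X Z - ∇_[X, Y] Z`. -/
def curvature (X Y Z : VF n M) (x : M) : TangentSpace (𝓡 (4 * n + 3)) x :=
  C.cov (fun y => C.cov Z y (Y y)) x (X x) - C.cov (fun y => C.cov Z y (X y)) x (Y x)
    - C.cov Z x (VectorField.mlieBracket (𝓡 (4 * n + 3)) X Y x)

end BiquardConnection

/-- An `Sp(n)Sp(1)` frame of `H` on the open set `U`: a smooth orthonormal frame with
`ξ_(k,i) = I i ξ_(k,0)` for `i = 1, 2, 3`. -/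
structure SpFrame (P : PseudohermitianStructure n M) (U : Set M) where
  isOpen : IsOpen U
  ξ : HIdx n → VF n M
  smooth : ∀ α, (ξ α).SmoothOn U
  mem_H : ∀ α, ∀ x ∈ U, ξ α x ∈ P.H x
  orthonormal : ∀ α β, ∀ x ∈ U, P.g x (ξ α x) (ξ β x) = if α = β then 1 else 0
  quaternionic : ∀ k (i : Fin 3), ∀ x ∈ U, ξ (k, i.succ) x = P.I i x (ξ (k, 0) x)

end Basic

/-- Components `F_A`, `A` a multiindex of length `k`, of a covariant `k`-tensor in a frame. As the
frames below are orthonormal, upper and lower indices are not distinguished. -/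
abbrev Tensor (n : ℕ) (M : Type*) (k : ℕ) : Type _ := (Fin k → Idx n) → M → ℝ

/-- A tensor of order zero. -/
def scalar {n : ℕ} {M : Type*} (f : M → ℝ) : Tensor n M 0 := fun _ => f

/-- The `2`-tensor on `TM` with horizontal components `f` and all others zero. -/
def horizontal {n : ℕ} {M : Type*} (f : HIdx n → HIdx n → M → ℝ) : Tensor n M 2 := fun A =>
  match A 0, A 1 with
  | Sum.inl α, Sum.inl β => f α β
  | _, _ => 0

/-- The symmetric part `F_(A) = (1/k!) ∑ σ, F_(σA)`. -/
def symPart {n : ℕ} {M : Type*} {k : ℕ} (F : Tensor n M k) : Tensor n M k := fun A x =>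
  (k.factorial : ℝ)⁻¹ * ∑ σ : Equiv.Perm (Fin k), F (A ∘ σ) x

/-- The order of an index: `1` for horizontal and `2` for vertical ones. -/
def idxOrder {n : ℕ} : Idx n → ℕ
  | Sum.inl _ => 1
  | Sum.inr _ => 2

/-- The order `o(A)` of a multiindex. -/
def order {n k : ℕ} (A : Fin k → Idx n) : ℕ := ∑ j, idxOrder (A j)

/-- The components `ε_ijk` of the volume form `η¹ ∧ η² ∧ η³` on `V`. -/
def eps (i j k : Fin 3) : ℝ :=
  Matrix.det (Matrix.of fun r s : Fin 3 => if ![i, j, k] r = s then (1 : ℝ) else 0)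

namespace SpFrame

variable {n : ℕ} {M : Type*} [TopologicalSpace M] [ChartedSpace (Model n) M]
  [IsManifold (𝓡 (4 * n + 3)) ∞ M] {P : PseudohermitianStructure n M} {U : Set M}
  (f : SpFrame P U) (C : BiquardConnection P)

/-- The whole frame `ξ_a`, consisting of the `ξ_α` and the Reeb fields. -/
def vec : Idx n → VF n M := Sum.elim f.ξ C.reeb

/-- The dual coframe: `θ^a(v)`. -/
def coframe (a : Idx n) (x : M) (v : TangentSpace (𝓡 (4 * n + 3)) x) : ℝ :=
  C.metric x (f.vec C a x) v

/-- Connection coefficients `θ^c(∇_{ξ_a} ξ_b)`. -/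
def conn (a b c : Idx n) (x : M) : ℝ :=
  f.coframe C c x (C.cov (f.vec C b) x (f.vec C a x))

/-- The covariant derivative of a tensor; the new index is the last one:
`F_{A,c} = ξ_c F_A - ∑ j, F_{a_1 … d … a_k} θ^d(∇_{ξ_c} ξ_{a_j})`. -/
def covD {k : ℕ} (F : Tensor n M k) : Tensor n M (k + 1) := fun A x =>
  dirDeriv (F (Fin.init A)) x (f.vec C (A (Fin.last k)) x)
    - ∑ j : Fin k, ∑ d : Idx n, f.conn C (A (Fin.last k)) (Fin.init A j) d x *
        F (Function.update (Fin.init A) j d) x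

/-- The iterated covariant derivative `∇^r F`. -/
def iterCovD {k : ℕ} (F : Tensor n M k) : (r : ℕ) → Tensor n M (k + r)
  | 0 => F
  | r + 1 => f.covD C (iterCovD F r)

/-- Torsion components `T_{abc} = θ^a(T(ξ_b, ξ_c))`. -/
def tor (a b c : Idx n) (x : M) : ℝ :=
  f.coframe C a x (C.cov.torsion x (f.vec C b x) (f.vec C c x))

/-- Curvature components `R_{abcd} = R_{abc}^d = θ^d(R(ξ_a, ξ_b) ξ_c)`, as a `4`-tensor. -/
def curv : Tensor n M 4 := fun A x =>
  f.coframe C (A 3) x (C.curvature (f.vec C (A 0)) (f.vec C (A 1)) (f.vec C (A 2)) x)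

/-- Components `I_{iαβ} = g(ξ_α, I i ξ_β)` of the almost complex structures. -/
def acs (i : Fin 3) (α β : HIdx n) (x : M) : ℝ :=
  P.g x (f.ξ α x) (P.I i x (f.ξ β x))

/-- Horizontal Ricci tensor `R_{αβ} = R_{γαβ}^γ`. -/
def ricci (α β : HIdx n) (x : M) : ℝ :=
  ∑ γ : HIdx n, f.curv C ![Sum.inl γ, Sum.inl α, Sum.inl β, Sum.inl γ] x

/-- Scalar curvature `S = R_α^α`. -/
def scal (x : M) : ℝ := ∑ α : HIdx n, f.ricci C α α x

/-- The symmetric part `T⁰_i` of the endomorphism `T(R_i, ·)` of `H`. -/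
def torSym (i : Fin 3) (α β : HIdx n) (x : M) : ℝ :=
  (f.tor C (Sum.inl α) (Sum.inr i) (Sum.inl β) x
    + f.tor C (Sum.inl β) (Sum.inr i) (Sum.inl α) x) / 2

/-- The skew part `b_i` of the endomorphism `T(R_i, ·)` of `H`. -/
def torSkew (i : Fin 3) (α β : HIdx n) (x : M) : ℝ :=
  (f.tor C (Sum.inl α) (Sum.inr i) (Sum.inl β) x
    - f.tor C (Sum.inl β) (Sum.inr i) (Sum.inl α) x) / 2

/-- `τ = ∑ i, T⁰_i I_i`; it is the tensor with `T⁰_i = (I_i τ - τ I_i) / 4` and Casimir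
eigenvalue `-1`. -/
def τ (α β : HIdx n) (x : M) : ℝ :=
  ∑ i, ∑ γ : HIdx n, f.torSym C i α γ x * f.acs i γ β x

/-- `μ = -(1/3) ∑ i, I_i b_i`; it is the tensor with `b_i = I_i μ` for each `i`. -/
def μ (α β : HIdx n) (x : M) : ℝ :=
  -(1 / 3) * ∑ i, ∑ γ : HIdx n, f.acs i α γ x * f.torSkew C i γ β x

/-- `L_{αβ} = τ_{αβ} / 2 + μ_{αβ} + S g_{αβ} / (32 n (n + 2))`. -/
def L (α β : HIdx n) (x : M) : ℝ :=
  f.τ C α β x / 2 + f.μ C α β x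
    + f.scal C x / (32 * n * (n + 2)) * (if α = β then 1 else 0)

/-- `B_{ij} = R_{klαβ} ε^{kl}_i I_j^{αβ}`. -/
def B (i j : Fin 3) (x : M) : ℝ :=
  ∑ k, ∑ l, ∑ α : HIdx n, ∑ β : HIdx n,
    f.curv C ![Sum.inr k, Sum.inr l, Sum.inl α, Sum.inl β] x * eps k l i * f.acs j α β x

/-- The matrix `A_{iα}^{jβ} = 2 ε^{jk}_i I_{kα}^β`. -/
def matA (x : M) : Matrix (Fin 3 × HIdx n) (Fin 3 × HIdx n) ℝ :=
  Matrix.of fun p r => 2 * ∑ k, eps r.1 k p.1 * f.acs k p.2 r.2 x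

/-- `Q_{iα} = -(A⁻¹)_{iα}^{jβ} T_{βkl} ε_j^{kl}`. -/
def Qmixed (i : Fin 3) (α : HIdx n) (x : M) : ℝ :=
  -∑ j, ∑ β : HIdx n, (f.matA x)⁻¹ (i, α) (j, β) *
    ∑ k, ∑ l, f.tor C (Sum.inl β) (Sum.inr k) (Sum.inr l) x * eps j k l

/-- The tensor `Q`: `Q_{αβ} = L_{αβ} + S g_{αβ} / (8 (n + 2))`, `Q_{αi} = Q_{iα}` as in `Qmixed`,
and `Q_{ij} = -B_{(ij)} / (16 n)`. -/
def Q : Tensor n M 2 := fun A x =>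
  match A 0, A 1 with
  | Sum.inl α, Sum.inl β =>
      f.L C α β x + f.scal C x / (8 * (n + 2)) * (if α = β then 1 else 0)
  | Sum.inl α, Sum.inr i => f.Qmixed C i α x
  | Sum.inr i, Sum.inl α => f.Qmixed C i α x
  | Sum.inr i, Sum.inr j => -(1 / (16 * n)) * ((f.B C i j x + f.B C j i x) / 2)

/-- The symmetrized covariant derivatives of `Q` vanish to total order `N` at `q`:
`Q_{(ab,C)}(q) = 0` whenever `o(abC) ≤ N`. -/
def SymDerivQVanish (N : ℕ) (q : M) : Prop :=
  ∀ (r : ℕ) (A : Fin (2 + r) → Idx n), order A ≤ N →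
    symPart (f.iterCovD C (f.Q C) r) A q = 0

end SpFrame

end QC

end

/-! In an Sp(n)Sp(1) frame the almost complex structures have constant matrices, so near q the
geometry becomes algebra. The connection coefficients and torsion components are elements of the
ring of smooth functions on U, the frame fields are derivations of that ring, and `FrameCalculus`
records what is needed of the Biquard connection. The Jacobi identity for the frame brackets yields
the first Bianchi identity `bianchi`, from which all the relations below are extracted.

Algebraic part. One component of the Bianchi identity expresses the curvature of V on horizontal
vectors through the torsion. This curvature is skew in its V-indices, so the torsion satisfies a
quadratic-free relation, `torsion_relation`. Together with orthogonality to sp(n) ⊕ sp(1) it forces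
T⁰_i = ¼[I_i, τ], b_i = I_i μ with τ, μ symmetric and trace-free, and T_{kij} = λ ε_{kij} for a
single function λ (`lam`). A double contraction of the purely horizontal Bianchi identity gives S =
-8n(n+2)λ (`trace_ric`), so that Q_{αβ} = ½τ + μ - ¼(1+4n)λ g.

Differential part. Let a_i be the horizontal torsion of V with its two vertical arguments dualized,
a = ∑ I_i a_i, and let p, m be the divergences of τ and μ. Contractions of the mixed Bianchi
identities give two linear relations `eq_one` and `eq_two` between p, m, a and the horizontal
gradient dλ. They hold on all of U and can therefore be differentiated.

The hypothesis is then used order by order. At order 2, the trace and the operator X ↦ ∑ I_i X I_i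
separate the three summands of Q_{αβ}, so τ, μ, λ vanish at q (`lam_τ_μ_eq_zero`), and with them the
Ricci tensor (`ric_eq_zero`). At order 3, Q_{αi} = 0 gives a_i = 0, and the trace of Q_{(αα,β)}
supplies a third relation, so p = m = dλ = 0 (`first_derivatives_eq_zero`, by the linear algebra of
`eq_zero_of_system`).

At order 4 (`second_derivatives_eq_zero`) the two relations are hit with the divergence of I_i
applied to them. This gives div(I_i a) = 4n λ_{,i}, for which n > 1 is essential, and the trace of
Q_{(αα,i)} then gives λ_{,i} = 0. At q one has B_{ij} = div(I_j a_i). The skew part of B is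
therefore controlled by div(I_i a) = 0 and the symmetric part by Q_{ij} = 0, so B = 0 and div a = ∑
B_{ii} = 0. The divergences of the two relations and the double trace of Q_{(αα,γγ)} form the same
linear system as at order 3, which kills div p, div m and div dλ. The last scalar is, up to sign,
the divergence of ∑ I_i W_i = -p + 3m + 2a, where W_i is the mixed Ricci curvature (`sum_jv_W`). -/

open scoped Manifold ContDiff Topology Bundle

noncomputable section

namespace QC

/-! ### Smooth functions and vector fields on an open set, Lie brackets. -/

section Smooth

set_option linter.unusedSectionVars false

variable {n : ℕ} {M : Type*} [TopologicalSpace M] [ChartedSpace (Model n) M]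
  [IsManifold (𝓡 (4 * n + 3)) ∞ M] {U : Set M}

/-- The function `F` is smooth on the set `U`. -/
def SmoothFn (F : M → ℝ) (U : Set M) : Prop :=
  ContMDiffOn (𝓡 (4 * n + 3)) 𝓘(ℝ) ∞ F U

theorem VF.SmoothOn.contMDiffAt {X : VF n M} (hU : IsOpen U) (hX : X.SmoothOn U) {x : M}
    (hx : x ∈ U) : ContMDiffAt (𝓡 (4 * n + 3)) (𝓡 (4 * n + 3)).tangent ∞
      (fun y => (⟨y, X y⟩ : TangentBundle (𝓡 (4 * n + 3)) M)) x :=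
  ContMDiffOn.contMDiffAt hX (hU.mem_nhds hx)

theorem VF.SmoothOn.diffAt {X : VF n M} (hU : IsOpen U) (hX : X.SmoothOn U) {x : M}
    (hx : x ∈ U) : X.DiffAt x :=
  (hX.contMDiffAt hU hx).mdifferentiableAt (by simp)

theorem SmoothFn.mdiffAt {F : M → ℝ} (hU : IsOpen U) (hF : SmoothFn (n := n) F U) {x : M}
    (hx : x ∈ U) : MDifferentiableAt (𝓡 (4 * n + 3)) 𝓘(ℝ) F x :=
  (ContMDiffOn.contMDiffAt hF (hU.mem_nhds hx)).mdifferentiableAt (by simp)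

theorem VF.SmoothOn.smul {F : M → ℝ} {X : VF n M} (hF : SmoothFn (n := n) F U)
    (hX : X.SmoothOn U) : VF.SmoothOn (n := n) (F • X) U :=
  ContMDiffOn.smul_section hF hX

theorem VF.SmoothOn.add {X Y : VF n M} (hX : X.SmoothOn U) (hY : Y.SmoothOn U) :
    VF.SmoothOn (n := n) (X + Y) U :=
  ContMDiffOn.add_section hX hY

theorem VF.SmoothOn.sum {ι : Type*} {s : Finset ι} {X : ι → VF n M}
    (hX : ∀ i ∈ s, (X i).SmoothOn U) :
    VF.SmoothOn (n := n) (fun x => ∑ i ∈ s, X i x) U :=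
  ContMDiffOn.sum_section hX

theorem VF.SmoothOn.congr {X Y : VF n M} (hX : X.SmoothOn U) (h : ∀ x ∈ U, Y x = X x) :
    Y.SmoothOn U :=
  ContMDiffOn.congr hX (fun x hx => by rw [h x hx])

theorem VF.SmoothOn.mlieBracket {X Y : VF n M} (hU : IsOpen U) (hX : X.SmoothOn U)
    (hY : Y.SmoothOn U) :
    VF.SmoothOn (n := n) (VectorField.mlieBracket (𝓡 (4 * n + 3)) X Y) U := by
  have h : VF.SmoothOn (n := n) (VectorField.mlieBracketWithin (𝓡 (4 * n + 3)) X Y U) U := by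
    have : IsManifold (𝓡 (4 * n + 3)) ((⊤ : ℕ∞) + 1) M := by
      simpa using (inferInstance : IsManifold (𝓡 (4 * n + 3)) ∞ M)
    have : IsManifold (𝓡 (4 * n + 3)) (minSmoothness ℝ 2) M := by
      simpa using (inferInstance : IsManifold (𝓡 (4 * n + 3)) 2 M)
    exact ContMDiffOn.mlieBracketWithin_vectorField (m := ⊤) (n := ⊤) hX hY hU.uniqueMDiffOn
      (by simp)
  exact h.congr fun x hx => (VectorField.mlieBracketWithin_of_isOpen hU hx).symm

/-- A smooth one-form applied to a smooth vector field. -/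
theorem SmoothFn.form {σ : (x : M) → TangentSpace (𝓡 (4 * n + 3)) x →L[ℝ] ℝ}
    (hσ : ContMDiff (𝓡 (4 * n + 3)) ((𝓡 (4 * n + 3)).prod 𝓘(ℝ, Model n →L[ℝ] ℝ)) ∞
    (fun x => Bundle.TotalSpace.mk' (Model n →L[ℝ] ℝ)
      (E := fun x => TangentSpace (𝓡 (4 * n + 3)) x →L[ℝ] ℝ) x (σ x)))
    {X : VF n M} (hX : X.SmoothOn U) : SmoothFn (n := n) (fun x => σ x (X x)) U := by
  have h := ContMDiffOn.clm_bundle_apply (F₂ := ℝ) (E₂ := fun _ : M => ℝ) hσ.contMDiffOn hX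
  intro x hx
  have := h x hx
  rw [Bundle.contMDiffWithinAt_section] at this
  exact this

theorem SmoothFn.bilin
    {g : (x : M) → TangentSpace (𝓡 (4 * n + 3)) x →L[ℝ] TangentSpace (𝓡 (4 * n + 3)) x →L[ℝ] ℝ}
    (hg : ContMDiff (𝓡 (4 * n + 3))
    ((𝓡 (4 * n + 3)).prod 𝓘(ℝ, Model n →L[ℝ] Model n →L[ℝ] ℝ)) ∞
    (fun x => Bundle.TotalSpace.mk' (Model n →L[ℝ] Model n →L[ℝ] ℝ)
      (E := fun x => TangentSpace (𝓡 (4 * n + 3)) x →L[ℝ] TangentSpace (𝓡 (4 * n + 3)) x →L[ℝ] ℝ)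
      x (g x)))
    {X Y : VF n M} (hX : X.SmoothOn U) (hY : Y.SmoothOn U) :
    SmoothFn (n := n) (fun x => g x (X x) (Y x)) U := by
  have h := ContMDiffOn.clm_bundle_apply₂ (F₃ := ℝ) (E₃ := fun _ : M => ℝ) hg.contMDiffOn hX hY
  intro x hx
  have := h x hx
  rw [Bundle.contMDiffWithinAt_section] at this
  exact this

theorem VF.SmoothOn.endo
    {A : (x : M) → TangentSpace (𝓡 (4 * n + 3)) x →L[ℝ] TangentSpace (𝓡 (4 * n + 3)) x}
    (hA : ContMDiffOn (𝓡 (4 * n + 3)) ((𝓡 (4 * n + 3)).prod 𝓘(ℝ, Model n →L[ℝ] Model n)) ∞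
    (fun x => Bundle.TotalSpace.mk' (Model n →L[ℝ] Model n)
      (E := fun x => TangentSpace (𝓡 (4 * n + 3)) x →L[ℝ] TangentSpace (𝓡 (4 * n + 3)) x) x (A x))
      U)
    {X : VF n M} (hX : X.SmoothOn U) : VF.SmoothOn (n := n) (fun x => A x (X x)) U :=
  ContMDiffOn.clm_bundle_apply hA hX

theorem VF.SmoothOn.mono {X : VF n M} {V : Set M} (hX : X.SmoothOn U) (h : V ⊆ U) :
    X.SmoothOn V :=
  ContMDiffOn.mono hX h

/-- A vector field that is smooth on the open set `U` agrees near each point of `U` with one that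
is smooth everywhere. -/
theorem VF.SmoothOn.exists_extension [T2Space M] {X : VF n M} (hU : IsOpen U) (hX : X.SmoothOn U)
    {x : M} (hx : x ∈ U) :
    ∃ Y : VF n M, Y.SmoothOn Set.univ ∧ ∀ᶠ y in 𝓝 x, X y = Y y := by
  obtain ⟨b, hb, -⟩ := (SmoothBumpFunction.nhds_basis_support (I := 𝓡 (4 * n + 3))
    (hU.mem_nhds hx)).mem_iff.1 (hU.mem_nhds hx)
  refine ⟨fun y => b y • X y, ?_, ?_⟩
  · have h := ContMDiffOn.smul_section_of_tsupport (b.contMDiff.contMDiffOn (s := U)) hU hb hX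
    exact contMDiffOn_univ.2 h
  · filter_upwards [b.eventuallyEq_one] with y hy
    simp [hy]

/-- Smoothness of the connection concerns globally smooth fields, while frame fields are smooth only
on U. A bump function, available because M is Hausdorff, extends a germ, and the connection is
local. -/
theorem VF.SmoothOn.cov [T2Space M]
    {cov : CovariantDerivative (𝓡 (4 * n + 3)) (Model n)
      (TangentSpace (𝓡 (4 * n + 3)) : M → Type _)}
    (hcov : CovariantDerivative.ContMDiffCovariantDerivative cov ∞)
    {X Y : VF n M} (hU : IsOpen U) (hX : X.SmoothOn U) (hY : Y.SmoothOn U) :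
    VF.SmoothOn (n := n) (fun x => cov Y x (X x)) U := by
  intro x hx
  obtain ⟨Y', hY', hYY'⟩ := hY.exists_extension hU hx
  have h1 := hcov.contMDiff.contMDiff (σ := Y') hY'
  have h2 := VF.SmoothOn.endo (h1.mono (Set.subset_univ U)) hX
  refine ContMDiffWithinAt.congr_of_eventuallyEq_of_mem (h2 x hx) ?_ hx
  have h3 : ∀ᶠ y in 𝓝 x, ∀ᶠ z in 𝓝 y, Y z = Y' z := eventually_eventually_nhds.2 hYY'
  filter_upwards [mem_nhdsWithin_of_mem_nhds h3, self_mem_nhdsWithin] with y hy hyU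
  rw [cov.isCovariantDerivativeOnUniv.congr_of_eventuallyEq (hY.diffAt hU hyU)
    (hY'.diffAt isOpen_univ (Set.mem_univ y)) Filter.univ_mem hy]

theorem SmoothFn.mul {F G : M → ℝ} (hF : SmoothFn (n := n) F U) (hG : SmoothFn (n := n) G U) :
    SmoothFn (n := n) (fun x => F x * G x) U := ContMDiffOn.mul hF hG

theorem SmoothFn.add {F G : M → ℝ} (hF : SmoothFn (n := n) F U) (hG : SmoothFn (n := n) G U) :
    SmoothFn (n := n) (fun x => F x + G x) U := ContMDiffOn.add hF hG

theorem SmoothFn.neg {F : M → ℝ} (hF : SmoothFn (n := n) F U) :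
    SmoothFn (n := n) (fun x => -F x) U := ContMDiffOn.neg hF

theorem SmoothFn.sub {F G : M → ℝ} (hF : SmoothFn (n := n) F U) (hG : SmoothFn (n := n) G U) :
    SmoothFn (n := n) (fun x => F x - G x) U := ContMDiffOn.sub hF hG

theorem SmoothFn.const (c : ℝ) : SmoothFn (n := n) (M := M) (fun _ => c) U :=
  contMDiffOn_const

theorem SmoothFn.congr {F G : M → ℝ} (hF : SmoothFn (n := n) F U) (h : ∀ x ∈ U, G x = F x) :
    SmoothFn (n := n) G U :=
  ContMDiffOn.congr hF h

theorem dirDeriv_congr {F G : M → ℝ} {x : M} (h : F =ᶠ[𝓝 x] G)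
    (v : TangentSpace (𝓡 (4 * n + 3)) x) : dirDeriv F x v = dirDeriv G x v := by
  have := h.mfderiv_eq (I := 𝓡 (4 * n + 3)) (I' := 𝓘(ℝ))
  unfold dirDeriv mvfderiv
  simp only [ContinuousLinearMap.comp_apply]
  rw [this]
  rfl

theorem mlieBracket_smul_right' {F : M → ℝ} {X Y : VF n M} (hU : IsOpen U)
    (hF : SmoothFn (n := n) F U) (hY : Y.SmoothOn U) {x : M} (hx : x ∈ U) :
    VectorField.mlieBracket (𝓡 (4 * n + 3)) X (F • Y) x
      = dirDeriv F x (X x) • Y x + F x • VectorField.mlieBracket (𝓡 (4 * n + 3)) X Y x :=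
  VectorField.mlieBracket_smul_right (hF.mdiffAt hU hx) (hY.diffAt hU hx)

/-- The derivative of a smooth function in the direction of a smooth vector field is smooth. -/
theorem SmoothFn.dirDeriv {F : M → ℝ} {X Y : VF n M} (hU : IsOpen U) (hF : SmoothFn (n := n) F U)
    (hX : X.SmoothOn U) (hY : Y.SmoothOn U) {σ : (x : M) → TangentSpace (𝓡 (4 * n + 3)) x →L[ℝ] ℝ}
    (hσ : ContMDiff (𝓡 (4 * n + 3)) ((𝓡 (4 * n + 3)).prod 𝓘(ℝ, Model n →L[ℝ] ℝ)) ∞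
    (fun x => Bundle.TotalSpace.mk' (Model n →L[ℝ] ℝ)
      (E := fun x => TangentSpace (𝓡 (4 * n + 3)) x →L[ℝ] ℝ) x (σ x)))
    (hσY : ∀ x, σ x (Y x) = 1) :
    SmoothFn (n := n) (fun x => dirDeriv F x (X x)) U := by
  -- Since [X, F Y] = (X F) Y + F [X, Y] and σ(Y) = 1, one has X F = σ([X, F Y]) - F σ([X, Y]), and
  -- the right side is visibly smooth.
  have h1 := SmoothFn.form hσ (VF.SmoothOn.mlieBracket hU hX (hY.smul hF))
  have h2 := SmoothFn.form hσ (VF.SmoothOn.mlieBracket hU hX hY)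
  refine (h1.sub (hF.mul h2)).congr fun x hx => ?_
  rw [mlieBracket_smul_right' hU hF hY hx]
  simp [hσY]

/-- The Lie bracket acts on functions as the commutator. -/
theorem dirDeriv_mlieBracket {F : M → ℝ} {X Y Z : VF n M} (hU : IsOpen U)
    (hF : SmoothFn (n := n) F U) (hX : X.SmoothOn U) (hY : Y.SmoothOn U) (hZ : Z.SmoothOn U)
    {σ : (x : M) → TangentSpace (𝓡 (4 * n + 3)) x →L[ℝ] ℝ}
    (hσ : ContMDiff (𝓡 (4 * n + 3)) ((𝓡 (4 * n + 3)).prod 𝓘(ℝ, Model n →L[ℝ] ℝ)) ∞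
    (fun x => Bundle.TotalSpace.mk' (Model n →L[ℝ] ℝ)
      (E := fun x => TangentSpace (𝓡 (4 * n + 3)) x →L[ℝ] ℝ) x (σ x)))
    (hσZ : ∀ x, σ x (Z x) = 1) {x : M} (hx : x ∈ U) :
    dirDeriv F x (VectorField.mlieBracket (𝓡 (4 * n + 3)) X Y x)
      = dirDeriv (fun y => dirDeriv F y (Y y)) x (X x)
        - dirDeriv (fun y => dirDeriv F y (X y)) x (Y x) := by
  have : IsManifold (𝓡 (4 * n + 3)) (minSmoothness ℝ 3) M := by
    simpa using (inferInstance : IsManifold (𝓡 (4 * n + 3)) 3 M)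
  -- The commutator formula is the coefficient of Z in the Jacobi identity for X, Y, F Z.
  -- Subtracting the Jacobi identity for X, Y, Z and applying σ, with σ(Z) = 1, isolates it.
  have key : ∀ {X Y : VF n M}, X.SmoothOn U → Y.SmoothOn U →
      VectorField.mlieBracket (𝓡 (4 * n + 3)) X
        (VectorField.mlieBracket (𝓡 (4 * n + 3)) Y (F • Z)) x
      = dirDeriv (fun y => dirDeriv F y (Y y)) x (X x) • Z x
        + dirDeriv F x (Y x) • VectorField.mlieBracket (𝓡 (4 * n + 3)) X Z x
        + dirDeriv F x (X x) • VectorField.mlieBracket (𝓡 (4 * n + 3)) Y Z x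
        + F x • VectorField.mlieBracket (𝓡 (4 * n + 3)) X
          (VectorField.mlieBracket (𝓡 (4 * n + 3)) Y Z) x := by
    intro X Y hX hY
    have hd := SmoothFn.dirDeriv hU hF hY hZ hσ hσZ
    have hb := VF.SmoothOn.mlieBracket hU hY hZ
    have e : VectorField.mlieBracket (𝓡 (4 * n + 3)) Y (F • Z) =ᶠ[𝓝 x]
        ((fun y => dirDeriv F y (Y y)) • Z + F • VectorField.mlieBracket (𝓡 (4 * n + 3)) Y Z :
          VF n M) := by
      filter_upwards [hU.mem_nhds hx] with y hy
      exact mlieBracket_smul_right' hU hF hZ hy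
    refine (Filter.EventuallyEq.mlieBracket_vectorField_eq (V₁ := X) Filter.EventuallyEq.rfl
      e).trans ?_
    rw [VectorField.mlieBracket_add_right ((hZ.smul hd).diffAt hU hx) ((hb.smul hF).diffAt hU hx),
      mlieBracket_smul_right' hU hd hZ hx, mlieBracket_smul_right' hU hF hb hx]
    abel
  have h2 : ∀ {X : VF n M}, X.SmoothOn U → ContMDiffAt (𝓡 (4 * n + 3)) (𝓡 (4 * n + 3)).tangent
      (minSmoothness ℝ 2) (fun y => (⟨y, X y⟩ : TangentBundle (𝓡 (4 * n + 3)) M)) x := by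
    intro X hX
    exact (hX.contMDiffAt hU hx).of_le
      (by rw [minSmoothness_of_isRCLikeNormedField]; exact WithTop.coe_le_coe.2 (le_top : (2 : ℕ∞) ≤ ⊤))
  have j1 := VectorField.leibniz_identity_mlieBracket_apply (h2 hX) (h2 hY) (h2 (hZ.smul hF))
  have j2 := VectorField.leibniz_identity_mlieBracket_apply (h2 hX) (h2 hY) (h2 hZ)
  rw [key hX hY, key hY hX, mlieBracket_smul_right' hU hF hZ hx, j2] at j1
  have := congrArg (σ x) j1
  simp only [map_add, map_smul, hσZ, smul_eq_mul] at this
  linarith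

end Smooth

end QC

namespace QC

/-! ### Coframe, structure functions and curvature components of the full frame. -/

namespace SpFrame

variable {n : ℕ} {M : Type*} [TopologicalSpace M] [ChartedSpace (Model n) M]
  [IsManifold (𝓡 (4 * n + 3)) ∞ M] {P : PseudohermitianStructure n M} {U : Set M}
  (f : SpFrame P U) (C : BiquardConnection P)

theorem mem_H_iff {x : M} {v : TangentSpace (𝓡 (4 * n + 3)) x} :
    v ∈ P.H x ↔ ∀ j, P.η j x v = 0 := by
  simp [PseudohermitianStructure.H, Submodule.mem_iInf]

theorem η_ξ (j : Fin 3) (α : HIdx n) {x : M} (hx : x ∈ U) : P.η j x (f.ξ α x) = 0 :=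
  mem_H_iff.1 (f.mem_H α x hx) j

theorem hor_mem_H (x : M) (v : TangentSpace (𝓡 (4 * n + 3)) x) : C.hor x v ∈ P.H x := by
  rw [mem_H_iff]
  intro j
  simp [BiquardConnection.hor, map_sub, map_sum, C.η_reeb]

theorem hor_of_mem {x : M} {v : TangentSpace (𝓡 (4 * n + 3)) x} (hv : v ∈ P.H x) :
    C.hor x v = v := by
  simp [BiquardConnection.hor, mem_H_iff.1 hv]

theorem hor_reeb (i : Fin 3) (x : M) : C.hor x (C.reeb i x) = 0 := by
  simp [BiquardConnection.hor, C.η_reeb]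

theorem coframe_inl (α : HIdx n) {x : M} (hx : x ∈ U) (v : TangentSpace (𝓡 (4 * n + 3)) x) :
    f.coframe C (Sum.inl α) x v = P.g x (f.ξ α x) (C.hor x v) := by
  simp [coframe, vec, BiquardConnection.metric, hor_of_mem C (f.mem_H α x hx), f.η_ξ _ α hx]

theorem coframe_inr (i : Fin 3) (x : M) (v : TangentSpace (𝓡 (4 * n + 3)) x) :
    f.coframe C (Sum.inr i) x v = P.η i x v := by
  simp [coframe, vec, BiquardConnection.metric, hor_reeb, C.η_reeb]

/-- The coframe as a linear form. -/
def coframeL (a : Idx n) (x : M) : TangentSpace (𝓡 (4 * n + 3)) x →ₗ[ℝ] ℝ where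
  toFun := f.coframe C a x
  map_add' v w := by
    simp only [coframe, BiquardConnection.metric, BiquardConnection.hor, map_add, add_smul,
      Finset.sum_add_distrib, map_sub, map_sum, mul_add]
    ring
  map_smul' c v := by
    simp only [coframe, BiquardConnection.metric, BiquardConnection.hor, map_smul, smul_eq_mul,
      mul_smul, ← Finset.smul_sum, ← smul_sub, RingHom.id_apply, mul_add, Finset.mul_sum]
    congr 1
    exact Finset.sum_congr rfl fun i _ => by ring

theorem coframeL_apply (a : Idx n) (x : M) (v : TangentSpace (𝓡 (4 * n + 3)) x) :
    f.coframeL C a x v = f.coframe C a x v := rfl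

theorem linearIndependent_ξ {x : M} (hx : x ∈ U) : LinearIndependent ℝ fun α => f.ξ α x := by
  rw [Fintype.linearIndependent_iff]
  intro c hc α
  have := congrArg (fun v => P.g x (f.ξ α x) v) hc
  simpa [map_sum, f.orthonormal _ _ x hx] using this

/-- An orthonormal family of 4n vectors exhausts the 4n-dimensional space H_x. -/
theorem span_ξ {x : M} (hx : x ∈ U) :
    Submodule.span ℝ (Set.range fun α => f.ξ α x) = P.H x := by
  have : FiniteDimensional ℝ (TangentSpace (𝓡 (4 * n + 3)) x) :=
    inferInstanceAs (FiniteDimensional ℝ (Model n))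
  apply Submodule.eq_of_le_of_finrank_eq
  · rw [Submodule.span_le]
    rintro _ ⟨α, rfl⟩
    exact f.mem_H α x hx
  · rw [finrank_span_eq_card (f.linearIndependent_ξ hx), PseudohermitianStructure.H,
      P.finrank_ker x]
    simp [mul_comm]

theorem eq_sum_of_mem_H {x : M} (hx : x ∈ U) {v : TangentSpace (𝓡 (4 * n + 3)) x}
    (hv : v ∈ P.H x) : v = ∑ α, P.g x (f.ξ α x) v • f.ξ α x := by
  rw [← f.span_ξ hx] at hv
  obtain ⟨c, rfl⟩ := (Submodule.mem_span_range_iff_exists_fun ℝ).1 hv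
  refine Finset.sum_congr rfl fun α _ => ?_
  simp [map_sum, f.orthonormal _ _ x hx]

/-- Expansion of a tangent vector in the frame. -/
theorem eq_sum_coframe {x : M} (hx : x ∈ U) (v : TangentSpace (𝓡 (4 * n + 3)) x) :
    v = ∑ a, f.coframe C a x v • f.vec C a x := by
  have h : v = C.hor x v + ∑ i, P.η i x v • C.reeb i x := by
    simp [BiquardConnection.hor]
  rw [Fintype.sum_sum_type]
  simp only [f.coframe_inl C _ hx, coframe_inr, vec, Sum.elim_inl, Sum.elim_inr]
  rw [← f.eq_sum_of_mem_H hx (hor_mem_H C x v)]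
  exact h

theorem coframe_vec (a b : Idx n) {x : M} (hx : x ∈ U) :
    f.coframe C a x (f.vec C b x) = if a = b then 1 else 0 := by
  rcases a with α | i <;> rcases b with β | j
  · simp [f.coframe_inl C _ hx, vec, hor_of_mem C (f.mem_H β x hx), f.orthonormal _ _ x hx]
  · simp [f.coframe_inl C _ hx, vec, hor_reeb]
  · simp [coframe_inr, vec, f.η_ξ _ _ hx]
  · simp [coframe_inr, vec, C.η_reeb]

theorem vec_smooth (a : Idx n) : (f.vec C a).SmoothOn U := by
  rcases a with α | i
  · exact f.smooth α
  · exact (C.reeb_smooth i).mono (Set.subset_univ U)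

theorem coframe_smooth (a : Idx n) {X : VF n M} (hX : X.SmoothOn U) :
    SmoothFn (n := n) (fun x => f.coframe C a x (X x)) U := by
  have h : ∀ i, SmoothFn (n := n) (fun x => P.η i x (X x)) U :=
    fun i => SmoothFn.form (P.η_smooth i) hX
  rcases a with α | i
  · have hv : VF.SmoothOn (n := n) (fun x => C.hor x (X x)) U := by
      have h1 : VF.SmoothOn (n := n)
          (fun x => ∑ i, (-P.η i x (X x)) • C.reeb i x) U :=
        VF.SmoothOn.sum (X := fun i x => (-P.η i x (X x)) • C.reeb i x) fun i _ =>
          VF.SmoothOn.smul (h i).neg ((C.reeb_smooth i).mono (Set.subset_univ U))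
      refine (hX.add h1).congr fun x _ => ?_
      simp [BiquardConnection.hor, sub_eq_add_neg]
    exact (SmoothFn.bilin P.g_smooth (f.smooth α) hv).congr fun x hx => f.coframe_inl C α hx _
  · exact (h i).congr fun x _ => coframe_inr f C i x _

theorem conn_smooth [T2Space M] (a b c : Idx n) : SmoothFn (n := n) (f.conn C a b c) U :=
  f.coframe_smooth C c (VF.SmoothOn.cov C.cov_smooth f.isOpen (f.vec_smooth C a)
    (f.vec_smooth C b))

/-- The first Reeb field and its contact form serve as the field and form with pairing 1 that
`SmoothFn.dirDeriv` asks for. -/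
theorem dirDeriv_smooth (a : Idx n) {F : M → ℝ} (hF : SmoothFn (n := n) F U) :
    SmoothFn (n := n) (fun x => dirDeriv F x (f.vec C a x)) U :=
  SmoothFn.dirDeriv f.isOpen hF (f.vec_smooth C a) (f.vec_smooth C (Sum.inr 0)) (P.η_smooth 0)
    fun x => by simp [vec, C.η_reeb]

theorem cov_vec (a b : Idx n) {x : M} (hx : x ∈ U) :
    C.cov (f.vec C b) x (f.vec C a x) = ∑ c, f.conn C a b c x • f.vec C c x :=
  f.eq_sum_coframe C hx _

theorem torsion_vec (a b : Idx n) {x : M} (hx : x ∈ U) :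
    C.cov.torsion x (f.vec C a x) (f.vec C b x)
      = C.cov (f.vec C b) x (f.vec C a x) - C.cov (f.vec C a) x (f.vec C b x)
        - VectorField.mlieBracket (𝓡 (4 * n + 3)) (f.vec C a) (f.vec C b) x :=
  C.cov.torsion_apply ((f.vec_smooth C a).diffAt f.isOpen hx)
    ((f.vec_smooth C b).diffAt f.isOpen hx)

/-- The structure functions of the frame, `[ξ_a, ξ_b] = c_ab^d ξ_d`. -/
def struct (a b d : Idx n) (x : M) : ℝ := f.conn C a b d x - f.conn C b a d x - f.tor C d a b x

theorem coframe_mlieBracket (a b d : Idx n) {x : M} (hx : x ∈ U) :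
    f.coframe C d x (VectorField.mlieBracket (𝓡 (4 * n + 3)) (f.vec C a) (f.vec C b) x)
      = f.struct C a b d x := by
  have h := f.torsion_vec C a b hx
  have h2 := congrArg (f.coframeL C d x) h
  simp only [map_sub, coframeL_apply] at h2
  simp only [struct, tor, conn]
  linarith

theorem mlieBracket_vec (a b : Idx n) {x : M} (hx : x ∈ U) :
    VectorField.mlieBracket (𝓡 (4 * n + 3)) (f.vec C a) (f.vec C b) x
      = ∑ d, f.struct C a b d x • f.vec C d x := by
  simp_rw [← f.coframe_mlieBracket C a b _ hx]
  exact f.eq_sum_coframe C hx _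

theorem struct_smooth (a b d : Idx n) : SmoothFn (n := n) (f.struct C a b d) U :=
  (f.coframe_smooth C d ((f.vec_smooth C a).mlieBracket f.isOpen (f.vec_smooth C b))).congr
    fun _ hx => (f.coframe_mlieBracket C a b d hx).symm

theorem tor_smooth [T2Space M] (a b c : Idx n) : SmoothFn (n := n) (f.tor C a b c) U :=
  (((f.conn_smooth C b c a).sub (f.conn_smooth C c b a)).sub (f.struct_smooth C b c a)).congr
    fun x _ => by simp [struct]

theorem dirDeriv_comm (a b : Idx n) {F : M → ℝ} (hF : SmoothFn (n := n) F U) {x : M}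
    (hx : x ∈ U) :
    dirDeriv (fun y => dirDeriv F y (f.vec C b y)) x (f.vec C a x)
        - dirDeriv (fun y => dirDeriv F y (f.vec C a y)) x (f.vec C b x)
      = ∑ d, f.struct C a b d x * dirDeriv F x (f.vec C d x) := by
  rw [← dirDeriv_mlieBracket f.isOpen hF (f.vec_smooth C a) (f.vec_smooth C b)
    (f.vec_smooth C (Sum.inr 0)) (P.η_smooth 0) (fun x => by simp [vec, C.η_reeb]) hx,
    f.mlieBracket_vec C a b hx]
  simp [dirDeriv, map_sum]

/-- Bracket of a frame field with a combination of frame fields. -/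
theorem coframe_mlieBracket_sum (a d : Idx n) {F : Idx n → M → ℝ}
    (hF : ∀ e, SmoothFn (n := n) (F e) U) {x : M} (hx : x ∈ U) :
    f.coframe C d x (VectorField.mlieBracket (𝓡 (4 * n + 3)) (f.vec C a)
        (fun y => ∑ e, F e y • f.vec C e y) x)
      = dirDeriv (F d) x (f.vec C a x) + ∑ e, F e x * f.struct C a e d x := by
  have key : ∀ s : Finset (Idx n), VectorField.mlieBracket (𝓡 (4 * n + 3)) (f.vec C a)
        (fun y => ∑ e ∈ s, F e y • f.vec C e y) x
      = ∑ e ∈ s, (dirDeriv (F e) x (f.vec C a x) • f.vec C e x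
        + F e x • VectorField.mlieBracket (𝓡 (4 * n + 3)) (f.vec C a) (f.vec C e) x) := by
    intro s
    induction s using Finset.induction_on with
    | empty =>
      simp only [Finset.sum_empty]
      exact congrFun VectorField.mlieBracket_zero_right x
    | insert e s he ih =>
      simp only [Finset.sum_insert he]
      rw [← ih, ← mlieBracket_smul_right' f.isOpen (hF e) (f.vec_smooth C e) hx]
      exact VectorField.mlieBracket_add_right
        (((f.vec_smooth C e).smul (hF e)).diffAt f.isOpen hx)
        ((VF.SmoothOn.sum (X := fun e x => F e x • f.vec C e x) fun e _ =>
          (f.vec_smooth C e).smul (hF e)).diffAt f.isOpen hx)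
  rw [key, ← coframeL_apply, map_sum]
  simp only [map_add, map_smul, coframeL_apply, f.coframe_vec C _ _ hx,
    f.coframe_mlieBracket C _ _ _ hx, smul_eq_mul, mul_ite, mul_one, mul_zero,
    Finset.sum_add_distrib, Finset.sum_ite_eq, Finset.mem_univ, if_true]

theorem coframe_mlieBracket_mlieBracket (a b c d : Idx n) {x : M} (hx : x ∈ U) :
    f.coframe C d x (VectorField.mlieBracket (𝓡 (4 * n + 3)) (f.vec C a)
        (VectorField.mlieBracket (𝓡 (4 * n + 3)) (f.vec C b) (f.vec C c)) x)
      = dirDeriv (f.struct C b c d) x (f.vec C a x)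
        + ∑ e, f.struct C b c e x * f.struct C a e d x := by
  rw [← f.coframe_mlieBracket_sum C a d (fun e => f.struct_smooth C b c e) hx]
  congr 1
  refine Filter.EventuallyEq.mlieBracket_vectorField_eq Filter.EventuallyEq.rfl ?_
  filter_upwards [f.isOpen.mem_nhds hx] with y hy
  exact f.mlieBracket_vec C b c hy

/-- The Jacobi identity is needed in components because, once the frame is abstracted to
derivations, the first Bianchi identity is deduced from this. -/
theorem struct_jacobi (a b c d : Idx n) {x : M} (hx : x ∈ U) :
    (dirDeriv (f.struct C b c d) x (f.vec C a x)
        + ∑ e, f.struct C b c e x * f.struct C a e d x)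
      + (dirDeriv (f.struct C c a d) x (f.vec C b x)
        + ∑ e, f.struct C c a e x * f.struct C b e d x)
      + (dirDeriv (f.struct C a b d) x (f.vec C c x)
        + ∑ e, f.struct C a b e x * f.struct C c e d x) = 0 := by
  have : IsManifold (𝓡 (4 * n + 3)) (minSmoothness ℝ 3) M := by
    simpa using (inferInstance : IsManifold (𝓡 (4 * n + 3)) 3 M)
  have h2 : ∀ a, ContMDiffAt (𝓡 (4 * n + 3)) (𝓡 (4 * n + 3)).tangent
      (minSmoothness ℝ 2) (fun y => (⟨y, f.vec C a y⟩ : TangentBundle (𝓡 (4 * n + 3)) M)) x := by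
    intro a
    exact ((f.vec_smooth C a).contMDiffAt f.isOpen hx).of_le
      (by rw [minSmoothness_of_isRCLikeNormedField]
          exact WithTop.coe_le_coe.2 (le_top : (2 : ℕ∞) ≤ ⊤))
  have j := VectorField.leibniz_identity_mlieBracket_apply (h2 a) (h2 b) (h2 c)
  rw [VectorField.mlieBracket_swap_apply (V := VectorField.mlieBracket _ _ _),
    VectorField.mlieBracket_swap (V := f.vec C a) (W := f.vec C c)] at j
  have hneg : VectorField.mlieBracket (𝓡 (4 * n + 3)) (f.vec C b)
      (-VectorField.mlieBracket (𝓡 (4 * n + 3)) (f.vec C c) (f.vec C a)) x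
      = -VectorField.mlieBracket (𝓡 (4 * n + 3)) (f.vec C b)
        (VectorField.mlieBracket (𝓡 (4 * n + 3)) (f.vec C c) (f.vec C a)) x := by
    have := VectorField.mlieBracket_const_smul_right (I := 𝓡 (4 * n + 3)) (c := (-1 : ℝ))
      (V := f.vec C b) (((f.vec_smooth C c).mlieBracket f.isOpen
        (f.vec_smooth C a)).diffAt f.isOpen hx)
    simpa using this
  rw [hneg] at j
  have := congrArg (f.coframeL C d x) j
  simp only [map_add, map_neg, coframeL_apply, f.coframe_mlieBracket_mlieBracket C _ _ _ _ hx]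
    at this
  linarith

/-- Covariant derivative of a combination of frame fields. -/
theorem coframe_cov_sum (a d : Idx n) {F : Idx n → M → ℝ}
    (hF : ∀ e, SmoothFn (n := n) (F e) U) {x : M} (hx : x ∈ U) :
    f.coframe C d x (C.cov (fun y => ∑ e, F e y • f.vec C e y) x (f.vec C a x))
      = dirDeriv (F d) x (f.vec C a x) + ∑ e, F e x * f.conn C a e d x := by
  have key : ∀ s : Finset (Idx n),
      C.cov (fun y => ∑ e ∈ s, F e y • f.vec C e y) x (f.vec C a x)
      = ∑ e ∈ s, (dirDeriv (F e) x (f.vec C a x) • f.vec C e x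
        + F e x • C.cov (f.vec C e) x (f.vec C a x)) := by
    intro s
    induction s using Finset.induction_on with
    | empty =>
      simp only [Finset.sum_empty]
      have := congrFun C.cov.zero x
      exact congrArg (fun L => L (f.vec C a x)) this
    | insert e s he ih =>
      simp only [Finset.sum_insert he]
      rw [← ih]
      have h1 := C.cov.isCovariantDerivativeOnUniv.add (x := x)
        (((f.vec_smooth C e).smul (hF e)).diffAt f.isOpen hx)
        ((VF.SmoothOn.sum (s := s) (X := fun e x => F e x • f.vec C e x) fun e _ =>
          (f.vec_smooth C e).smul (hF e)).diffAt f.isOpen hx)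
      have h2 := C.cov.isCovariantDerivativeOnUniv.leibniz (x := x)
        ((f.vec_smooth C e).diffAt f.isOpen hx) ((hF e).mdiffAt f.isOpen hx)
      refine (congrArg (fun L => L (f.vec C a x)) h1).trans ?_
      rw [h2]
      simp only [add_apply, smul_apply,
        ContinuousLinearMap.smulRight_apply, dirDeriv]
      abel
  rw [key, ← coframeL_apply, map_sum]
  simp only [map_add, map_smul, coframeL_apply, f.coframe_vec C _ _ hx, smul_eq_mul, mul_ite,
    mul_one, mul_zero, Finset.sum_add_distrib, Finset.sum_ite_eq, Finset.mem_univ, if_true]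
  rfl

theorem coframe_cov_cov [T2Space M] (a b c d : Idx n) {x : M} (hx : x ∈ U) :
    f.coframe C d x (C.cov (fun y => C.cov (f.vec C c) y (f.vec C b y)) x (f.vec C a x))
      = dirDeriv (f.conn C b c d) x (f.vec C a x)
        + ∑ e, f.conn C b c e x * f.conn C a e d x := by
  rw [← f.coframe_cov_sum C a d (fun e => f.conn_smooth C b c e) hx]
  congr 2
  have hs : VF.SmoothOn (n := n) (fun y => ∑ e, f.conn C b c e y • f.vec C e y) U :=
    VF.SmoothOn.sum (X := fun e x => f.conn C b c e x • f.vec C e x) fun e _ =>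
      (f.vec_smooth C e).smul (f.conn_smooth C b c e)
  refine C.cov.isCovariantDerivativeOnUniv.congr_of_eventuallyEq
    ((VF.SmoothOn.cov C.cov_smooth f.isOpen (f.vec_smooth C b) (f.vec_smooth C c)).diffAt
      f.isOpen hx) (hs.diffAt f.isOpen hx) Filter.univ_mem ?_
  filter_upwards [f.isOpen.mem_nhds hx] with y hy
  exact f.cov_vec C b c hy

theorem curv_eq [T2Space M] (a b c d : Idx n) {x : M} (hx : x ∈ U) :
    f.curv C ![a, b, c, d] x
      = (dirDeriv (f.conn C b c d) x (f.vec C a x)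
          + ∑ e, f.conn C b c e x * f.conn C a e d x)
        - (dirDeriv (f.conn C a c d) x (f.vec C b x)
          + ∑ e, f.conn C a c e x * f.conn C b e d x)
        - ∑ e, f.struct C a b e x * f.conn C e c d x := by
  have h : f.curv C ![a, b, c, d] x
      = f.coframeL C d x (C.curvature (f.vec C a) (f.vec C b) (f.vec C c) x) := rfl
  rw [h, BiquardConnection.curvature, map_sub, map_sub, f.mlieBracket_vec C a b hx, map_sum,
    map_sum]
  simp only [coframeL_apply, f.coframe_cov_cov C _ _ _ _ hx, map_smul, smul_eq_mul]
  rfl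


end SpFrame

end QC

/-! ### Quaternionic matrices; the axioms of the Biquard connection in the frame. -/

namespace QC

/-- The matrices of left multiplication by `i`, `j`, `k` on the quaternions. -/
def quatMat : Fin 3 → Matrix (Fin 4) (Fin 4) ℝ :=
  ![!![0, -1, 0, 0; 1, 0, 0, 0; 0, 0, 0, -1; 0, 0, 1, 0],
    !![0, 0, -1, 0; 0, 0, 0, 1; 1, 0, 0, 0; 0, -1, 0, 0],
    !![0, 0, 0, -1; 0, 0, -1, 0; 0, 1, 0, 0; 1, 0, 0, 0]]

/-- The matrices of the almost complex structures in an `Sp(n)Sp(1)` frame. -/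
def J (n : ℕ) (i : Fin 3) : Matrix (HIdx n) (HIdx n) ℝ :=
  Matrix.of fun α β => if α.1 = β.1 then quatMat i α.2 β.2 else 0

theorem J_skew {n : ℕ} (i : Fin 3) (α β : HIdx n) : J n i α β = -J n i β α := by
  obtain ⟨k, a⟩ := α
  obtain ⟨l, b⟩ := β
  simp only [J, Matrix.of_apply, eq_comm (a := l)]
  split_ifs
  · fin_cases i <;> fin_cases a <;> fin_cases b <;> simp [quatMat]
  · simp

namespace PseudohermitianStructure

variable {n : ℕ} {M : Type*} [TopologicalSpace M] [ChartedSpace (Model n) M]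
  [IsManifold (𝓡 (4 * n + 3)) ∞ M] (P : PseudohermitianStructure n M)

theorem mem_H_iff {x : M} {v : TangentSpace (𝓡 (4 * n + 3)) x} :
    v ∈ P.H x ↔ ∀ j, P.η j x v = 0 := SpFrame.mem_H_iff

theorem I_mem_H (i : Fin 3) {x : M} {v : TangentSpace (𝓡 (4 * n + 3)) x} (hv : v ∈ P.H x) :
    P.I i x v ∈ P.H x :=
  P.mem_H_iff.2 (P.I_mem i x v (P.mem_H_iff.1 hv))

theorem I_I_self (i : Fin 3) {x : M} {v : TangentSpace (𝓡 (4 * n + 3)) x} (hv : v ∈ P.H x) :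
    P.I i x (P.I i x v) = -v :=
  P.I_sq i x v (P.mem_H_iff.1 hv)

theorem I_zero_one {x : M} {v : TangentSpace (𝓡 (4 * n + 3)) x} (hv : v ∈ P.H x) :
    P.I 0 x (P.I 1 x v) = P.I 2 x v := by
  have h := P.I_mul x _ (P.mem_H_iff.1 (P.I_mem_H 2 hv))
  rw [P.I_I_self 2 hv] at h
  simpa using h

/-- Anticommutation is not among the axioms. It follows by expanding the square of `I 2`, which is
-1, as the square of the product of `I 0` and `I 1`. -/
theorem I_one_zero {x : M} {v : TangentSpace (𝓡 (4 * n + 3)) x} (hv : v ∈ P.H x) :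
    P.I 1 x (P.I 0 x v) = -P.I 2 x v := by
  have h1 : P.I 1 x v ∈ P.H x := P.I_mem_H 1 hv
  have e := P.I_I_self 2 h1
  rw [← P.I_zero_one h1, ← P.I_zero_one (P.I_mem_H 0 (P.I_mem_H 1 h1))] at e
  rw [P.I_I_self 1 hv, map_neg, map_neg, map_neg] at e
  have e2 := congrArg (P.I 0 x) e
  rw [map_neg, P.I_I_self 0 (P.I_mem_H 1 (P.I_mem_H 0 hv)), map_neg, P.I_zero_one hv] at e2
  simpa using e2

theorem I_one_two {x : M} {v : TangentSpace (𝓡 (4 * n + 3)) x} (hv : v ∈ P.H x) :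
    P.I 1 x (P.I 2 x v) = P.I 0 x v := by
  rw [← P.I_zero_one hv, P.I_one_zero (P.I_mem_H 1 hv), ← P.I_zero_one (P.I_mem_H 1 hv),
    P.I_I_self 1 hv]
  simp

theorem I_two_one {x : M} {v : TangentSpace (𝓡 (4 * n + 3)) x} (hv : v ∈ P.H x) :
    P.I 2 x (P.I 1 x v) = -P.I 0 x v := by
  rw [← P.I_zero_one (P.I_mem_H 1 hv), P.I_I_self 1 hv]
  simp

theorem I_zero_two {x : M} {v : TangentSpace (𝓡 (4 * n + 3)) x} (hv : v ∈ P.H x) :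
    P.I 0 x (P.I 2 x v) = -P.I 1 x v := by
  rw [← P.I_zero_one hv, P.I_I_self 0 (P.I_mem_H 1 hv)]

theorem I_two_zero {x : M} {v : TangentSpace (𝓡 (4 * n + 3)) x} (hv : v ∈ P.H x) :
    P.I 2 x (P.I 0 x v) = P.I 1 x v := by
  rw [← P.I_zero_one (P.I_mem_H 0 hv), P.I_one_zero hv, map_neg, P.I_zero_two hv]
  simp

end PseudohermitianStructure

namespace SpFrame

variable {n : ℕ} {M : Type*} [TopologicalSpace M] [ChartedSpace (Model n) M]
  [IsManifold (𝓡 (4 * n + 3)) ∞ M] {P : PseudohermitianStructure n M} {U : Set M}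
  (f : SpFrame P U) (C : BiquardConnection P)

theorem I_ξ (i : Fin 3) (β : HIdx n) {x : M} (hx : x ∈ U) :
    P.I i x (f.ξ β x) = ∑ α, J n i α β • f.ξ α x := by
  obtain ⟨k, b⟩ := β
  have h0 := f.mem_H (k, 0) x hx
  have e0 : f.ξ (k, 1) x = P.I 0 x (f.ξ (k, 0) x) := f.quaternionic k 0 x hx
  have e1 : f.ξ (k, 2) x = P.I 1 x (f.ξ (k, 0) x) := f.quaternionic k 1 x hx
  have e2 : f.ξ (k, 3) x = P.I 2 x (f.ξ (k, 0) x) := f.quaternionic k 2 x hx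
  have hs : ∑ α, J n i α (k, b) • f.ξ α x = ∑ a, quatMat i a b • f.ξ (k, a) x := by
    rw [Fintype.sum_prod_type]
    rw [Finset.sum_eq_single k]
    · simp [J]
    · intro l _ hl
      simp [J, hl]
    · simp
  rw [hs, Fin.sum_univ_four, e0, e1, e2]
  fin_cases b <;> fin_cases i <;>
    simp [quatMat, e0, e1, e2, P.I_I_self _ h0, P.I_zero_one h0, P.I_one_zero h0,
      P.I_one_two h0, P.I_two_one h0, P.I_two_zero h0, P.I_zero_two h0]

/-- The point of an Sp(n)Sp(1) frame: these components do not depend on the point, so frame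
derivatives do not see them. -/
theorem acs_eq (i : Fin 3) (α β : HIdx n) {x : M} (hx : x ∈ U) : f.acs i α β x = J n i α β := by
  rw [acs, f.I_ξ i β hx]
  simp [map_sum, f.orthonormal _ _ x hx]

theorem eventually_mem_H (β : HIdx n) {x : M} (hx : x ∈ U) : ∀ᶠ y in 𝓝 x, f.ξ β y ∈ P.H y := by
  filter_upwards [f.isOpen.mem_nhds hx] with y hy using f.mem_H β y hy

theorem cov_ξ_mem (β : HIdx n) {x : M} (hx : x ∈ U) (v) : C.cov (f.ξ β) x v ∈ P.H x :=
  C.cov_H x _ ((f.smooth β).diffAt f.isOpen hx) (f.eventually_mem_H β hx) v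

theorem cov_reeb_mem (j : Fin 3) (x : M) (v) : C.cov (C.reeb j) x v ∈ vertSpan C.reeb x :=
  C.cov_V x _ ((C.reeb_smooth j).diffAt isOpen_univ (Set.mem_univ x))
    (Filter.Eventually.of_forall fun _ => Submodule.subset_span ⟨j, rfl⟩) v

theorem conn_inl_inr (a : Idx n) (β : HIdx n) (k : Fin 3) {x : M} (hx : x ∈ U) :
    f.conn C a (Sum.inl β) (Sum.inr k) x = 0 := by
  rw [conn, coframe_inr]
  exact mem_H_iff.1 (f.cov_ξ_mem C β hx _) k

theorem hor_of_mem_vertSpan {x : M} {v : TangentSpace (𝓡 (4 * n + 3)) x}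
    (hv : v ∈ vertSpan C.reeb x) : C.hor x v = 0 := by
  obtain ⟨c, rfl⟩ := (Submodule.mem_span_range_iff_exists_fun ℝ).1 hv
  simp [BiquardConnection.hor, map_sum, C.η_reeb]

theorem conn_inr_inl (a : Idx n) (j : Fin 3) (β : HIdx n) {x : M} (hx : x ∈ U) :
    f.conn C a (Sum.inr j) (Sum.inl β) x = 0 := by
  rw [conn, f.coframe_inl C β hx]
  have := hor_of_mem_vertSpan C (cov_reeb_mem C j x (f.vec C a x))
  simp only [vec, Sum.elim_inr] at this ⊢
  rw [this, map_zero]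

theorem conn_inl_inl (a : Idx n) (β γ : HIdx n) {x : M} (hx : x ∈ U) :
    f.conn C a (Sum.inl β) (Sum.inl γ) x
      = P.g x (f.ξ γ x) (C.cov (f.ξ β) x (f.vec C a x)) := by
  rw [conn, f.coframe_inl C γ hx]
  simp only [vec, Sum.elim_inl]
  rw [hor_of_mem C (f.cov_ξ_mem C β hx _)]

theorem conn_skew (a : Idx n) (β γ : HIdx n) {x : M} (hx : x ∈ U) :
    f.conn C a (Sum.inl β) (Sum.inl γ) x = -f.conn C a (Sum.inl γ) (Sum.inl β) x := by
  have h := C.cov_g x (f.ξ β) (f.ξ γ) ((f.smooth β).diffAt f.isOpen hx)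
    ((f.smooth γ).diffAt f.isOpen hx) (f.eventually_mem_H β hx) (f.eventually_mem_H γ hx)
    (f.vec C a x)
  have h0 : dirDeriv (fun y => P.g y (f.ξ β y) (f.ξ γ y)) x (f.vec C a x) = 0 := by
    rw [dirDeriv_congr (G := fun _ => if β = γ then 1 else 0)]
    · simp [dirDeriv, mvfderiv_const]
    · filter_upwards [f.isOpen.mem_nhds hx] with y hy using f.orthonormal β γ y hy
  rw [h0] at h
  rw [f.conn_inl_inl C a β γ hx, f.conn_inl_inl C a γ β hx,
    P.g_symm x (f.ξ γ x) _ (mem_H_iff.1 (f.mem_H γ x hx)) (mem_H_iff.1 (f.cov_ξ_mem C β hx _))]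
  linarith

/-- Parallelism of the isomorphism `V → span {I_i}` in the frame. -/
theorem conn_J (a : Idx n) (j : Fin 3) (β ε : HIdx n) {x : M} (hx : x ∈ U) :
    ∑ δ, J n j δ β * f.conn C a (Sum.inl δ) (Sum.inl ε) x
      = ∑ i, f.conn C a (Sum.inr j) (Sum.inr i) x * J n i ε β
        + ∑ δ, f.conn C a (Sum.inl β) (Sum.inl δ) x * J n j ε δ := by
  have h := C.cov_φ x (C.reeb j) (f.ξ β) ((C.reeb_smooth j).diffAt isOpen_univ (Set.mem_univ x))
    ((f.smooth β).diffAt f.isOpen hx)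
    (Filter.Eventually.of_forall fun _ => Submodule.subset_span ⟨j, rfl⟩)
    (f.eventually_mem_H β hx) (f.vec C a x)
  let F : Idx n → M → ℝ := fun e => Sum.elim (fun δ _ => J n j δ β) (fun _ _ => 0) e
  have hF : ∀ e, SmoothFn (n := n) (F e) U := by
    rintro (δ | i)
    · exact SmoothFn.const _
    · exact SmoothFn.const _
  have hs : VF.SmoothOn (n := n) (fun y => ∑ e, F e y • f.vec C e y) U :=
    VF.SmoothOn.sum (X := fun e x => F e x • f.vec C e x) fun e _ =>
      (f.vec_smooth C e).smul (hF e)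
  have heq : ∀ y ∈ U, ∑ i, P.η i y (C.reeb j y) • P.I i y (f.ξ β y)
      = ∑ e, F e y • f.vec C e y := by
    intro y hy
    rw [Fintype.sum_sum_type]
    simp [F, vec, C.η_reeb, f.I_ξ j β hy]
  have hs' : VF.SmoothOn (n := n) (fun y => ∑ i, P.η i y (C.reeb j y) • P.I i y (f.ξ β y)) U :=
    hs.congr heq
  have hc := C.cov.isCovariantDerivativeOnUniv.congr_of_eventuallyEq
    (hs'.diffAt f.isOpen hx) (hs.diffAt f.isOpen hx) Filter.univ_mem
    (by filter_upwards [f.isOpen.mem_nhds hx] with y hy using heq y hy)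
  rw [hc] at h
  have h2 := congrArg (f.coframeL C (Sum.inl ε) x) h
  rw [coframeL_apply, f.coframe_cov_sum C a (Sum.inl ε) hF hx] at h2
  have hd : dirDeriv (F (Sum.inl ε)) x (f.vec C a x) = 0 := by
    simp [F, dirDeriv, mvfderiv_const]
  have hcξ : C.cov (f.ξ β) x (f.vec C a x)
      = ∑ δ, f.conn C a (Sum.inl β) (Sum.inl δ) x • f.ξ δ x := by
    simp_rw [f.conn_inl_inl C a β _ hx]
    exact f.eq_sum_of_mem_H hx (f.cov_ξ_mem C β hx _)
  have hη : ∀ i, P.η i x (C.cov (C.reeb j) x (f.vec C a x))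
      = f.conn C a (Sum.inr j) (Sum.inr i) x := fun i => by
    rw [conn, coframe_inr]; rfl
  have hξ : ∀ α, f.coframeL C (Sum.inl ε) x (f.ξ α x) = if ε = α then 1 else 0 := fun α => by
    have := f.coframe_vec C (Sum.inl ε) (Sum.inl α) hx
    simpa [vec, coframeL_apply] using this
  have hI : ∀ i β, f.coframeL C (Sum.inl ε) x (P.I i x (f.ξ β x)) = J n i ε β := fun i β => by
    rw [f.I_ξ i β hx, map_sum]
    simp [hξ]
  rw [hd, Fintype.sum_sum_type] at h2
  simp only [hcξ, hη, C.η_reeb, map_add, map_sum, map_smul, hI, smul_eq_mul, F, Sum.elim_inl,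
    Sum.elim_inr, zero_mul, Finset.sum_const_zero, add_zero, zero_add] at h2
  rw [h2]
  simp

theorem tor_skew (a b c : Idx n) (x : M) : f.tor C a b c x = -f.tor C a c b x := by
  rw [tor, C.cov.torsion_antisymm, ← coframeL_apply, map_neg]
  rfl

theorem tor_inl_inl_inl (α β γ : HIdx n) {x : M} (hx : x ∈ U) :
    f.tor C (Sum.inl α) (Sum.inl β) (Sum.inl γ) x = 0 := by
  rw [tor, f.coframe_inl C α hx, hor_of_mem_vertSpan C, map_zero]
  exact C.torsion_HH x _ (f.mem_H β x hx) _ (f.mem_H γ x hx)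

theorem tor_inr_inr_inl (i j : Fin 3) (β : HIdx n) {x : M} (hx : x ∈ U) :
    f.tor C (Sum.inr i) (Sum.inr j) (Sum.inl β) x = 0 := by
  rw [tor, coframe_inr]
  exact mem_H_iff.1 (C.torsion_VH x _ (Submodule.subset_span ⟨j, rfl⟩) _ (f.mem_H β x hx)) i

/-- Since ∇ preserves H, η^i(T(X,Y)) = -η^i([X,Y]) = dη^i(X,Y) = 2g(I_i X, Y) for horizontal X, Y.
The sign comes from exchanging the indices of the skew matrix. -/
theorem tor_inr_inl_inl (i : Fin 3) (α β : HIdx n) {x : M} (hx : x ∈ U) :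
    f.tor C (Sum.inr i) (Sum.inl α) (Sum.inl β) x = -2 * J n i α β := by
  have h := P.compat i x (f.ξ α) (f.ξ β) ((f.smooth α).diffAt f.isOpen hx)
    ((f.smooth β).diffAt f.isOpen hx) (mem_H_iff.1 (f.mem_H α x hx))
    (mem_H_iff.1 (f.mem_H β x hx))
  have h0 : ∀ (α : HIdx n) (v : TangentSpace (𝓡 (4 * n + 3)) x), dirDeriv (fun y => P.η i y (f.ξ α y)) x v = 0 := by
    intro α v
    rw [dirDeriv_congr (G := fun _ => 0)]
    · simp [dirDeriv, mvfderiv_const]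
    · filter_upwards [f.isOpen.mem_nhds hx] with y hy using f.η_ξ i α hy
  have hg : P.g x (P.I i x (f.ξ α x)) (f.ξ β x) = J n i β α := by
    rw [P.g_symm x _ _ (mem_H_iff.1 (P.I_mem_H i (f.mem_H α x hx)))
      (mem_H_iff.1 (f.mem_H β x hx)), ← f.acs_eq i β α hx]
    rfl
  rw [extDeriv₁, h0, h0, hg] at h
  have ht := congrArg (P.η i x) (f.torsion_vec C (Sum.inl α) (Sum.inl β) hx)
  rw [map_sub, map_sub] at ht
  simp only [vec, Sum.elim_inl, mem_H_iff.1 (f.cov_ξ_mem C _ hx _) i] at ht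
  rw [tor, coframe_inr]
  simp only [vec, Sum.elim_inl]
  rw [ht, J_skew]
  linarith

theorem torsion_reeb_ξ (i : Fin 3) (β : HIdx n) {x : M} (hx : x ∈ U) :
    C.cov.torsion x (C.reeb i x) (f.ξ β x)
      = ∑ α, f.tor C (Sum.inl α) (Sum.inr i) (Sum.inl β) x • f.ξ α x := by
  have hm := C.torsion_VH x _ (Submodule.subset_span ⟨i, rfl⟩) _ (f.mem_H β x hx)
  rw [f.eq_sum_of_mem_H hx hm]
  refine Finset.sum_congr rfl fun α _ => ?_
  rw [tor, f.coframe_inl C α hx]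
  simp only [vec, Sum.elim_inl, Sum.elim_inr]
  rw [hor_of_mem C hm]

theorem tor_trace_J (i k : Fin 3) {x : M} (hx : x ∈ U) :
    ∑ β, ∑ α, f.tor C (Sum.inl α) (Sum.inr i) (Sum.inl β) x * J n k α β = 0 := by
  have h := C.torsion_perp x (C.reeb i x) (Submodule.subset_span ⟨i, rfl⟩)
    (P.I k x).toLinearMap (Or.inr ⟨fun j => if j = k then 1 else 0, fun v _ => by simp⟩)
    (fun α => f.ξ α x) (fun α => f.mem_H α x hx) (fun α β => f.orthonormal α β x hx)
  simp only [f.torsion_reeb_ξ C i _ hx, map_sum, map_smul, ContinuousLinearMap.coe_coe,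
    sum_apply, smul_apply, smul_eq_mul] at h
  rw [← h]
  refine Finset.sum_congr rfl fun β _ => Finset.sum_congr rfl fun α _ => ?_
  rw [← f.acs_eq k α β hx]
  rfl

/-- Orthogonality of the torsion to `sp(n)` in the frame. -/
theorem tor_perp_spn (i : Fin 3) (A : Matrix (HIdx n) (HIdx n) ℝ) (hA : A.transpose = -A)
    (hJ : ∀ k, A * J n k = J n k * A) {x : M} (hx : x ∈ U) :
    ∑ β, ∑ α, f.tor C (Sum.inl α) (Sum.inr i) (Sum.inl β) x * A α β = 0 := by
  let L : TangentSpace (𝓡 (4 * n + 3)) x →ₗ[ℝ] TangentSpace (𝓡 (4 * n + 3)) x :=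
    ∑ α, ∑ β, A α β • (f.coframeL C (Sum.inl β) x).smulRight (f.ξ α x)
  have hξ : ∀ α β, f.coframeL C (Sum.inl β) x (f.ξ α x) = if β = α then 1 else 0 := fun α β => by
    have := f.coframe_vec C (Sum.inl β) (Sum.inl α) hx
    simpa [vec, coframeL_apply] using this
  have hL : ∀ β, L (f.ξ β x) = ∑ α, A α β • f.ξ α x := fun β => by
    simp [L, LinearMap.sum_apply, hξ]
  have hspan : ∀ v ∈ P.H x, ∃ c : HIdx n → ℝ, v = ∑ β, c β • f.ξ β x := fun v hv =>
    ⟨_, f.eq_sum_of_mem_H hx hv⟩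
  have hmem : ∀ β, L (f.ξ β x) ∈ P.H x := fun β => by
    rw [hL]
    exact Submodule.sum_mem _ fun α _ => Submodule.smul_mem _ _ (f.mem_H α x hx)
  have hA' : ∀ α β, A α β = -A β α := fun α β => by
    have := congrFun (congrFun hA β) α
    simpa using this
  have hg1 : ∀ α β, P.g x (L (f.ξ α x)) (f.ξ β x) = A β α := fun α β => by
    rw [hL]
    simp [map_sum, sum_apply, f.orthonormal _ _ x hx]
  have hg2 : ∀ α β, P.g x (f.ξ α x) (L (f.ξ β x)) = A α β := fun α β => by
    rw [hL]
    simp [map_sum, f.orthonormal _ _ x hx]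
  have hsp : P.IsSpn x L := by
    refine ⟨fun v hv => ?_, fun v hv w hw => ?_, fun k v hv => ?_⟩
    · obtain ⟨c, rfl⟩ := hspan v hv
      rw [map_sum]
      exact Submodule.sum_mem _ fun β _ => by
        rw [map_smul]; exact Submodule.smul_mem _ _ (hmem β)
    · obtain ⟨c, rfl⟩ := hspan v hv
      obtain ⟨d, rfl⟩ := hspan w hw
      simp only [map_sum, map_smul, sum_apply, smul_apply, smul_eq_mul, hg1, hg2]
      rw [← Finset.sum_neg_distrib]
      refine Finset.sum_congr rfl fun α _ => ?_
      rw [← mul_neg, ← Finset.sum_neg_distrib]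
      refine congrArg _ (Finset.sum_congr rfl fun β _ => ?_)
      rw [hA' α β]
      ring
    · obtain ⟨c, rfl⟩ := hspan v hv
      simp only [map_sum, map_smul]
      refine Finset.sum_congr rfl fun β _ => congrArg _ ?_
      rw [f.I_ξ k β hx, hL]
      simp only [map_sum, map_smul, hL, f.I_ξ k _ hx, Finset.smul_sum, smul_smul]
      rw [Finset.sum_comm]
      conv_rhs => rw [Finset.sum_comm]
      refine Finset.sum_congr rfl fun ε _ => ?_
      rw [← Finset.sum_smul, ← Finset.sum_smul]
      congr 1
      have := congrFun (congrFun (hJ k) ε) β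
      rw [Matrix.mul_apply, Matrix.mul_apply] at this
      rw [← Finset.sum_congr rfl fun δ _ => mul_comm (A ε δ) (J n k δ β), this]
      exact Finset.sum_congr rfl fun δ _ => mul_comm _ _
  have h := C.torsion_perp x (C.reeb i x) (Submodule.subset_span ⟨i, rfl⟩) L (Or.inl hsp)
    (fun α => f.ξ α x) (fun α => f.mem_H α x hx) (fun α β => f.orthonormal α β x hx)
  simp only [f.torsion_reeb_ξ C i _ hx, map_sum, map_smul, sum_apply, smul_apply, smul_eq_mul,
    hg2] at h
  exact h

end SpFrame

end QC

/-! ### The abstract frame calculus, the first Bianchi identity, curvature as matrices. -/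

namespace QC

open Matrix

/-- `J_i J_j` for the quaternionic matrices. -/
theorem J_mul_J {n : ℕ} (i j : Fin 3) (M : Matrix (Fin 4) (Fin 4) ℝ)
    (h : quatMat i * quatMat j = M) :
    J n i * J n j = Matrix.of fun α β => if α.1 = β.1 then M α.2 β.2 else 0 := by
  subst h
  ext ⟨k, a⟩ ⟨l, b⟩
  simp only [J, Matrix.mul_apply, Matrix.of_apply, Fintype.sum_prod_type]
  by_cases hkl : k = l
  · subst hkl
    rw [Finset.sum_eq_single k (fun m _ hm => by simp [hm.symm]) (by simp)]
    simp
  · rw [if_neg hkl]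
    refine Finset.sum_eq_zero fun m _ => Finset.sum_eq_zero fun c _ => ?_
    by_cases h1 : k = m
    · subst h1
      simp [hkl]
    · simp [h1]

theorem quatMat_mul_self (i : Fin 3) : quatMat i * quatMat i = -1 := by
  fin_cases i <;> ext a b <;> fin_cases a <;> fin_cases b <;>
    simp [quatMat, Matrix.mul_apply, Fin.sum_univ_four]

theorem quatMat_zero_one : quatMat 0 * quatMat 1 = quatMat 2 := by
  ext a b
  fin_cases a <;> fin_cases b <;> simp [quatMat, Matrix.mul_apply, Fin.sum_univ_four]

theorem J_mul_self {n : ℕ} (i : Fin 3) : J n i * J n i = -1 := by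
  rw [J_mul_J i i _ (quatMat_mul_self i)]
  ext ⟨k, a⟩ ⟨l, b⟩
  by_cases h1 : k = l <;> by_cases h2 : a = b <;>
    simp [Matrix.one_apply, h1, h2]

theorem J_zero_one {n : ℕ} : J n 0 * J n 1 = J n 2 := by
  rw [J_mul_J 0 1 _ quatMat_zero_one, J]

theorem J_transpose {n : ℕ} (i : Fin 3) : (J n i)ᵀ = -J n i := by
  ext α β
  exact J_skew i β α

theorem eps_eq (i j k : Fin 3) : eps i j k =
    (![![![0, 0, 0], ![0, 0, 1], ![0, -1, 0]], ![![0, 0, -1], ![0, 0, 0], ![1, 0, 0]],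
      ![![0, 1, 0], ![-1, 0, 0], ![0, 0, 0]]] : Fin 3 → Fin 3 → Fin 3 → ℝ) i j k := by
  fin_cases i <;> fin_cases j <;> fin_cases k <;> simp [eps, Matrix.det_fin_three]

/-- Components of the Biquard connection in an `Sp(n)Sp(1)` frame, as elements of an algebra
of functions on which the frame acts by derivations. -/
structure FrameCalculus (n : ℕ) (𝒜 : Type*) [CommRing 𝒜] [Algebra ℝ 𝒜] where
  D : Idx n → Derivation ℝ 𝒜 𝒜
  /-- Connection coefficients `Γ a b c = θ^c(∇_a ξ_b)`. -/
  Γ : Idx n → Idx n → Idx n → 𝒜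
  /-- Torsion components `T a b c = θ^a(T(ξ_b, ξ_c))`. -/
  T : Idx n → Idx n → Idx n → 𝒜
  T_skew : ∀ a b c, T a b c = -T a c b
  D_comm : ∀ a b F, D a (D b F) - D b (D a F) = ∑ d, (Γ a b d - Γ b a d - T d a b) * D d F
  jacobi : ∀ a b c d,
    (D a (Γ b c d - Γ c b d - T d b c)
        + ∑ e, (Γ b c e - Γ c b e - T e b c) * (Γ a e d - Γ e a d - T d a e))
      + (D b (Γ c a d - Γ a c d - T d c a)
        + ∑ e, (Γ c a e - Γ a c e - T e c a) * (Γ b e d - Γ e b d - T d b e))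
      + (D c (Γ a b d - Γ b a d - T d a b)
        + ∑ e, (Γ a b e - Γ b a e - T e a b) * (Γ c e d - Γ e c d - T d c e)) = 0
  Γ_hv : ∀ a β k, Γ a (Sum.inl β) (Sum.inr k) = 0
  Γ_vh : ∀ a k β, Γ a (Sum.inr k) (Sum.inl β) = 0
  Γ_skew : ∀ a β γ, Γ a (Sum.inl β) (Sum.inl γ) = -Γ a (Sum.inl γ) (Sum.inl β)
  Γ_J : ∀ a j β ε, ∑ δ, algebraMap ℝ 𝒜 (J n j δ β) * Γ a (Sum.inl δ) (Sum.inl ε)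
      = ∑ i, Γ a (Sum.inr j) (Sum.inr i) * algebraMap ℝ 𝒜 (J n i ε β)
        + ∑ δ, Γ a (Sum.inl β) (Sum.inl δ) * algebraMap ℝ 𝒜 (J n j ε δ)
  T_hhh : ∀ α β γ, T (Sum.inl α) (Sum.inl β) (Sum.inl γ) = 0
  T_vvh : ∀ i j β, T (Sum.inr i) (Sum.inr j) (Sum.inl β) = 0
  T_vhh : ∀ i α β, T (Sum.inr i) (Sum.inl α) (Sum.inl β) = -2 * algebraMap ℝ 𝒜 (J n i α β)
  T_trace_J : ∀ i k, ∑ β, ∑ α, T (Sum.inl α) (Sum.inr i) (Sum.inl β)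
    * algebraMap ℝ 𝒜 (J n k α β) = 0
  -- The operator X ↦ ∑ J_j X J_j has eigenvalue -3 on matrices commuting with all J_j and
  -- eigenvalue 1 on the complement. For a skew matrix, orthogonality to sp(n) is thus the
  -- eigenvalue equation with eigenvalue 1, which makes sense over any algebra.
  T_spn : ∀ i (b : Matrix (HIdx n) (HIdx n) 𝒜),
    (b = Matrix.of fun α β => T (Sum.inl α) (Sum.inr i) (Sum.inl β)
      - T (Sum.inl β) (Sum.inr i) (Sum.inl α)) →
    b = ∑ j, (J n j).map (algebraMap ℝ 𝒜) * b * (J n j).map (algebraMap ℝ 𝒜)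

namespace FrameCalculus

set_option linter.unusedSectionVars false

variable {n : ℕ} {𝒜 : Type*} [CommRing 𝒜] [Algebra ℝ 𝒜] (K : FrameCalculus n 𝒜)

/-- Curvature components `R a b c d = θ^d(R(ξ_a, ξ_b)ξ_c)`. -/
def R (a b c d : Idx n) : 𝒜 :=
  (K.D a (K.Γ b c d) + ∑ e, K.Γ b c e * K.Γ a e d)
    - (K.D b (K.Γ a c d) + ∑ e, K.Γ a c e * K.Γ b e d)
    - ∑ e, (K.Γ a b e - K.Γ b a e - K.T e a b) * K.Γ e c d

/-- Covariant derivative of the torsion: `T^d_{bc,a}`. -/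
def NT (d b c a : Idx n) : 𝒜 :=
  K.D a (K.T d b c) + ∑ e, K.Γ a e d * K.T e b c - ∑ e, K.Γ a b e * K.T d e c
    - ∑ e, K.Γ a c e * K.T d b e

/-- The first Bianchi identity. -/
theorem bianchi (a b c d : Idx n) :
    K.R a b c d + K.R b c a d + K.R c a b d
      = K.NT d b c a + K.NT d c a b + K.NT d a b c
        + ∑ e, (K.T e a b * K.T d e c + K.T e b c * K.T d e a + K.T e c a * K.T d e b) := by
  -- The quadratic terms of the two sides differ, summand by summand in e, by those of the Jacobi
  -- identity. The derivative terms are then exactly those of `jacobi`.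
  have key : ∀ e, K.Γ b c e * K.Γ a e d - K.Γ a c e * K.Γ b e d
        - (K.Γ a b e - K.Γ b a e - K.T e a b) * K.Γ e c d
        + (K.Γ c a e * K.Γ b e d - K.Γ b a e * K.Γ c e d
        - (K.Γ b c e - K.Γ c b e - K.T e b c) * K.Γ e a d)
        + (K.Γ a b e * K.Γ c e d - K.Γ c b e * K.Γ a e d
        - (K.Γ c a e - K.Γ a c e - K.T e c a) * K.Γ e b d)
      - (K.Γ a e d * K.T e b c - K.Γ a b e * K.T d e c - K.Γ a c e * K.T d b e)
      - (K.Γ b e d * K.T e c a - K.Γ b c e * K.T d e a - K.Γ b a e * K.T d c e)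
      - (K.Γ c e d * K.T e a b - K.Γ c a e * K.T d e b - K.Γ c b e * K.T d a e)
      - (K.T e a b * K.T d e c + K.T e b c * K.T d e a + K.T e c a * K.T d e b)
      = (K.Γ b c e - K.Γ c b e - K.T e b c) * (K.Γ a e d - K.Γ e a d - K.T d a e)
        + (K.Γ c a e - K.Γ a c e - K.T e c a) * (K.Γ b e d - K.Γ e b d - K.T d b e)
        + (K.Γ a b e - K.Γ b a e - K.T e a b) * (K.Γ c e d - K.Γ e c d - K.T d c e) := by
    intro e
    rw [K.T_skew d e a, K.T_skew d e b, K.T_skew d e c]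
    ring
  have h := Finset.sum_congr (rfl : (Finset.univ : Finset (Idx n)) = Finset.univ)
    fun e _ => key e
  have j := K.jacobi a b c d
  simp only [Finset.sum_add_distrib, Finset.sum_sub_distrib] at h
  simp only [map_sub] at j
  simp only [R, NT, Finset.sum_add_distrib]
  linear_combination h + j

/-- The almost complex structures as matrices over `𝒜`. -/
def jm (n : ℕ) (𝒜 : Type*) [CommRing 𝒜] [Algebra ℝ 𝒜] (i : Fin 3) :
    Matrix (HIdx n) (HIdx n) 𝒜 := (J n i).map (algebraMap ℝ 𝒜)

local notation "𝕁" => jm n 𝒜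

theorem jm_self (i : Fin 3) : 𝕁 i * 𝕁 i = -1 := by
  rw [jm, ← Matrix.map_mul, J_mul_self]
  ext α β
  by_cases h : α = β <;> simp [h]

theorem jm01 : 𝕁 0 * 𝕁 1 = 𝕁 2 := by
  rw [jm, jm, ← Matrix.map_mul, J_zero_one, jm]

theorem jm_transpose (i : Fin 3) : (𝕁 i)ᵀ = -𝕁 i := by
  rw [jm, ← Matrix.transpose_map, J_transpose]
  ext α β
  simp

theorem jm_apply_swap (i : Fin 3) (α β : HIdx n) : 𝕁 i α β = -𝕁 i β α := by
  have := congrFun (congrFun (jm_transpose (n := n) (𝒜 := 𝒜) i) β) α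
  simpa using this

theorem jm_self' (i : Fin 3) (X : Matrix (HIdx n) (HIdx n) 𝒜) : 𝕁 i * (𝕁 i * X) = -X := by
  rw [← mul_assoc, jm_self]; simp

theorem jm10 : 𝕁 1 * 𝕁 0 = -𝕁 2 := by
  have h := congrArg Matrix.transpose (jm01 (n := n) (𝒜 := 𝒜))
  rw [Matrix.transpose_mul, jm_transpose, jm_transpose, jm_transpose] at h
  simpa using h

theorem jm02 : 𝕁 0 * 𝕁 2 = -𝕁 1 := by
  rw [← jm01, jm_self']

theorem jm20 : 𝕁 2 * 𝕁 0 = 𝕁 1 := by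
  rw [← neg_neg (𝕁 2), ← jm10, neg_mul, mul_assoc, jm_self]; simp

theorem jm21 : 𝕁 2 * 𝕁 1 = -𝕁 0 := by
  rw [← jm01, mul_assoc, jm_self]; simp

theorem jm12 : 𝕁 1 * 𝕁 2 = 𝕁 0 := by
  rw [← neg_neg (𝕁 2), ← jm10, mul_neg, jm_self']; simp

theorem natCast_mul_cancel {k : ℕ} (hk : k ≠ 0) {x y : 𝒜} (h : (k : 𝒜) * x = k * y) : x = y := by
  have hk' : (k : ℝ) ≠ 0 := by exact_mod_cast hk
  have := congrArg (fun z => algebraMap ℝ 𝒜 (k : ℝ)⁻¹ * z) h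
  rw [← map_natCast (algebraMap ℝ 𝒜)] at this
  simpa only [← mul_assoc, ← map_mul, inv_mul_cancel₀ hk', map_one, one_mul] using this

theorem nsmul_cancel {k : ℕ} (hk : k ≠ 0) {X Y : Matrix (HIdx n) (HIdx n) 𝒜}
    (h : k • X = k • Y) : X = Y := by
  ext α β
  have := congrFun (congrFun h α) β
  simp only [Matrix.smul_apply, nsmul_eq_mul] at this
  exact natCast_mul_cancel hk this

theorem eq_zero_of_eq_neg {x : 𝒜} (h : x = -x) : x = 0 :=
  natCast_mul_cancel two_ne_zero (by push_cast; linear_combination h)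

theorem trace_jm (i : Fin 3) : (𝕁 i).trace = 0 := by
  have h := congrArg Matrix.trace (jm_transpose (n := n) (𝒜 := 𝒜) i)
  rw [Matrix.trace_transpose, Matrix.trace_neg] at h
  exact eq_zero_of_eq_neg h

theorem trace_one : (1 : Matrix (HIdx n) (HIdx n) 𝒜).trace = 4 * n := by
  rw [Matrix.trace_one]
  simp [mul_comm]

/-- `J_i J_j` has trace `-4n δ_ij`. -/
theorem trace_jm_mul (i j : Fin 3) :
    (𝕁 i * 𝕁 j).trace = if i = j then -(4 * n : 𝒜) else 0 := by
  fin_cases i <;> fin_cases j <;>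
    simp [jm_self, jm01, jm10, jm12, jm21, jm02, jm20, trace_jm, mul_comm]

/-- The connection matrices on `H`. -/
def Ω (a : Idx n) : Matrix (HIdx n) (HIdx n) 𝒜 :=
  Matrix.of fun δ β => K.Γ a (Sum.inl β) (Sum.inl δ)

/-- The connection coefficients on `V`. -/
def γ (a : Idx n) (j i : Fin 3) : 𝒜 := K.Γ a (Sum.inr j) (Sum.inr i)

theorem Ω_transpose (a : Idx n) : (K.Ω a)ᵀ = -K.Ω a := by
  ext α β
  exact K.Γ_skew a α β

theorem Ω_jm (a : Idx n) (j : Fin 3) :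
    K.Ω a * 𝕁 j - 𝕁 j * K.Ω a = ∑ i, K.γ a j i • 𝕁 i := by
  ext ε β
  have h := K.Γ_J a j β ε
  simp only [Matrix.sub_apply, Matrix.mul_apply, Matrix.sum_apply, Matrix.smul_apply, smul_eq_mul,
    Ω, γ, jm, Matrix.map_apply, Matrix.of_apply]
  rw [sub_eq_iff_eq_add]
  calc _ = ∑ δ, algebraMap ℝ 𝒜 (J n j δ β) * K.Γ a (Sum.inl δ) (Sum.inl ε) :=
        Finset.sum_congr rfl fun _ _ => mul_comm _ _
    _ = _ := by
      rw [h]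
      congr 1
      exact Finset.sum_congr rfl fun _ _ => mul_comm _ _

theorem trace_sum_smul_jm (c : Fin 3 → 𝒜) (k : Fin 3) :
    ((∑ i, c i • 𝕁 i) * 𝕁 k).trace = -(4 * n * c k) := by
  rw [Finset.sum_mul, Matrix.trace_sum]
  simp only [Matrix.smul_mul, Matrix.trace_smul, trace_jm_mul, smul_eq_mul, mul_ite, mul_zero]
  simp [mul_comm]

theorem trace_comm_jm (X : Matrix (HIdx n) (HIdx n) 𝒜) (i j : Fin 3) :
    ((X * 𝕁 i - 𝕁 i * X) * 𝕁 j).trace = (X * (𝕁 i * 𝕁 j)).trace - (X * (𝕁 j * 𝕁 i)).trace := by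
  rw [sub_mul, Matrix.trace_sub, mul_assoc, mul_assoc (𝕁 i), Matrix.trace_mul_comm (𝕁 i),
    mul_assoc]

/-- Metricity on V is not an axiom. It holds because V is identified with the span of the J_i:
tr([Ω, J_i] J_j) equals -4n times the coefficient and is skew in i, j. -/
theorem γ_skew (hn : n ≠ 0) (a : Idx n) (i j : Fin 3) : K.γ a i j = -K.γ a j i := by
  have h1 := trace_sum_smul_jm (n := n) (K.γ a i) j
  have h2 := trace_sum_smul_jm (n := n) (K.γ a j) i
  rw [← Ω_jm, trace_comm_jm] at h1 h2
  refine natCast_mul_cancel (k := 4 * n) (by omega) ?_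
  push_cast
  linear_combination h1 + h2

/-- Entrywise derivative of a matrix. -/
def DM (a : Idx n) (X : Matrix (HIdx n) (HIdx n) 𝒜) : Matrix (HIdx n) (HIdx n) 𝒜 :=
  X.map (K.D a)

theorem DM_add (a : Idx n) (X Y : Matrix (HIdx n) (HIdx n) 𝒜) :
    K.DM a (X + Y) = K.DM a X + K.DM a Y := by
  ext; simp [DM]

theorem DM_sub (a : Idx n) (X Y : Matrix (HIdx n) (HIdx n) 𝒜) :
    K.DM a (X - Y) = K.DM a X - K.DM a Y := by
  ext; simp [DM]

theorem DM_smul (a : Idx n) (c : 𝒜) (X : Matrix (HIdx n) (HIdx n) 𝒜) :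
    K.DM a (c • X) = K.D a c • X + c • K.DM a X := by
  ext
  simp only [DM, Matrix.map_apply, Matrix.smul_apply, smul_eq_mul, Derivation.leibniz,
    Matrix.add_apply]
  ring

theorem DM_mul (a : Idx n) (X Y : Matrix (HIdx n) (HIdx n) 𝒜) :
    K.DM a (X * Y) = K.DM a X * Y + X * K.DM a Y := by
  ext
  simp only [DM, Matrix.map_apply, Matrix.mul_apply, Derivation.leibniz, Matrix.add_apply, map_sum,
    ← Finset.sum_add_distrib, smul_eq_mul]
  exact Finset.sum_congr rfl fun _ _ => by ring

theorem DM_sum (a : Idx n) (X : Fin 3 → Matrix (HIdx n) (HIdx n) 𝒜) :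
    K.DM a (∑ i, X i) = ∑ i, K.DM a (X i) := by
  simp [Fin.sum_univ_three, DM_add]

theorem DM_jm (a : Idx n) (i : Fin 3) : K.DM a (𝕁 i) = 0 := by
  ext; simp [DM, jm]

/-- Covariant derivative of an endomorphism of `H`. -/
def N (a : Idx n) (X : Matrix (HIdx n) (HIdx n) 𝒜) : Matrix (HIdx n) (HIdx n) 𝒜 :=
  K.DM a X + K.Ω a * X - X * K.Ω a

theorem N_add (a : Idx n) (X Y : Matrix (HIdx n) (HIdx n) 𝒜) :
    K.N a (X + Y) = K.N a X + K.N a Y := by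
  simp only [N, DM_add]; noncomm_ring

theorem N_sub (a : Idx n) (X Y : Matrix (HIdx n) (HIdx n) 𝒜) :
    K.N a (X - Y) = K.N a X - K.N a Y := by
  simp only [N, DM_sub]; noncomm_ring

theorem N_mul (a : Idx n) (X Y : Matrix (HIdx n) (HIdx n) 𝒜) :
    K.N a (X * Y) = K.N a X * Y + X * K.N a Y := by
  simp only [N, DM_mul]; noncomm_ring

theorem N_jm (a : Idx n) (j : Fin 3) : K.N a (𝕁 j) = ∑ i, K.γ a j i • 𝕁 i := by
  rw [N, DM_jm, zero_add, Ω_jm]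

/-- The curvature as an endomorphism of `H`. -/
def RM (a b : Idx n) : Matrix (HIdx n) (HIdx n) 𝒜 :=
  Matrix.of fun δ β => K.R a b (Sum.inl β) (Sum.inl δ)

/-- The structure functions of the frame. -/
def c (a b e : Idx n) : 𝒜 := K.Γ a b e - K.Γ b a e - K.T e a b

theorem RM_eq (a b : Idx n) : K.RM a b = K.DM a (K.Ω b) - K.DM b (K.Ω a)
    + (K.Ω a * K.Ω b - K.Ω b * K.Ω a) - ∑ e, K.c a b e • K.Ω e := by
  ext δ β
  simp only [RM, R, DM, Ω, c, Matrix.of_apply, Matrix.sub_apply, Matrix.add_apply, Matrix.map_apply,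
    Matrix.mul_apply, Matrix.sum_apply, Matrix.smul_apply, smul_eq_mul]
  rw [Fintype.sum_sum_type (fun e => K.Γ b (Sum.inl β) e * K.Γ a e (Sum.inl δ)),
    Fintype.sum_sum_type (fun e => K.Γ a (Sum.inl β) e * K.Γ b e (Sum.inl δ))]
  simp only [Γ_hv, zero_mul, Finset.sum_const_zero, add_zero]
  simp only [mul_comm (K.Γ b (Sum.inl β) _), mul_comm (K.Γ a (Sum.inl β) _)]
  ring

theorem R_vv (a b : Idx n) (j i : Fin 3) : K.R a b (Sum.inr j) (Sum.inr i)
    = K.D a (K.γ b j i) - K.D b (K.γ a j i)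
      + ∑ k, (K.γ b j k * K.γ a k i - K.γ a j k * K.γ b k i)
      - ∑ e, K.c a b e * K.γ e j i := by
  simp only [R, γ, c]
  rw [Fintype.sum_sum_type (fun e => K.Γ b (Sum.inr j) e * K.Γ a e (Sum.inr i)),
    Fintype.sum_sum_type (fun e => K.Γ a (Sum.inr j) e * K.Γ b e (Sum.inr i))]
  simp only [Γ_vh, zero_mul, Finset.sum_const_zero, zero_add, Finset.sum_sub_distrib]
  ring

theorem R_hv (a b : Idx n) (β : HIdx n) (i : Fin 3) : K.R a b (Sum.inl β) (Sum.inr i) = 0 := by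
  simp only [R, Fintype.sum_sum_type, Γ_hv, map_zero, zero_mul, mul_zero,
    Finset.sum_const_zero, add_zero, sub_zero]

theorem R_vh (a b : Idx n) (β : HIdx n) (i : Fin 3) : K.R a b (Sum.inr i) (Sum.inl β) = 0 := by
  simp only [R, Fintype.sum_sum_type, Γ_vh, map_zero, zero_mul, mul_zero,
    Finset.sum_const_zero, add_zero, sub_zero]

theorem T_self (d a : Idx n) : K.T d a a = 0 := eq_zero_of_eq_neg (K.T_skew d a a)

theorem c_skew (a b e : Idx n) : K.c a b e = -K.c b a e := by
  rw [c, c, K.T_skew e a b]; ring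

theorem R_swap (a b c d : Idx n) : K.R a b c d = -K.R b a c d := by
  have h : ∀ a b, K.R a b c d = (K.D a (K.Γ b c d) + ∑ e, K.Γ b c e * K.Γ a e d)
    - (K.D b (K.Γ a c d) + ∑ e, K.Γ a c e * K.Γ b e d) - ∑ e, K.c a b e * K.Γ e c d :=
    fun _ _ => rfl
  rw [h a b, h b a]
  simp only [K.c_skew a b, neg_mul, Finset.sum_neg_distrib]
  ring

theorem RM_transpose (a b : Idx n) : (K.RM a b)ᵀ = -K.RM a b := by
  have hD : ∀ a b, (K.DM a (K.Ω b))ᵀ = -K.DM a (K.Ω b) := fun a b => by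
    rw [DM, ← Matrix.transpose_map, Ω_transpose]
    ext; simp
  rw [RM_eq]
  simp only [Matrix.transpose_sub, Matrix.transpose_add, Matrix.transpose_mul, hD, Ω_transpose,
    Matrix.transpose_sum, Matrix.transpose_smul, smul_neg, Finset.sum_neg_distrib]
  noncomm_ring

theorem R_skew (a b : Idx n) (β γ : HIdx n) :
    K.R a b (Sum.inl β) (Sum.inl γ) = -K.R a b (Sum.inl γ) (Sum.inl β) := by
  have := congrFun (congrFun (K.RM_transpose a b) β) γ
  simpa [RM] using this

/-- The identification of V with the span of the J_i is parallel, so the curvature of H acts on that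
span by the curvature of V. In matrices, each of the three kinds of terms in `RM_eq` is commuted
with J_j by means of `Ω_jm`. -/
theorem RM_jm (a b : Idx n) (j : Fin 3) :
    K.RM a b * 𝕁 j - 𝕁 j * K.RM a b = ∑ i, K.R a b (Sum.inr j) (Sum.inr i) • 𝕁 i := by
  have hD : ∀ a b, K.DM a (K.Ω b) * 𝕁 j - 𝕁 j * K.DM a (K.Ω b)
      = ∑ i, K.D a (K.γ b j i) • 𝕁 i := fun a b => by
    have := congrArg (K.DM a) (K.Ω_jm b j)
    rw [DM_sub, DM_mul, DM_mul, DM_sum] at this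
    simpa [DM_smul, DM_jm] using this
  have hC : (K.Ω a * K.Ω b - K.Ω b * K.Ω a) * 𝕁 j - 𝕁 j * (K.Ω a * K.Ω b - K.Ω b * K.Ω a)
      = ∑ i, (∑ k, (K.γ b j k * K.γ a k i - K.γ a j k * K.γ b k i)) • 𝕁 i := by
    have h1 : (K.Ω a * K.Ω b - K.Ω b * K.Ω a) * 𝕁 j - 𝕁 j * (K.Ω a * K.Ω b - K.Ω b * K.Ω a)
      = (K.Ω a * (K.Ω b * 𝕁 j - 𝕁 j * K.Ω b) - (K.Ω b * 𝕁 j - 𝕁 j * K.Ω b) * K.Ω a)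
        - (K.Ω b * (K.Ω a * 𝕁 j - 𝕁 j * K.Ω a) - (K.Ω a * 𝕁 j - 𝕁 j * K.Ω a) * K.Ω b) := by
      noncomm_ring
    have h2 : ∀ a (c : Fin 3 → 𝒜), K.Ω a * (∑ k, c k • 𝕁 k) - (∑ k, c k • 𝕁 k) * K.Ω a
        = ∑ i, (∑ k, c k * K.γ a k i) • 𝕁 i := by
      intro a c
      simp only [Finset.mul_sum, Finset.sum_mul, ← Finset.sum_sub_distrib, Matrix.mul_smul,
        Matrix.smul_mul, ← smul_sub, Ω_jm, Finset.sum_smul, Finset.smul_sum, smul_smul]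
      exact Finset.sum_comm
    rw [h1, Ω_jm, Ω_jm, h2, h2, ← Finset.sum_sub_distrib]
    simp only [← sub_smul, ← Finset.sum_sub_distrib]
  have hE : (∑ e, K.c a b e • K.Ω e) * 𝕁 j - 𝕁 j * (∑ e, K.c a b e • K.Ω e)
      = ∑ i, (∑ e, K.c a b e * K.γ e j i) • 𝕁 i := by
    simp only [Finset.mul_sum, Finset.sum_mul, ← Finset.sum_sub_distrib, Matrix.mul_smul,
        Matrix.smul_mul, ← smul_sub, Ω_jm, Finset.sum_smul, Finset.smul_sum, smul_smul]
    exact Finset.sum_comm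
  simp only [R_vv, sub_smul, add_smul, Finset.sum_sub_distrib, Finset.sum_add_distrib] at hC ⊢
  rw [← hD, ← hD, ← hE, ← hC, RM_eq]
  noncomm_ring

end FrameCalculus

end QC

/-! ### Components of the first Bianchi identity by type of indices. -/

namespace QC

open Matrix

namespace FrameCalculus

variable {n : ℕ} {𝒜 : Type*} [CommRing 𝒜] [Algebra ℝ 𝒜] (K : FrameCalculus n 𝒜)

local notation "𝕁" => jm n 𝒜

/-- The endomorphism `T(R_i, ·)` of `H`. -/
def t (i : Fin 3) : Matrix (HIdx n) (HIdx n) 𝒜 :=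
  Matrix.of fun α β => K.T (Sum.inl α) (Sum.inr i) (Sum.inl β)

/-- The horizontal part of `T(R_i, R_j)`. -/
def th (i j : Fin 3) (β : HIdx n) : 𝒜 := K.T (Sum.inl β) (Sum.inr i) (Sum.inr j)

/-- The vertical part of `T(R_i, R_j)`. -/
def tv (k i j : Fin 3) : 𝒜 := K.T (Sum.inr k) (Sum.inr i) (Sum.inr j)

/-- Covariant derivative of a family of endomorphisms of `H` indexed by a vertical index. -/
def NV (a : Idx n) (X : Fin 3 → Matrix (HIdx n) (HIdx n) 𝒜) (i : Fin 3) :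
    Matrix (HIdx n) (HIdx n) 𝒜 :=
  K.N a (X i) - ∑ j, K.γ a i j • X j

theorem T_vhh' (i : Fin 3) (α β : HIdx n) :
    K.T (Sum.inr i) (Sum.inl α) (Sum.inl β) = -2 * 𝕁 i α β := K.T_vhh i α β

theorem T_hvh (i : Fin 3) (α β : HIdx n) :
    K.T (Sum.inl α) (Sum.inr i) (Sum.inl β) = K.t i α β := rfl

theorem T_hhv (i : Fin 3) (α β : HIdx n) :
    K.T (Sum.inl α) (Sum.inl β) (Sum.inr i) = -K.t i α β := K.T_skew _ _ _

theorem T_vhv (i j : Fin 3) (β : HIdx n) :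
    K.T (Sum.inr i) (Sum.inl β) (Sum.inr j) = 0 := by rw [K.T_skew, K.T_vvh, neg_zero]

theorem T_hvv (i j : Fin 3) (β : HIdx n) :
    K.T (Sum.inl β) (Sum.inr i) (Sum.inr j) = K.th i j β := rfl

theorem T_vvv (k i j : Fin 3) : K.T (Sum.inr k) (Sum.inr i) (Sum.inr j) = K.tv k i j := rfl

theorem Γ_hh (a : Idx n) (α β : HIdx n) : K.Γ a (Sum.inl α) (Sum.inl β) = K.Ω a β α := rfl

theorem Γ_vv (a : Idx n) (i j : Fin 3) : K.Γ a (Sum.inr i) (Sum.inr j) = K.γ a i j := rfl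

theorem Ω_swap (a : Idx n) (α β : HIdx n) : K.Ω a α β = -K.Ω a β α := K.Γ_skew a β α

theorem R_hh (a b : Idx n) (α β : HIdx n) :
    K.R a b (Sum.inl α) (Sum.inl β) = K.RM a b β α := rfl

theorem NT_hvh (a : Idx n) (i : Fin 3) (α β : HIdx n) :
    K.NT (Sum.inl α) (Sum.inr i) (Sum.inl β) a = K.NV a K.t i α β := by
  simp only [NT, NV, N, DM, Fintype.sum_sum_type, Γ_hv, Γ_vh, zero_mul, Finset.sum_const_zero,
    add_zero, zero_add, T_hvh, Γ_hh, Γ_vv, Matrix.sub_apply, Matrix.add_apply, Matrix.map_apply,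
    Matrix.mul_apply, Matrix.sum_apply, Matrix.smul_apply, smul_eq_mul]
  simp only [mul_comm (K.Ω a _ β)]
  ring

theorem NT_swap (a b c d : Idx n) : K.NT d b c a = -K.NT d c b a := by
  have h1 : ∑ e, K.Γ a e d * K.T e c b = -∑ e, K.Γ a e d * K.T e b c := by
    rw [← Finset.sum_neg_distrib]
    exact Finset.sum_congr rfl fun e _ => by rw [K.T_skew e c b]; ring
  have h2 : ∑ e, K.Γ a c e * K.T d e b = -∑ e, K.Γ a c e * K.T d b e := by
    rw [← Finset.sum_neg_distrib]
    exact Finset.sum_congr rfl fun e _ => by rw [K.T_skew d e b]; ring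
  have h3 : ∑ e, K.Γ a b e * K.T d c e = -∑ e, K.Γ a b e * K.T d e c := by
    rw [← Finset.sum_neg_distrib]
    exact Finset.sum_congr rfl fun e _ => by rw [K.T_skew d c e]; ring
  rw [NT, NT, h1, h2, h3, K.T_skew d c b, map_neg]
  ring

theorem NT_hhv (a : Idx n) (i : Fin 3) (α β : HIdx n) :
    K.NT (Sum.inl α) (Sum.inl β) (Sum.inr i) a = -K.NV a K.t i α β := by
  rw [NT_swap, NT_hvh]

theorem NT_hhh (a : Idx n) (α β γ : HIdx n) :
    K.NT (Sum.inl α) (Sum.inl β) (Sum.inl γ) a = 0 := by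
  simp [NT, Fintype.sum_sum_type, Γ_hv, Γ_vh, T_hhh]

theorem NT_vhv (a : Idx n) (i j : Fin 3) (β : HIdx n) :
    K.NT (Sum.inr i) (Sum.inl β) (Sum.inr j) a = 0 := by
  simp [NT, Fintype.sum_sum_type, Γ_hv, Γ_vh, T_vhv]

theorem NT_vvh (a : Idx n) (i j : Fin 3) (β : HIdx n) :
    K.NT (Sum.inr i) (Sum.inr j) (Sum.inl β) a = 0 := by
  simp [NT, Fintype.sum_sum_type, Γ_hv, Γ_vh, T_vvh]

/-- This torsion component is -2 J_i, so its covariant derivative vanishes by the parallelism of V →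
span{J_i}. Skewness of the connection on V converts between the upper and lower vertical index. -/
theorem NT_vhh (hn : n ≠ 0) (a : Idx n) (i : Fin 3) (α β : HIdx n) :
    K.NT (Sum.inr i) (Sum.inl α) (Sum.inl β) a = 0 := by
  have h := congrFun (congrFun (K.Ω_jm a i) α) β
  have h0 : K.D a (𝕁 i α β) = 0 := by simp [jm]
  simp only [Matrix.sub_apply, Matrix.mul_apply, Matrix.sum_apply, Matrix.smul_apply,
    smul_eq_mul] at h
  simp only [NT, Fintype.sum_sum_type, Γ_hv, zero_mul, Finset.sum_const_zero, zero_add,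
    add_zero, T_vhh', Γ_hh, Γ_vv, K.γ_skew hn a _ i, K.Ω_swap a _ α, Derivation.leibniz, h0,
    smul_zero]
  have h2 : K.D a (-2 : 𝒜) = 0 := by
    have := (K.D a).map_algebraMap (-2)
    rwa [map_neg, map_ofNat] at this
  simp only [h2, smul_zero, mul_neg, neg_mul, Finset.sum_neg_distrib, mul_left_comm _ (2 : 𝒜),
    mul_assoc (2 : 𝒜), ← Finset.mul_sum, mul_comm (K.Ω a _ β)]
  linear_combination -2 * h

theorem bianchi_hhh (α β γ δ : HIdx n) :
    K.RM (Sum.inl α) (Sum.inl β) δ γ + K.RM (Sum.inl β) (Sum.inl γ) δ α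
        + K.RM (Sum.inl γ) (Sum.inl α) δ β
      = -2 * ∑ i, (𝕁 i α β * K.t i δ γ + 𝕁 i β γ * K.t i δ α + 𝕁 i γ α * K.t i δ β) := by
  have h := K.bianchi (Sum.inl α) (Sum.inl β) (Sum.inl γ) (Sum.inl δ)
  simp only [NT_hhh, Fintype.sum_sum_type, T_hhh, zero_mul, add_zero, zero_add,
    Finset.sum_const_zero, T_vhh', T_hvh, R_hh] at h
  rw [h, Finset.mul_sum]
  exact Finset.sum_congr rfl fun i _ => by ring

/-- Of the three curvature terms two mix H and V and vanish, so the curvature of V on horizontal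
vectors is algebraic in the torsion. -/
theorem bianchi_vhh_v (hn : n ≠ 0) (i k : Fin 3) (β γ : HIdx n) :
    K.R (Sum.inl β) (Sum.inl γ) (Sum.inr i) (Sum.inr k)
      = -2 * ((K.t i)ᵀ * 𝕁 k + 𝕁 k * K.t i) β γ - 2 * ∑ j, 𝕁 j β γ * K.tv k j i := by
  have h := K.bianchi (Sum.inr i) (Sum.inl β) (Sum.inl γ) (Sum.inr k)
  rw [R_hv, R_hv, K.NT_vhh hn, NT_vhv, NT_vvh] at h
  simp only [Fintype.sum_sum_type, Finset.sum_add_distrib, T_vvh, T_vhv, T_vhh', T_vvv, T_hvh,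
    T_hhv, T_hhh, mul_zero, add_zero, zero_add, Finset.sum_const_zero] at h
  simp only [Matrix.add_apply, Matrix.mul_apply, Matrix.transpose_apply]
  rw [h]
  simp only [jm_apply_swap (n := n) (𝒜 := 𝒜) k β, neg_mul, mul_neg, Finset.sum_neg_distrib,
    mul_left_comm _ (2 : 𝒜), mul_assoc (2 : 𝒜), ← Finset.mul_sum, mul_comm (𝕁 k _ β)]
  ring

/-- The source of the first-order relations: `W_eq` and `contracted_bianchi` are its traces against
the identity and against J_k. -/
theorem bianchi_vhh_h (i : Fin 3) (β γ δ : HIdx n) :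
    K.RM (Sum.inr i) (Sum.inl β) δ γ - K.RM (Sum.inr i) (Sum.inl γ) δ β
      = -K.NV (Sum.inl β) K.t i δ γ + K.NV (Sum.inl γ) K.t i δ β
        - 2 * ∑ j, 𝕁 j β γ * K.th j i δ := by
  have h := K.bianchi (Sum.inr i) (Sum.inl β) (Sum.inl γ) (Sum.inl δ)
  rw [R_vh, K.R_swap (Sum.inl γ), NT_hhh, NT_hhv, NT_hvh] at h
  simp only [Fintype.sum_sum_type, Finset.sum_add_distrib, T_vvh, T_vhv, T_vhh', T_hvv, T_hvh,
    T_hhv, T_hhh, zero_mul, mul_zero, add_zero, zero_add, Finset.sum_const_zero, R_hh] at h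
  rw [sub_eq_add_neg, h]
  simp only [neg_mul, Finset.sum_neg_distrib, mul_assoc (2 : 𝒜), ← Finset.mul_sum]
  ring

theorem bianchi_vvh_v (i j k : Fin 3) (γ : HIdx n) :
    K.R (Sum.inr j) (Sum.inl γ) (Sum.inr i) (Sum.inr k)
        - K.R (Sum.inr i) (Sum.inl γ) (Sum.inr j) (Sum.inr k)
      = K.NT (Sum.inr k) (Sum.inr i) (Sum.inr j) (Sum.inl γ)
        - 2 * ∑ ε, K.th i j ε * 𝕁 k ε γ := by
  have h := K.bianchi (Sum.inr i) (Sum.inr j) (Sum.inl γ) (Sum.inr k)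
  rw [R_hv, K.R_swap (Sum.inl γ), NT_vhv, NT_vvh] at h
  simp only [Fintype.sum_sum_type, Finset.sum_add_distrib, T_vvh, T_vhv, T_vhh', T_hvv, T_hvh,
    T_hhv, zero_mul, mul_zero, add_zero, zero_add, Finset.sum_const_zero] at h
  rw [sub_eq_add_neg, h]
  simp only [neg_mul, mul_neg, Finset.sum_neg_distrib, mul_left_comm _ (2 : 𝒜), ← Finset.mul_sum]
  ring

/-- Only one curvature term survives, so the curvature of H on vertical pairs, and with it B, is
expressed by torsion and its first derivatives. -/
theorem bianchi_vvh_h (i j : Fin 3) (γ δ : HIdx n) :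
    K.RM (Sum.inr i) (Sum.inr j) δ γ
      = K.NV (Sum.inr i) K.t j δ γ - K.NV (Sum.inr j) K.t i δ γ
        + K.NT (Sum.inl δ) (Sum.inr i) (Sum.inr j) (Sum.inl γ)
        + ∑ k, K.tv k i j * K.t k δ γ - (K.t i * K.t j) δ γ + (K.t j * K.t i) δ γ := by
  have h := K.bianchi (Sum.inr i) (Sum.inr j) (Sum.inl γ) (Sum.inl δ)
  rw [R_vh, R_vh, NT_hvh, NT_hhv] at h
  simp only [Fintype.sum_sum_type, Finset.sum_add_distrib, T_vvh, T_vhv, T_hvv, T_hvh,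
    T_hhv, T_hhh, T_vvv, zero_mul, mul_zero, add_zero, zero_add, Finset.sum_const_zero, R_hh] at h
  rw [h]
  simp only [neg_mul, mul_neg, Finset.sum_neg_distrib, Matrix.mul_apply, neg_neg,
    mul_comm (K.t i δ _), mul_comm (K.t j δ _)]
  ring

end FrameCalculus

end QC

/-! ### Ring identities for a quaternion triple. -/

namespace QC

open Matrix

/-- Three elements of a ring satisfying the quaternion relations. -/
structure QuatTriple {S : Type*} [Ring S] (A B C : S) : Prop where
  aa : A * A = -1
  bb : B * B = -1
  cc : C * C = -1
  ab : A * B = C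
  ba : B * A = -C
  bc : B * C = A
  cb : C * B = -A
  ca : C * A = B
  ac : A * C = -B

namespace QuatTriple

variable {S : Type*} [Ring S] {A B C : S}

theorem rotate (h : QuatTriple A B C) : QuatTriple B C A :=
  ⟨h.bb, h.cc, h.aa, h.bc, h.cb, h.ca, h.ac, h.ab, h.ba⟩

theorem aa' (h : QuatTriple A B C) (x : S) : A * (A * x) = -x := by rw [← mul_assoc, h.aa]; simp
theorem bb' (h : QuatTriple A B C) (x : S) : B * (B * x) = -x := h.rotate.aa' x
theorem cc' (h : QuatTriple A B C) (x : S) : C * (C * x) = -x := h.rotate.rotate.aa' x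
theorem ab' (h : QuatTriple A B C) (x : S) : A * (B * x) = C * x := by rw [← mul_assoc, h.ab]
theorem bc' (h : QuatTriple A B C) (x : S) : B * (C * x) = A * x := h.rotate.ab' x
theorem ca' (h : QuatTriple A B C) (x : S) : C * (A * x) = B * x := h.rotate.rotate.ab' x
theorem ba' (h : QuatTriple A B C) (x : S) : B * (A * x) = -(C * x) := by
  rw [← mul_assoc, h.ba, neg_mul]
theorem cb' (h : QuatTriple A B C) (x : S) : C * (B * x) = -(A * x) := h.rotate.ba' x
theorem ac' (h : QuatTriple A B C) (x : S) : A * (C * x) = -(B * x) := h.rotate.rotate.ba' x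

/-- An anticommutator and a commutator with `A` are separated by conjugation with `A`. -/
theorem anticomm_eq_zero (h : QuatTriple A B C) (h2 : ∀ x : S, x + x = 0 → x = 0) {s b E : S}
    (hE : A * E * A = E) (e : s * A + A * s + (A * b - b * A) + E = 0) :
    s * A + A * s = 0 ∧ A * b - b * A + E = 0 := by
  -- The map x ↦ A x A negates s A + A s and fixes both A b - b A and E.
  have e' := congrArg (fun x => A * x * A) e
  simp only [mul_add, add_mul, mul_sub, sub_mul, hE, mul_zero, zero_mul] at e'
  simp only [mul_assoc, h.aa, h.aa', mul_neg, neg_mul, mul_one] at e'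
  constructor
  · apply h2
    linear_combination (norm := abel) e - e'
  · apply h2
    linear_combination (norm := abel) e + e'

/-- As b commutes with A, A b A = -b and C b C = B b B. The eigenvalue equation then reads 2b = 2 B
b B, which is anticommutation with B, hence also with C = A B. -/
theorem anticomm_of_comm (h : QuatTriple A B C) (h2 : ∀ x : S, x + x = 0 → x = 0) {b : S}
    (hA : A * b = b * A) (e : b = A * b * A + B * b * B + C * b * C) :
    B * b = -(b * B) ∧ C * b = -(b * C) := by
  have h1 : C * b * C = B * b * B := by
    have : C * b * C = B * (A * b) * (B * A) := by
      rw [h.ba, ← neg_neg C, ← h.ba]; noncomm_ring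
    rw [this, hA, ← mul_assoc (B * (b * A))]
    simp only [mul_assoc, h.ab', h.ca]
  have h3 : A * b * A = -b := by rw [hA, mul_assoc, h.aa]; simp
  rw [h1, h3] at e
  have e4 : b = B * b * B := by
    have : (b - B * b * B) + (b - B * b * B) = 0 := by
      linear_combination (norm := abel) e
    exact sub_eq_zero.1 (h2 _ this)
  have hB : B * b = -(b * B) := by
    conv_lhs => rw [e4]
    simp only [mul_assoc, h.bb']
  refine ⟨hB, ?_⟩
  rw [← h.ab, mul_assoc, hB, mul_neg, ← mul_assoc, hA, mul_assoc]

/-- The symmetric and skew parts of the mixed equation are separated by commutation with `A`. -/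
theorem mixed (h : QuatTriple A B C) (h2 : ∀ x : S, x + x = 0 → x = 0) {s₁ s₂ b₁ b₂ μ₁ μ₂ E : S}
    (hs₁ : s₁ * A + A * s₁ = 0)
    (hb₁ : b₁ = A * μ₁) (hb₂ : b₂ = B * μ₂) (h1A : A * μ₁ = μ₁ * A) (h1B : B * μ₁ = μ₁ * B)
    (h2A : A * μ₂ = μ₂ * A) (hE : A * E = -(E * A))
    (e : (s₁ * B + B * s₁) + (s₂ * A + A * s₂) + (B * b₁ - b₁ * B) + (A * b₂ - b₂ * A) + E = 0) :
    (s₁ * B + B * s₁) + (s₂ * A + A * s₂) = 0 ∧ E = C * (μ₁ - μ₂) + C * (μ₁ - μ₂) := by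
  have hW : (B * b₁ - b₁ * B) + (A * b₂ - b₂ * A)
      = -(C * (μ₁ - μ₂) + C * (μ₁ - μ₂)) := by
    rw [hb₁, hb₂, mul_assoc A, ← h1B, mul_assoc B, ← h2A]
    simp only [h.ab', h.ba', mul_sub]
    abel
  have hC : A * (C * (μ₁ - μ₂)) = -(C * (μ₁ - μ₂) * A) := by
    simp only [mul_assoc, sub_mul, ← h1A, ← h2A, mul_sub, h.ac', h.ca']
    abel
  -- The symmetric contribution commutes with A: for the s₂ terms this is automatic, for the s₁
  -- terms it uses that s₁ anticommutes with A.
  have hZ : A * ((s₁ * B + B * s₁) + (s₂ * A + A * s₂))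
      = ((s₁ * B + B * s₁) + (s₂ * A + A * s₂)) * A := by
    have e1 : A * s₁ = -(s₁ * A) := by linear_combination (norm := abel) hs₁
    have e2 : A * (s₁ * B) = -(s₁ * C) := by rw [← mul_assoc, e1, neg_mul, mul_assoc, h.ab]
    simp only [mul_add, add_mul, e2, mul_assoc, h.aa', h.aa, h.ab', h.ba]
    have e4 : B * (s₁ * A) = C * s₁ := by
      have : s₁ * A = -(A * s₁) := by linear_combination (norm := abel) hs₁
      rw [this, mul_neg, h.ba']; simp
    rw [e4]
    simp only [mul_neg, mul_one]
    abel
  set Z := (s₁ * B + B * s₁) + (s₂ * A + A * s₂) with hZdef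
  have e5 : Z = (C * (μ₁ - μ₂) + C * (μ₁ - μ₂)) - E := by
    have : Z + ((B * b₁ - b₁ * B) + (A * b₂ - b₂ * A)) + E = 0 := by
      linear_combination (norm := abel) e
    rw [hW] at this
    linear_combination (norm := abel) this
  -- By the equation, Z is also equal to an expression anticommuting with A. Commuting and
  -- anticommuting with the invertible A forces Z = 0.
  have e6 : A * Z = -(Z * A) := by
    rw [e5, mul_sub, mul_add, hC, hE, sub_mul, add_mul]
    abel
  have e7 : A * Z = 0 := by
    apply h2
    nth_rewrite 1 [e6]
    rw [hZ]
    abel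
  have e8 : Z = 0 := by
    have := congrArg (fun x => A * x) e7
    simpa [h.aa'] using this
  refine ⟨e8, ?_⟩
  rw [e8] at e5
  linear_combination (norm := abel) e5

/-- The polarized anticommutation relations allow A to be moved past s₂ and s₃. The leftover terms B
s₁ B and C s₁ C cancel because C s₁ C = -B s₁ B. This is what recovers the individual T⁰_i from τ.
-/
theorem four_eq_comm (h : QuatTriple A B C) {s₁ s₂ s₃ : S} (h1 : s₁ * A + A * s₁ = 0)
    (h12 : (s₁ * B + B * s₁) + (s₂ * A + A * s₂) = 0)
    (h13 : (s₁ * C + C * s₁) + (s₃ * A + A * s₃) = 0) :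
    A * (s₁ * A + s₂ * B + s₃ * C) - (s₁ * A + s₂ * B + s₃ * C) * A = 4 • s₁ := by
  have e2 : A * s₂ = -(s₂ * A) - s₁ * B - B * s₁ := by linear_combination (norm := abel) h12
  have e3 : A * s₃ = -(s₃ * A) - s₁ * C - C * s₁ := by linear_combination (norm := abel) h13
  have e1 : A * s₁ = -(s₁ * A) := by linear_combination (norm := abel) h1
  have e4 : C * (s₁ * C) = -(B * (s₁ * B)) := by
    have e5 : C * (s₁ * C) = -(B * (A * s₁) * (A * B)) := by
      rw [h.ab, ← mul_assoc B, h.ba, neg_mul, neg_mul, neg_neg, mul_assoc]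
    rw [e5, e1]
    simp only [mul_assoc, mul_neg, neg_mul, h.aa']
    abel
  have f1 : A * (s₁ * A) = s₁ := by rw [← mul_assoc, e1, neg_mul, mul_assoc, h.aa]; simp
  have f2 : A * (s₂ * B) = -(s₂ * C) + s₁ - B * (s₁ * B) := by
    rw [← mul_assoc, e2]
    simp only [sub_mul, neg_mul, mul_assoc, h.ab, h.bb]
    simp
  have f3 : A * (s₃ * C) = s₃ * B + s₁ - C * (s₁ * C) := by
    rw [← mul_assoc, e3]
    simp only [sub_mul, neg_mul, mul_assoc, h.ac, h.cc]
    simp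
  simp only [mul_add, add_mul, f1, f2, f3, e4, mul_assoc, h.aa, h.ba, h.ca, mul_neg, mul_one]
  abel

end QuatTriple

end QC

/-! ### Algebraic structure of the torsion: reduction to τ, μ and λ. -/

namespace QC

open Matrix

theorem sum_cyc {S : Type*} [AddCommMonoid S] (i : Fin 3) (F : Fin 3 → S) :
    ∑ j, F j = F i + F (i + 1) + F (i + 2) := by
  rw [Fin.sum_univ_three]
  fin_cases i
  · rfl
  · change _ = F 1 + F 2 + F 0
    abel
  · change _ = F 2 + F 0 + F 1
    abel

theorem fin3_cases (i j : Fin 3) : j = i ∨ j = i + 1 ∨ j = i + 2 := by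
  fin_cases i <;> fin_cases j <;> simp

namespace FrameCalculus

set_option linter.unusedSectionVars false

variable {n : ℕ} {𝒜 : Type*} [CommRing 𝒜] [Algebra ℝ 𝒜] (K : FrameCalculus n 𝒜)

local notation "𝕁" => jm n 𝒜

theorem quatTriple_jm (i : Fin 3) : QuatTriple (𝕁 i) (𝕁 (i + 1)) (𝕁 (i + 2)) := by
  have h : QuatTriple (𝕁 0) (𝕁 1) (𝕁 2) :=
    ⟨jm_self _, jm_self _, jm_self _, jm01, jm10, jm12, jm21, jm20, jm02⟩
  fin_cases i
  · exact h
  · exact h.rotate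
  · exact h.rotate.rotate

theorem add_self_eq_zero' (X : Matrix (HIdx n) (HIdx n) 𝒜) (h : X + X = 0) : X = 0 :=
  nsmul_cancel (k := 2) two_ne_zero (by rw [two_nsmul, h, smul_zero])

theorem R_vv_skew (hn : n ≠ 0) (a b : Idx n) (i j : Fin 3) :
    K.R a b (Sum.inr i) (Sum.inr j) = -K.R a b (Sum.inr j) (Sum.inr i) := by
  have h1 := trace_sum_smul_jm (n := n) (fun j => K.R a b (Sum.inr i) (Sum.inr j)) j
  have h2 := trace_sum_smul_jm (n := n) (fun i => K.R a b (Sum.inr j) (Sum.inr i)) i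
  rw [← RM_jm, trace_comm_jm] at h1 h2
  refine natCast_mul_cancel (k := 4 * n) (by omega) ?_
  push_cast
  linear_combination h1 + h2

/-- Symmetric part of `T(R_i, ·)`. -/
def s (i : Fin 3) : Matrix (HIdx n) (HIdx n) 𝒜 := (1 / 2 : ℝ) • (K.t i + (K.t i)ᵀ)

/-- Skew part of `T(R_i, ·)`. -/
def b (i : Fin 3) : Matrix (HIdx n) (HIdx n) 𝒜 := (1 / 2 : ℝ) • (K.t i - (K.t i)ᵀ)

theorem t_eq (i : Fin 3) : K.t i = K.s i + K.b i := by
  simp only [s, b]; module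

theorem t_transpose (i : Fin 3) : (K.t i)ᵀ = K.s i - K.b i := by
  simp only [s, b]; module

theorem s_transpose (i : Fin 3) : (K.s i)ᵀ = K.s i := by
  simp only [s, Matrix.transpose_smul, Matrix.transpose_add, Matrix.transpose_transpose]; module

theorem b_transpose (i : Fin 3) : (K.b i)ᵀ = -K.b i := by
  simp only [b, Matrix.transpose_smul, Matrix.transpose_sub, Matrix.transpose_transpose]; module

theorem trace_t_jm (i k : Fin 3) : (K.t i * 𝕁 k).trace = 0 := by
  have h : ((K.t i)ᵀ * 𝕁 k).trace = 0 := K.T_trace_J i k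
  rw [← Matrix.trace_transpose, Matrix.transpose_mul, jm_transpose, neg_mul, Matrix.trace_neg,
    Matrix.trace_mul_comm, h, neg_zero]

theorem trace_b_jm (i k : Fin 3) : (K.b i * 𝕁 k).trace = 0 := by
  have h : ((K.t i)ᵀ * 𝕁 k).trace = 0 := K.T_trace_J i k
  simp [b, sub_mul, Matrix.trace_sub, h, trace_t_jm]

theorem b_casimir (i : Fin 3) : K.b i = ∑ j, 𝕁 j * K.b i * 𝕁 j := by
  have h := K.T_spn i (K.t i - (K.t i)ᵀ) rfl
  simp only [b, Matrix.mul_smul, Matrix.smul_mul, ← Finset.smul_sum]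
  exact congrArg _ h

theorem tv_swap (k i j : Fin 3) : K.tv k i j = -K.tv k j i := K.T_skew _ _ _

theorem tv_self (k i : Fin 3) : K.tv k i i = 0 := K.T_self _ _

/-- The part of the Bianchi identity which does not involve the curvature. -/
theorem torsion_relation (hn : n ≠ 0) (i k : Fin 3) :
    (K.s i * 𝕁 k + 𝕁 k * K.s i) + (K.s k * 𝕁 i + 𝕁 i * K.s k)
      + (𝕁 k * K.b i - K.b i * 𝕁 k) + (𝕁 i * K.b k - K.b k * 𝕁 i)
      + ∑ j, (K.tv k j i + K.tv i j k) • 𝕁 j = 0 := by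
  have h : ((K.t i)ᵀ * 𝕁 k + 𝕁 k * K.t i) + ((K.t k)ᵀ * 𝕁 i + 𝕁 i * K.t k)
      + ∑ j, (K.tv k j i + K.tv i j k) • 𝕁 j = 0 := by
    ext β γ
    have h1 := K.bianchi_vhh_v hn i k β γ
    have h2 := K.bianchi_vhh_v hn k i β γ
    -- The curvature of V is skew in its two vertical indices, so adding the identities for (i, k)
    -- and (k, i) eliminates it.
    rw [K.R_vv_skew hn] at h1
    refine natCast_mul_cancel two_ne_zero ?_
    simp only [Matrix.add_apply, Matrix.sum_apply, Matrix.smul_apply, smul_eq_mul,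
      Matrix.zero_apply, add_mul, Finset.sum_add_distrib] at h1 h2 ⊢
    simp only [mul_comm (K.tv _ _ _)]
    push_cast
    linear_combination h1 + h2
  simp only [t_transpose] at h
  simp only [t_eq] at h
  rw [← h]
  noncomm_ring

/-- The diagonal case of `torsion_relation`. The vertical torsion term involves only J_j with j ≠ i,
which are fixed by conjugation X ↦ J_i X J_i, so `anticomm_eq_zero` applies. -/
theorem anticomm_s_self_and (hn : n ≠ 0) (i : Fin 3) :
    K.s i * 𝕁 i + 𝕁 i * K.s i = 0 ∧
      𝕁 i * K.b i - K.b i * 𝕁 i + ∑ j, K.tv i j i • 𝕁 j = 0 := by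
  have q := quatTriple_jm (n := n) (𝒜 := 𝒜) i
  refine q.anticomm_eq_zero add_self_eq_zero' ?_ ?_
  · rw [sum_cyc i, tv_self]
    simp only [zero_smul, zero_add, mul_add, add_mul, Matrix.mul_smul, Matrix.smul_mul,
      q.ba, q.ca, q.ab, q.ac, neg_mul, neg_neg]
  · have h := K.torsion_relation hn i i
    simp only [add_smul, Finset.sum_add_distrib] at h
    apply add_self_eq_zero'
    linear_combination (norm := abel) h

/-- Pairing the commutator equation with J_j under the trace: the b_i terms are traces tr(b_i J_k),
zero by orthogonality to sp(1) (or traces against ± the identity that cancel), and 4n times the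
component remains. -/
theorem tv_outer (hn : n ≠ 0) (i j : Fin 3) : K.tv i j i = 0 := by
  have h := congrArg (fun X => (X * 𝕁 j).trace) (K.anticomm_s_self_and hn i).2
  have q := quatTriple_jm (n := n) (𝒜 := 𝒜) i
  simp only [add_mul, Matrix.trace_add, trace_sum_smul_jm, zero_mul, Matrix.trace_zero] at h
  have h3 : ((𝕁 i * K.b i - K.b i * 𝕁 i) * 𝕁 j).trace = 0 := by
    have h1 := trace_comm_jm (K.b i) i j
    have h2 : ∀ k, (K.b i * -𝕁 k).trace = 0 := fun k => by simp [trace_b_jm]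
    rw [← neg_sub, neg_mul, Matrix.trace_neg, h1]
    rcases fin3_cases i j with rfl | rfl | rfl <;>
    simp [q.ab, q.ba, q.ac, q.ca, trace_b_jm]
  refine natCast_mul_cancel (k := 4 * n) (by omega) ?_
  push_cast
  linear_combination h3 - h

theorem anticomm_s_self (hn : n ≠ 0) (i : Fin 3) : K.s i * 𝕁 i + 𝕁 i * K.s i = 0 :=
  (K.anticomm_s_self_and hn i).1

theorem comm_b_self (hn : n ≠ 0) (i : Fin 3) : 𝕁 i * K.b i = K.b i * 𝕁 i := by
  have h := (K.anticomm_s_self_and hn i).2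
  simp only [K.tv_outer hn, zero_smul, Finset.sum_const_zero, add_zero] at h
  exact sub_eq_zero.1 h

theorem anticomm_b (hn : n ≠ 0) (i : Fin 3) :
    𝕁 (i + 1) * K.b i = -(K.b i * 𝕁 (i + 1)) ∧ 𝕁 (i + 2) * K.b i = -(K.b i * 𝕁 (i + 2)) := by
  refine (quatTriple_jm (n := n) (𝒜 := 𝒜) i).anticomm_of_comm add_self_eq_zero'
    (K.comm_b_self hn i) ?_
  rw [← sum_cyc i (fun j => 𝕁 j * K.b i * 𝕁 j)]
  exact K.b_casimir i

/-- J_i commutes with b_i, and each of the other two structures anticommutes with both J_i and b_i,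
so the product commutes with all three. -/
theorem comm_jm_mul_b (hn : n ≠ 0) (i j : Fin 3) :
    𝕁 j * (-(𝕁 i * K.b i)) = -(𝕁 i * K.b i) * 𝕁 j := by
  have q := quatTriple_jm (n := n) (𝒜 := 𝒜) i
  have h0 := K.comm_b_self hn i
  obtain ⟨h1, h2⟩ := K.anticomm_b hn i
  rcases fin3_cases i j with rfl | rfl | rfl
  · rw [neg_mul, mul_assoc, ← h0, mul_neg]
  · rw [neg_mul, mul_assoc, ← neg_neg (K.b i * _), ← h1]
    simp only [mul_neg, q.ba', q.ab', neg_neg]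
  · rw [neg_mul, mul_assoc, ← neg_neg (K.b i * _), ← h2]
    simp only [mul_neg, q.ac', q.ca', neg_neg]

/-- The off-diagonal case of `torsion_relation`. Its vertical term is a scalar multiple of J_{i+2},
and `mixed` equates it with 2 J_{i+2}(μ₁ - μ₂), where μ₁, μ₂ are the candidates for μ from two
values of i. Both are trace-free, so taking the trace kills the scalar, and then the candidates
agree. -/
theorem mixed_relations (hn : n ≠ 0) (i : Fin 3) :
    (K.s i * 𝕁 (i + 1) + 𝕁 (i + 1) * K.s i) + (K.s (i + 1) * 𝕁 i + 𝕁 i * K.s (i + 1)) = 0 ∧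
    K.tv (i + 1) (i + 2) i = K.tv i (i + 1) (i + 2) ∧
    𝕁 i * K.b i = 𝕁 (i + 1) * K.b (i + 1) := by
  have q := quatTriple_jm (n := n) (𝒜 := 𝒜) i
  have hE : ∑ j, (K.tv (i + 1) j i + K.tv i j (i + 1)) • 𝕁 j
      = (K.tv (i + 1) (i + 2) i - K.tv i (i + 1) (i + 2)) • 𝕁 (i + 2) := by
    rw [sum_cyc i, tv_self, tv_self, K.tv_swap i i, K.tv_outer hn, K.tv_swap (i + 1) (i + 1),
      K.tv_outer hn, K.tv_swap i (i + 2)]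
    simp [sub_eq_add_neg]
  have h := K.torsion_relation hn i (i + 1)
  rw [hE] at h
  obtain ⟨h1, h2⟩ := q.mixed add_self_eq_zero' (K.anticomm_s_self hn i)
    (μ₁ := -(𝕁 i * K.b i)) (μ₂ := -(𝕁 (i + 1) * K.b (i + 1)))
    (by rw [mul_neg, q.aa', neg_neg]) (by rw [mul_neg, q.bb', neg_neg])
    (K.comm_jm_mul_b hn i i) (K.comm_jm_mul_b hn i (i + 1)) (K.comm_jm_mul_b hn (i + 1) i)
    (by rw [Matrix.mul_smul, Matrix.smul_mul, q.ac, q.ca, smul_neg]) h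
  refine ⟨h1, ?_⟩
  have h3 := congrArg (fun X => 𝕁 (i + 2) * X) h2
  simp only [Matrix.mul_smul, mul_add, q.cc', q.cc] at h3
  have htr : ∀ i, (𝕁 i * K.b i).trace = 0 := fun i => by
    rw [Matrix.trace_mul_comm, trace_b_jm]
  have h4 := congrArg Matrix.trace h3
  simp only [Matrix.trace_smul, Matrix.trace_neg, Matrix.trace_add, Matrix.trace_sub, htr,
    trace_one, smul_eq_mul] at h4
  have h5 : K.tv (i + 1) (i + 2) i = K.tv i (i + 1) (i + 2) := by
    refine natCast_mul_cancel (k := 4 * n) (by omega) ?_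
    push_cast
    linear_combination -h4
  refine ⟨h5, ?_⟩
  rw [h5, sub_self, zero_smul] at h3
  refine sub_eq_zero.1 (add_self_eq_zero' _ ?_)
  linear_combination (norm := abel) -h3

/-- The component `T(R₂, R₃)·R₁` of the torsion. -/
def lam : 𝒜 := K.tv 0 1 2

theorem tv_cyc (hn : n ≠ 0) (i : Fin 3) : K.tv i (i + 1) (i + 2) = K.lam := by
  have h0 : K.tv 1 2 0 = K.tv 0 1 2 := (K.mixed_relations hn 0).2.1
  have h1 : K.tv 2 0 1 = K.tv 1 2 0 := (K.mixed_relations hn 1).2.1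
  fin_cases i
  · rfl
  · exact h0
  · exact h1.trans h0

/-- `μ = -(1/3) ∑ I_i b_i`. -/
def μ : Matrix (HIdx n) (HIdx n) 𝒜 := (-(1 / 3) : ℝ) • ∑ i, 𝕁 i * K.b i

/-- `τ = ∑ T⁰_i I_i`. -/
def τ : Matrix (HIdx n) (HIdx n) 𝒜 := ∑ i, K.s i * 𝕁 i

theorem μ_eq (hn : n ≠ 0) (i : Fin 3) : K.μ = -(𝕁 i * K.b i) := by
  have h1 := (K.mixed_relations hn i).2.2
  have h2 := (K.mixed_relations hn (i + 1)).2.2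
  have h3 : i + 1 + 1 = i + 2 := by fin_cases i <;> rfl
  rw [h3] at h2
  rw [μ, sum_cyc i, ← h2, ← h1]
  module

theorem b_eq (hn : n ≠ 0) (i : Fin 3) : K.b i = 𝕁 i * K.μ := by
  rw [K.μ_eq hn i, mul_neg, jm_self', neg_neg]

theorem μ_comm (hn : n ≠ 0) (j : Fin 3) : 𝕁 j * K.μ = K.μ * 𝕁 j := by
  rw [K.μ_eq hn 0, K.comm_jm_mul_b hn]

theorem s_eq (hn : n ≠ 0) (i : Fin 3) : (4 : ℝ) • K.s i = 𝕁 i * K.τ - K.τ * 𝕁 i := by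
  have q := quatTriple_jm (n := n) (𝒜 := 𝒜) i
  have h1 := (K.mixed_relations hn i).1
  have h2 := (K.mixed_relations hn (i + 2)).1
  have h3 : i + 2 + 1 = i := by fin_cases i <;> rfl
  rw [h3] at h2
  rw [τ, sum_cyc i, q.four_eq_comm (K.anticomm_s_self hn i) h1
    (by linear_combination (norm := abel) h2)]
  module

theorem t_eq_τμ (hn : n ≠ 0) (i : Fin 3) :
    K.t i = (1 / 4 : ℝ) • (𝕁 i * K.τ - K.τ * 𝕁 i) + 𝕁 i * K.μ := by
  rw [← K.s_eq hn, t_eq, K.b_eq hn]; module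

theorem μ_transpose (hn : n ≠ 0) : (K.μ)ᵀ = K.μ := by
  rw [K.μ_eq hn 0, Matrix.transpose_neg, Matrix.transpose_mul, jm_transpose, b_transpose,
    K.comm_b_self hn]
  simp

theorem τ_transpose (hn : n ≠ 0) : (K.τ)ᵀ = K.τ := by
  have h : ∀ i, 𝕁 i * K.s i = -(K.s i * 𝕁 i) := fun i => by
    linear_combination (norm := abel) K.anticomm_s_self hn i
  simp only [τ, Matrix.transpose_sum, Matrix.transpose_mul, s_transpose, jm_transpose, neg_mul, h,
    neg_neg]

/-- By `s_eq`, J_i τ J_i = 4 T⁰_i J_i - τ, and summing over i gives 4τ - 3τ. -/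
theorem τ_casimir (hn : n ≠ 0) : ∑ i, 𝕁 i * K.τ * 𝕁 i = K.τ := by
  have h : ∀ i, 𝕁 i * K.τ * 𝕁 i = (4 : ℝ) • (K.s i * 𝕁 i) - K.τ := fun i => by
    rw [← Matrix.smul_mul, K.s_eq hn, sub_mul, mul_assoc K.τ, jm_self]
    simp
  simp only [h, Finset.sum_sub_distrib, ← Finset.smul_sum]
  rw [← τ]
  simp only [Finset.sum_const, Finset.card_univ, Fintype.card_fin]
  module

theorem trace_μ (hn : n ≠ 0) : (K.μ).trace = 0 := by
  rw [K.μ_eq hn 0, Matrix.trace_neg, Matrix.trace_mul_comm, trace_b_jm, neg_zero]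

theorem trace_τ (hn : n ≠ 0) : (K.τ).trace = 0 := by
  have h := congrArg Matrix.trace (K.τ_casimir hn)
  have h2 : ∀ i, (𝕁 i * K.τ * 𝕁 i).trace = -(K.τ).trace := fun i => by
    rw [mul_assoc, Matrix.trace_mul_comm, mul_assoc, jm_self]; simp
  simp only [Fin.sum_univ_three, Matrix.trace_add, h2] at h
  refine natCast_mul_cancel (k := 4) (by omega) ?_
  push_cast
  linear_combination -h

end FrameCalculus

end QC

/-! ### Scalar and Ricci curvature in terms of the torsion. -/

namespace QC

open Matrix

namespace FrameCalculus

set_option linter.unusedSectionVars false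

variable {n : ℕ} {𝒜 : Type*} [CommRing 𝒜] [Algebra ℝ 𝒜] (K : FrameCalculus n 𝒜)

local notation "𝕁" => jm n 𝒜

theorem tv_eq (hn : n ≠ 0) (k i j : Fin 3) : K.tv k i j = eps k i j • K.lam := by
  have h0 := K.tv_cyc hn 0
  have h1 := K.tv_cyc hn 1
  have h2 := K.tv_cyc hn 2
  simp only [Fin.isValue, zero_add, show (1 : Fin 3) + 1 = 2 from rfl,
    show (1 : Fin 3) + 2 = 0 from rfl, show (2 : Fin 3) + 1 = 0 from rfl,
    show (2 : Fin 3) + 2 = 1 from rfl] at h0 h1 h2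
  have o1 : ∀ a b, K.tv a b a = 0 := K.tv_outer hn
  have o2 : ∀ a b, K.tv a a b = 0 := fun a b => by rw [tv_swap, o1, neg_zero]
  rw [eps_eq]
  fin_cases k <;> fin_cases i <;> fin_cases j <;>
    simp [tv_self, o1, o2, h0, h1, h2, K.tv_swap 0 2 1, K.tv_swap 1 0 2, K.tv_swap 2 1 0]

/-- Curvature of `V`, as a horizontal two-form. -/
def Rv (i k : Fin 3) : Matrix (HIdx n) (HIdx n) 𝒜 :=
  Matrix.of fun β γ => K.R (Sum.inl β) (Sum.inl γ) (Sum.inr i) (Sum.inr k)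

theorem Rv_eq (hn : n ≠ 0) (i k : Fin 3) : K.Rv i k
    = (-2 : ℝ) • ((K.t i)ᵀ * 𝕁 k + 𝕁 k * K.t i + ∑ j, K.tv k j i • 𝕁 j) := by
  ext β γ
  rw [Rv, Matrix.of_apply, K.bianchi_vhh_v hn]
  simp only [Matrix.add_apply, Matrix.smul_apply, Matrix.sum_apply, smul_eq_mul,
    mul_comm (K.tv _ _ _)]
  simp only [Algebra.smul_def, map_neg, map_ofNat]
  ring

/-- The endomorphisms T(R_i, ·) are orthogonal to the identity and to every J_k, so only the
vertical torsion contributes. -/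
theorem trace_Rv_jm (hn : n ≠ 0) (i k m : Fin 3) :
    (K.Rv i k * 𝕁 m).trace = 8 * n * K.tv k m i := by
  have h1 : ∀ j, ((K.t i)ᵀ * 𝕁 j).trace = 0 := fun j => K.T_trace_J i j
  have htr : (K.t i).trace = 0 := by
    rw [K.t_eq_τμ hn]
    simp only [Matrix.trace_add, Matrix.trace_smul, Matrix.trace_sub]
    rw [← K.b_eq hn, Matrix.trace_mul_comm, sub_self, smul_zero, zero_add]
    have := congrArg Matrix.trace (K.b_transpose i)
    rw [Matrix.trace_transpose, Matrix.trace_neg] at this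
    exact eq_zero_of_eq_neg this
  have htr' : ((K.t i)ᵀ).trace = 0 := by rw [Matrix.trace_transpose, htr]
  have key : ((K.t i)ᵀ * (𝕁 k * 𝕁 m)).trace + (K.t i * (𝕁 m * 𝕁 k)).trace = 0 := by
    rcases fin3_cases k m with rfl | rfl | rfl
    · simp [jm_self, htr]
    · simp [(quatTriple_jm (n := n) (𝒜 := 𝒜) k).ab, (quatTriple_jm (n := n) (𝒜 := 𝒜) k).ba,
        h1, trace_t_jm]
    · simp [(quatTriple_jm (n := n) (𝒜 := 𝒜) k).ac, (quatTriple_jm (n := n) (𝒜 := 𝒜) k).ca,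
        h1, trace_t_jm]
  rw [K.Rv_eq hn, Matrix.smul_mul, Matrix.trace_smul, add_mul, add_mul, Matrix.trace_add,
    Matrix.trace_add, trace_sum_smul_jm, mul_assoc, mul_assoc (𝕁 k), Matrix.trace_mul_comm (𝕁 k),
    mul_assoc, key]
  simp only [Algebra.smul_def, map_neg, map_ofNat]
  ring

/-- Horizontal Ricci tensor. -/
def ric : Matrix (HIdx n) (HIdx n) 𝒜 :=
  Matrix.of fun α β => ∑ γ, K.RM (Sum.inl γ) (Sum.inl α) γ β

theorem trace_RM_jm (a b : Idx n) (i : Fin 3) :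
    (K.RM a b * 𝕁 (i + 2)).trace = -(2 * n * K.R a b (Sum.inr i) (Sum.inr (i + 1))) := by
  have q := quatTriple_jm (n := n) (𝒜 := 𝒜) i
  have h := trace_sum_smul_jm (n := n) (fun j => K.R a b (Sum.inr i) (Sum.inr j)) (i + 1)
  rw [← RM_jm, trace_comm_jm, q.ab, q.ba, mul_neg, Matrix.trace_neg] at h
  refine natCast_mul_cancel (k := 2) (by omega) ?_
  push_cast
  linear_combination h

theorem trace_RM_jm0 (a b : Idx n) :
    (K.RM a b * 𝕁 0).trace = -(2 * n * K.R a b (Sum.inr 1) (Sum.inr 2)) := K.trace_RM_jm a b 1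

theorem trace_jm_mul_t (i j k : Fin 3) (h : ∀ j, (K.t i * 𝕁 j).trace = 0) :
    (𝕁 k * K.t i * 𝕁 k * 𝕁 j).trace = 0 := by
  rw [mul_assoc, mul_assoc, Matrix.trace_mul_comm, mul_assoc, mul_assoc]
  rcases fin3_cases k j with rfl | rfl | rfl
  · simp [jm_self, h]
  · simp [(quatTriple_jm (n := n) (𝒜 := 𝒜) k).ba, (quatTriple_jm (n := n) (𝒜 := 𝒜) k).ac, h]
  · simp [(quatTriple_jm (n := n) (𝒜 := 𝒜) k).ca, (quatTriple_jm (n := n) (𝒜 := 𝒜) k).ab, h]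

/-- The scalar curvature is a multiple of the vertical torsion. -/
theorem trace_ric (hn : n ≠ 0) : K.ric.trace = -(8 * n * (n + 2)) * K.lam := by
  -- The horizontal Bianchi identity is contracted twice with the same structure J_0. The torsion
  -- side vanishes by tracelessness. Of the curvature terms one gives 16n²λ and the other two give
  -- the scalar curvature plus 16nλ each.
  have hb : ∑ γ, ∑ β, ∑ α, ∑ δ, 𝕁 0 γ δ * 𝕁 0 α β * (K.RM (Sum.inl α) (Sum.inl β) δ γ
      + K.RM (Sum.inl β) (Sum.inl γ) δ α + K.RM (Sum.inl γ) (Sum.inl α) δ β)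
      = ∑ γ, ∑ β, ∑ α, ∑ δ, 𝕁 0 γ δ * 𝕁 0 α β * (-2 * ∑ i, (𝕁 i α β * K.t i δ γ
        + 𝕁 i β γ * K.t i δ α + 𝕁 i γ α * K.t i δ β)) := by
    simp only [K.bianchi_hhh]
  have hR : ∑ γ, ∑ β, ∑ α, ∑ δ, 𝕁 0 γ δ * 𝕁 0 α β * (-2 * ∑ i, (𝕁 i α β * K.t i δ γ
        + 𝕁 i β γ * K.t i δ α + 𝕁 i γ α * K.t i δ β)) = 0 := by
    have h1 : ∀ i, ∑ γ, ∑ β, ∑ α, ∑ δ, 𝕁 0 γ δ * 𝕁 0 α β * (𝕁 i α β * K.t i δ γ) = 0 := fun i => by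
      have : ∀ α β γ δ, 𝕁 0 γ δ * 𝕁 0 α β * (𝕁 i α β * K.t i δ γ)
        = (𝕁 0 α β * 𝕁 i α β) * (𝕁 0 γ δ * K.t i δ γ) := fun α β γ δ => by ring
      simp only [this, ← Finset.mul_sum, ← Finset.sum_mul]
      have h2 : ∑ γ, ∑ δ, 𝕁 0 γ δ * K.t i δ γ = 0 := by
        have := K.trace_t_jm i 0
        rw [Matrix.trace_mul_comm] at this
        exact this
      rw [h2, mul_zero]
    have h2 : ∀ i, ∑ γ, ∑ β, ∑ α, ∑ δ, 𝕁 0 γ δ * 𝕁 0 α β * (𝕁 i β γ * K.t i δ α) = 0 := fun i => by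
      rw [← K.trace_jm_mul_t i i 0 (K.trace_t_jm i)]
      simp only [Matrix.trace, Matrix.diag, Matrix.mul_apply, Finset.sum_mul]
      refine Finset.sum_congr rfl fun γ _ => Finset.sum_congr rfl fun β _ =>
        Finset.sum_congr rfl fun α _ => Finset.sum_congr rfl fun δ _ => by ring
    have h3 : ∀ i, ∑ γ, ∑ β, ∑ α, ∑ δ, 𝕁 0 γ δ * 𝕁 0 α β * (𝕁 i γ α * K.t i δ β) = 0 := fun i => by
      rw [← K.trace_jm_mul_t i i 0 (K.trace_t_jm i)]
      simp only [Matrix.trace, Matrix.diag, Matrix.mul_apply, Finset.sum_mul]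
      refine Finset.sum_congr rfl fun γ _ => ?_
      rw [Finset.sum_comm]
      refine Finset.sum_congr rfl fun β _ =>
        Finset.sum_congr rfl fun α _ => Finset.sum_congr rfl fun δ _ => ?_
      rw [jm_apply_swap 0 α β, jm_apply_swap i β γ]
      ring
    have h4 : ∀ α β γ δ, 𝕁 0 γ δ * 𝕁 0 α β * (-2 * ∑ i, (𝕁 i α β * K.t i δ γ
        + 𝕁 i β γ * K.t i δ α + 𝕁 i γ α * K.t i δ β))
      = -2 * ∑ i, (𝕁 0 γ δ * 𝕁 0 α β * (𝕁 i α β * K.t i δ γ)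
        + 𝕁 0 γ δ * 𝕁 0 α β * (𝕁 i β γ * K.t i δ α)
        + 𝕁 0 γ δ * 𝕁 0 α β * (𝕁 i γ α * K.t i δ β)) := fun α β γ δ => by
      simp only [Fin.sum_univ_three]; ring
    simp only [h4]
    simp only [Fin.sum_univ_three, mul_add, Finset.sum_add_distrib]
    simp only [← Finset.mul_sum _ _ (-2 : 𝒜), h1, h2, h3]
    simp
  rw [hR] at hb
  have hY : ∑ γ, ∑ β, (𝕁 0 * K.RM (Sum.inl β) (Sum.inl γ) * 𝕁 0) γ β
      = K.ric.trace + 16 * n * K.lam := by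
    -- Conjugating the curvature by J_0 returns minus the curvature, up to the curvature of V
    -- produced by commuting.
    have h1 : ∀ β γ, 𝕁 0 * K.RM (Sum.inl β) (Sum.inl γ) * 𝕁 0
        = -K.RM (Sum.inl β) (Sum.inl γ) + K.Rv 0 1 β γ • 𝕁 2 - K.Rv 0 2 β γ • 𝕁 1
          + K.Rv 0 0 β γ • 1 := fun β γ => by
      have := K.RM_jm (Sum.inl β) (Sum.inl γ) 0
      rw [sub_eq_iff_eq_add, ← sub_eq_iff_eq_add'] at this
      rw [← this, Fin.sum_univ_three]
      simp only [sub_mul, add_mul, mul_assoc, Matrix.smul_mul, jm_self, jm10, jm20, Rv,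
        Matrix.of_apply]
      simp only [mul_neg, mul_one, smul_neg]
      abel
    have h2 : K.ric.trace = ∑ γ, ∑ β, -K.RM (Sum.inl β) (Sum.inl γ) γ β := by
      simp only [ric, Matrix.trace, Matrix.diag, Matrix.of_apply]
      rw [Finset.sum_comm]
      refine Finset.sum_congr rfl fun γ _ => Finset.sum_congr rfl fun β _ => ?_
      simp only [RM, Matrix.of_apply]
      rw [R_swap]
    have h3 := K.trace_Rv_jm hn 0 1 2
    have h4 := K.trace_Rv_jm hn 0 2 1
    have h5 : K.Rv 0 0 = 0 := by
      ext β γ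
      exact eq_zero_of_eq_neg (K.R_vv_skew hn _ _ _ _)
    simp only [K.tv_eq hn, eps_eq] at h3 h4
    simp only [Matrix.trace, Matrix.diag, Matrix.mul_apply] at h3 h4
    rw [Finset.sum_comm] at h3 h4
    simp only [h1, h5, Matrix.add_apply, Matrix.sub_apply, Matrix.neg_apply, Matrix.smul_apply,
      smul_eq_mul, Matrix.zero_apply, zero_mul, add_zero, Finset.sum_add_distrib,
      Finset.sum_sub_distrib, h2, h3, h4]
    simp
    ring
  have hX : ∑ β, ∑ α, 𝕁 0 α β * (K.RM (Sum.inl α) (Sum.inl β) * 𝕁 0).trace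
      = 16 * n * n * K.lam := by
    have h3 := K.trace_Rv_jm hn 1 2 0
    simp only [K.tv_eq hn, eps_eq] at h3
    simp only [Matrix.trace, Matrix.diag, Matrix.mul_apply] at h3
    rw [Finset.sum_comm] at h3
    simp only [trace_RM_jm0]
    have : ∀ α β, 𝕁 0 α β * -(2 * n * K.R (Sum.inl α) (Sum.inl β) (Sum.inr 1) (Sum.inr 2))
        = 2 * n * (K.Rv 1 2 α β * 𝕁 0 β α) := fun α β => by
      rw [jm_apply_swap 0 β α, Rv, Matrix.of_apply]; ring
    simp only [this, ← Finset.mul_sum, h3]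
    simp
    ring
  have e1 : ∑ γ, ∑ β, ∑ α, ∑ δ, 𝕁 0 γ δ * 𝕁 0 α β * K.RM (Sum.inl α) (Sum.inl β) δ γ
      = ∑ β, ∑ α, 𝕁 0 α β * (K.RM (Sum.inl α) (Sum.inl β) * 𝕁 0).trace := by
    rw [Finset.sum_comm]
    refine Finset.sum_congr rfl fun β _ => ?_
    rw [Finset.sum_comm]
    refine Finset.sum_congr rfl fun α _ => ?_
    rw [Matrix.trace_mul_comm]
    simp only [Matrix.trace, Matrix.diag, Matrix.mul_apply, Finset.mul_sum]
    exact Finset.sum_congr rfl fun γ _ => Finset.sum_congr rfl fun δ _ => by ring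
  have e2 : ∑ γ, ∑ β, ∑ α, ∑ δ, 𝕁 0 γ δ * 𝕁 0 α β * K.RM (Sum.inl β) (Sum.inl γ) δ α
      = ∑ γ, ∑ β, (𝕁 0 * K.RM (Sum.inl β) (Sum.inl γ) * 𝕁 0) γ β := by
    simp only [Matrix.mul_apply, Finset.sum_mul]
    exact Finset.sum_congr rfl fun γ _ => Finset.sum_congr rfl fun β _ =>
        Finset.sum_congr rfl fun α _ => Finset.sum_congr rfl fun δ _ => by ring
  have e3 : ∑ γ, ∑ β, ∑ α, ∑ δ, 𝕁 0 γ δ * 𝕁 0 α β * K.RM (Sum.inl γ) (Sum.inl α) δ β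
      = ∑ γ, ∑ β, (𝕁 0 * K.RM (Sum.inl β) (Sum.inl γ) * 𝕁 0) γ β := by
    simp only [Matrix.mul_apply, Finset.sum_mul]
    refine Finset.sum_congr rfl fun γ _ => ?_
    rw [Finset.sum_comm]
    refine Finset.sum_congr rfl fun β _ =>
        Finset.sum_congr rfl fun α _ => Finset.sum_congr rfl fun δ _ => ?_
    simp only [RM, Matrix.of_apply]
    rw [R_swap, jm_apply_swap 0 α β]
    ring
  simp only [mul_add, Finset.sum_add_distrib, e1, e2, e3, hY, hX] at hb
  refine natCast_mul_cancel (k := 2) (by omega) ?_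
  push_cast
  linear_combination hb

/-- The Ricci tensor vanishes where the torsion does. -/
theorem ric_eq_zero (hn : n ≠ 0) (ev : 𝒜 →ₐ[ℝ] ℝ) (ht : ∀ i α β, ev (K.t i α β) = 0)
    (hl : ev K.lam = 0) (α β : HIdx n) : ev (K.ric α β) = 0 := by
  set Ric : Matrix (HIdx n) (HIdx n) ℝ := K.ric.map ev with hRic
  have hJ : ∀ i α β, ev (𝕁 i α β) = J n i α β := fun i α β => by simp [jm]
  -- Where the torsion vanishes so does the curvature of V on horizontal pairs. The horizontal
  -- curvature then commutes with all J_k and has no J_k-trace.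
  have hRv : ∀ a b i k, ev (K.R (Sum.inl a) (Sum.inl b) (Sum.inr i) (Sum.inr k)) = 0 := by
    intro a b i k
    have := congrFun (congrFun (K.Rv_eq hn i k) a) b
    rw [Rv, Matrix.of_apply] at this
    rw [this]
    simp [Matrix.mul_apply, Matrix.sum_apply, ht, K.tv_eq hn, hl]
  have htr : ∀ a b k, ∑ γ, ∑ δ, J n k γ δ * ev (K.RM (Sum.inl a) (Sum.inl b) δ γ) = 0 := by
    intro a b k
    have h1 : (K.RM (Sum.inl a) (Sum.inl b) * 𝕁 k).trace
        = -(2 * n * K.R (Sum.inl a) (Sum.inl b) (Sum.inr (k + 1)) (Sum.inr (k + 1 + 1))) := by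
      have h2 : k + 1 + 2 = k := by fin_cases k <;> rfl
      have := K.trace_RM_jm (Sum.inl a) (Sum.inl b) (k + 1)
      rwa [h2] at this
    rw [Matrix.trace_mul_comm] at h1
    have h3 := congrArg ev h1
    simpa [Matrix.trace, Matrix.mul_apply, hRv, hJ] using h3
  have hcomm : ∀ a b k γ β, ∑ δ, J n k γ δ * ev (K.RM (Sum.inl a) (Sum.inl b) δ β)
      = ∑ δ, ev (K.RM (Sum.inl a) (Sum.inl b) γ δ) * J n k δ β := by
    intro a b k γ β
    have := congrArg ev (congrFun (congrFun (K.RM_jm (Sum.inl a) (Sum.inl b) k) γ) β)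
    simp [Matrix.mul_apply, Matrix.sum_apply, hRv, hJ] at this
    linarith
  have hsymm : ∀ α β, Ric α β = Ric β α := by
    intro α β
    have h : ∑ γ, ev (K.RM (Sum.inl α) (Sum.inl β) γ γ + K.RM (Sum.inl β) (Sum.inl γ) γ α
        + K.RM (Sum.inl γ) (Sum.inl α) γ β) = 0 := by
      simp [K.bianchi_hhh, ht]
    have h0 : ∀ γ, K.RM (Sum.inl α) (Sum.inl β) γ γ = 0 := fun γ =>
      eq_zero_of_eq_neg (K.R_skew _ _ _ _)
    have h1 : ∀ γ, K.RM (Sum.inl β) (Sum.inl γ) γ α = -K.RM (Sum.inl γ) (Sum.inl β) γ α :=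
      fun γ => K.R_swap _ _ _ _
    simp only [h0, h1, map_add, map_neg, zero_add, Finset.sum_add_distrib,
      Finset.sum_neg_distrib] at h
    simp only [hRic, ric, Matrix.map_apply, Matrix.of_apply, map_sum]
    linarith
  have hRJ : ∀ k α β, (Ric * J n k) α β = (Ric * J n k) β α := by
    intro k α β
    have h : ∑ γ, ∑ δ, J n k γ δ * ev (K.RM (Sum.inl α) (Sum.inl β) δ γ
        + K.RM (Sum.inl β) (Sum.inl γ) δ α + K.RM (Sum.inl γ) (Sum.inl α) δ β) = 0 := by
      simp [K.bianchi_hhh, ht]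
    have h1 : ∀ γ δ, K.RM (Sum.inl β) (Sum.inl γ) δ α = -K.RM (Sum.inl γ) (Sum.inl β) δ α :=
      fun γ δ => K.R_swap _ _ _ _
    simp only [h1, map_add, map_neg, mul_add, mul_neg, Finset.sum_add_distrib, htr, zero_add,
      Finset.sum_neg_distrib] at h
    simp only [hcomm] at h
    have h2 : ∀ α β, (Ric * J n k) α β
        = ∑ γ, ∑ δ, ev (K.RM (Sum.inl γ) (Sum.inl α) γ δ) * J n k δ β := fun α β => by
      simp only [hRic, ric, Matrix.mul_apply, Matrix.map_apply, Matrix.of_apply, map_sum,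
        Finset.sum_mul]
      exact Finset.sum_comm
    rw [h2, h2]
    linarith
  -- Ric and Ric J_k are both symmetric while J_k is skew, so Ric anticommutes with every J_k. But
  -- J_2 = J_0 J_1 then commutes with Ric as well, whence Ric = 0.
  have hanti : ∀ k, Ric * J n k = -(J n k * Ric) := fun k => by
    have h1 : (Ric * J n k)ᵀ = Ric * J n k := by
      ext α β; exact hRJ k β α
    have h2 : Ricᵀ = Ric := by
      ext α β; exact hsymm β α
    rw [← h1, Matrix.transpose_mul, h2, J_transpose, neg_mul]
  have h2 : Ric * J n 2 = J n 2 * Ric := by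
    rw [← J_zero_one, ← mul_assoc, hanti, neg_mul, mul_assoc, hanti, mul_neg, neg_neg, mul_assoc]
  have h3 : Ric * J n 2 = 0 := by
    have := hanti 2
    rw [← h2] at this
    have h5 : (2 : ℝ) • (Ric * J n 2) = 0 := by
      rw [two_smul]; nth_rewrite 1 [this]; simp
    exact (smul_eq_zero.1 h5).resolve_left two_ne_zero
  have h4 : Ric = 0 := by
    have := congrArg (fun X => X * J n 2) h3
    simp only [mul_assoc, J_mul_self, zero_mul] at this
    simpa using this
  exact congrFun (congrFun h4 α) β

end FrameCalculus

end QC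

/-! ### Divergences and contractions of the mixed Bianchi identities. -/

namespace QC

open Matrix

namespace FrameCalculus

set_option linter.unusedSectionVars false

variable {n : ℕ} {𝒜 : Type*} [CommRing 𝒜] [Algebra ℝ 𝒜] (K : FrameCalculus n 𝒜)

local notation "𝕁" => jm n 𝒜

/-- The almost complex structures acting on vectors. -/
def jv (n : ℕ) (𝒜 : Type*) [CommRing 𝒜] [Algebra ℝ 𝒜] (i : Fin 3) :
    (HIdx n → 𝒜) →ₗ[ℝ] (HIdx n → 𝒜) :=
  ((jm n 𝒜 i).mulVecLin).restrictScalars ℝ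

local notation "𝕛" => jv n 𝒜

theorem jv_apply (i : Fin 3) (v : HIdx n → 𝒜) (β : HIdx n) : 𝕛 i v β = ∑ γ, 𝕁 i β γ * v γ := rfl

theorem jv_eq (i : Fin 3) (v : HIdx n → 𝒜) : 𝕛 i v = 𝕁 i *ᵥ v := rfl

theorem jv_self (i : Fin 3) (v : HIdx n → 𝒜) : 𝕛 i (𝕛 i v) = -v := by
  rw [jv_eq, jv_eq, Matrix.mulVec_mulVec, jm_self, Matrix.neg_mulVec, Matrix.one_mulVec]
theorem jv01 (v : HIdx n → 𝒜) : 𝕛 0 (𝕛 1 v) = 𝕛 2 v := by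
  simp only [jv_eq, Matrix.mulVec_mulVec, jm01]
theorem jv12 (v : HIdx n → 𝒜) : 𝕛 1 (𝕛 2 v) = 𝕛 0 v := by
  simp only [jv_eq, Matrix.mulVec_mulVec, jm12]
theorem jv20 (v : HIdx n → 𝒜) : 𝕛 2 (𝕛 0 v) = 𝕛 1 v := by
  simp only [jv_eq, Matrix.mulVec_mulVec, jm20]
theorem jv10 (v : HIdx n → 𝒜) : 𝕛 1 (𝕛 0 v) = -𝕛 2 v := by
  simp only [jv_eq, Matrix.mulVec_mulVec, jm10, Matrix.neg_mulVec]
theorem jv21 (v : HIdx n → 𝒜) : 𝕛 2 (𝕛 1 v) = -𝕛 0 v := by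
  simp only [jv_eq, Matrix.mulVec_mulVec, jm21, Matrix.neg_mulVec]
theorem jv02 (v : HIdx n → 𝒜) : 𝕛 0 (𝕛 2 v) = -𝕛 1 v := by
  simp only [jv_eq, Matrix.mulVec_mulVec, jm02, Matrix.neg_mulVec]

/-- Contraction of the derivative index of a family of matrices with the first matrix index. -/
def Div (X : HIdx n → Matrix (HIdx n) (HIdx n) 𝒜) : HIdx n → 𝒜 := fun β => ∑ γ, X γ γ β

theorem Div_mul_jm (X : HIdx n → Matrix (HIdx n) (HIdx n) 𝒜) (k : Fin 3) :
    Div (fun γ => X γ * 𝕁 k) = -𝕛 k (Div X) := by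
  ext β
  simp only [Div, jv_apply, Pi.neg_apply, Matrix.mul_apply, Finset.mul_sum]
  rw [Finset.sum_comm, ← Finset.sum_neg_distrib]
  refine Finset.sum_congr rfl fun δ _ => ?_
  rw [← Finset.sum_neg_distrib]
  refine Finset.sum_congr rfl fun γ _ => ?_
  rw [jm_apply_swap k δ β]
  ring

theorem Div_add (X Y : HIdx n → Matrix (HIdx n) (HIdx n) 𝒜) :
    Div (fun γ => X γ + Y γ) = Div X + Div Y := by
  ext β; simp [Div, Finset.sum_add_distrib]

theorem Div_sub (X Y : HIdx n → Matrix (HIdx n) (HIdx n) 𝒜) :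
    Div (fun γ => X γ - Y γ) = Div X - Div Y := by
  ext β; simp [Div, Finset.sum_sub_distrib]

theorem Div_neg (X : HIdx n → Matrix (HIdx n) (HIdx n) 𝒜) :
    Div (fun γ => -X γ) = -Div X := by
  ext β; simp [Div]

theorem Div_smul (c : ℝ) (X : HIdx n → Matrix (HIdx n) (HIdx n) 𝒜) :
    Div (fun γ => c • X γ) = c • Div X := by
  ext β; simp [Div, Finset.smul_sum]

theorem N_smul (a : Idx n) (c : ℝ) (X : Matrix (HIdx n) (HIdx n) 𝒜) :
    K.N a (c • X) = c • K.N a X := by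
  have : K.DM a (c • X) = c • K.DM a X := by ext; simp [DM]
  simp only [N, this, Matrix.mul_smul, Matrix.smul_mul, smul_sub, smul_add]

theorem N_smul' (a : Idx n) (c : 𝒜) (X : Matrix (HIdx n) (HIdx n) 𝒜) :
    K.N a (c • X) = K.D a c • X + c • K.N a X := by
  simp only [N, DM_smul, Matrix.mul_smul, Matrix.smul_mul, smul_sub, smul_add]
  abel

theorem N_transpose (a : Idx n) (X : Matrix (HIdx n) (HIdx n) 𝒜) :
    (K.N a X)ᵀ = K.N a Xᵀ := by
  have : (K.DM a X)ᵀ = K.DM a Xᵀ := rfl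
  simp only [N, Matrix.transpose_sub, Matrix.transpose_add, Matrix.transpose_mul, Ω_transpose, this]
  noncomm_ring

theorem trace_N (a : Idx n) (X : Matrix (HIdx n) (HIdx n) 𝒜) :
    (K.N a X).trace = K.D a X.trace := by
  rw [N, Matrix.trace_sub, Matrix.trace_add, Matrix.trace_mul_comm (K.Ω a), add_sub_cancel_right]
  simp [DM, Matrix.trace]

/-- The covariant derivative of J_j is a combination of the J_i, with which X also commutes, so
those terms cancel. -/
theorem N_comm_jm {X : Matrix (HIdx n) (HIdx n) 𝒜} (hX : ∀ j, 𝕁 j * X = X * 𝕁 j) (a : Idx n)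
    (j : Fin 3) : 𝕁 j * K.N a X = K.N a X * 𝕁 j := by
  have h := congrArg (K.N a) (hX j)
  rw [N_mul, N_mul, N_jm, Finset.sum_mul, Finset.mul_sum] at h
  simp only [Matrix.mul_smul, Matrix.smul_mul, hX] at h
  linear_combination (norm := abel) h

theorem N_μ_comm (hn : n ≠ 0) (a : Idx n) (j : Fin 3) :
    𝕁 j * K.N a K.μ = K.N a K.μ * 𝕁 j := K.N_comm_jm (K.μ_comm hn) a j

/-- The operator ∑ J_i X J_i is parallel although the single J_i are not: the connection on V is
skew, and the extra terms cancel in pairs. -/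
theorem N_τ_casimir (hn : n ≠ 0) (a : Idx n) : ∑ i, 𝕁 i * K.N a K.τ * 𝕁 i = K.N a K.τ := by
  have h := congrArg (K.N a) (K.τ_casimir hn)
  simp only [Fin.sum_univ_three, N_add, N_mul, N_jm, K.γ_skew hn a 1 0, K.γ_skew hn a 2 0,
    K.γ_skew hn a 2 1, eq_zero_of_eq_neg (K.γ_skew hn a _ _), add_mul, mul_add,
    Matrix.mul_smul, Matrix.smul_mul, neg_smul, mul_neg, neg_mul, zero_smul,
    mul_zero, zero_mul] at h ⊢
  linear_combination (norm := abel) h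

theorem NV_t (hn : n ≠ 0) (a : Idx n) (i : Fin 3) : K.NV a K.t i
    = (1 / 4 : ℝ) • (𝕁 i * K.N a K.τ - K.N a K.τ * 𝕁 i) + 𝕁 i * K.N a K.μ := by
  rw [NV]
  simp only [K.t_eq_τμ hn, N_add, N_smul, N_sub, N_mul, N_jm, Fin.sum_univ_three, add_mul, mul_add,
    Matrix.smul_mul, Matrix.mul_smul]
  simp only [smul_add, smul_sub, smul_comm (K.γ _ _ _) (1 / 4 : ℝ)]
  abel

theorem NT_vvv (hn : n ≠ 0) (a : Idx n) (k i j : Fin 3) :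
    K.NT (Sum.inr k) (Sum.inr i) (Sum.inr j) a = eps k i j • K.D a K.lam := by
  have h0 : ∀ i, K.γ a i i = 0 := fun i => eq_zero_of_eq_neg (K.γ_skew hn a i i)
  simp only [NT, Fintype.sum_sum_type, Γ_hv, Γ_vh, zero_mul, Finset.sum_const_zero, zero_add, Γ_vv,
    T_vvv, K.tv_eq hn, Fin.sum_univ_three, Derivation.map_smul]
  simp only [eps_eq]
  fin_cases k <;> fin_cases i <;> fin_cases j <;>
    simp [h0, K.γ_skew hn a 1 0, K.γ_skew hn a 2 0, K.γ_skew hn a 2 1]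

/-- Horizontal gradient of `lam`. -/
def dlam : HIdx n → 𝒜 := fun β => K.D (Sum.inl β) K.lam

/-- Mixed curvature of `V`. -/
def rv (j i k : Fin 3) : HIdx n → 𝒜 := fun β => K.R (Sum.inr j) (Sum.inl β) (Sum.inr i) (Sum.inr k)

theorem rv_skew (hn : n ≠ 0) (j i k : Fin 3) : K.rv j i k = -K.rv j k i := by
  ext β
  exact K.R_vv_skew hn _ _ _ _

theorem rv_sub (hn : n ≠ 0) (i j k : Fin 3) :
    K.rv j i k - K.rv i j k = eps k i j • K.dlam + (2 : ℝ) • 𝕛 k (K.th i j) := by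
  ext β
  have h := K.bianchi_vvh_v i j k β
  rw [K.NT_vvv hn] at h
  simp only [rv, dlam, Pi.sub_apply, Pi.add_apply, Pi.smul_apply, jv_apply]
  rw [h, sub_eq_add_neg]
  congr 1
  simp only [jm_apply_swap k β, Algebra.smul_def, map_ofNat, neg_mul, Finset.sum_neg_distrib,
    mul_neg]
  simp only [mul_comm (𝕁 k _ _)]

/-- The same algebra as for the Koszul formula: a three-index quantity skew in its last two indices
is determined by its skew part in the first two, which is `rv_sub`. -/
theorem rv_eq (hn : n ≠ 0) (j i k : Fin 3) :
    K.rv j i k = (1 / 2 * (eps k i j + eps i j k - eps j k i)) • K.dlam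
      + (𝕛 k (K.th i j) + 𝕛 i (K.th j k) - 𝕛 j (K.th k i)) := by
  have h1 := K.rv_sub hn i j k
  have h2 := K.rv_sub hn j k i
  have h3 := K.rv_sub hn k i j
  rw [K.rv_skew hn j k i] at h2
  rw [K.rv_skew hn i k j, K.rv_skew hn k i j] at h3
  linear_combination (norm := module) (1 / 2 : ℝ) • (h1 + h2 - h3)

/-- Divergences of `τ` and `μ`, and their quaternionic variants. -/
def p : HIdx n → 𝒜 := Div fun γ => K.N (Sum.inl γ) K.τ

def m : HIdx n → 𝒜 := Div fun γ => K.N (Sum.inl γ) K.μ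

def y (k : Fin 3) : HIdx n → 𝒜 := Div fun γ => 𝕁 k * K.N (Sum.inl γ) K.τ

/-- The divergence of `N_τ_casimir`. The vectors `y k` are otherwise unknown, and later relations
are combined so that only this sum occurs. -/
theorem sum_jv_y (hn : n ≠ 0) : 𝕛 0 (K.y 0) + 𝕛 1 (K.y 1) + 𝕛 2 (K.y 2) = -K.p := by
  have h : Div (fun γ => ∑ i, 𝕁 i * K.N (Sum.inl γ) K.τ * 𝕁 i) = K.p := by
    simp only [K.N_τ_casimir hn]; rfl
  simp only [Fin.sum_univ_three, Div_add, Div_mul_jm] at h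
  rw [← h, y, y, y]
  abel

theorem Div_NV_t (hn : n ≠ 0) (i : Fin 3) : Div (fun γ => K.NV (Sum.inl γ) K.t i)
    = (1 / 4 : ℝ) • (K.y i + 𝕛 i K.p) - 𝕛 i K.m := by
  simp only [K.NV_t hn, Div_add, Div_smul, Div_sub, Div_mul_jm, K.N_μ_comm hn]
  rw [y, p, m]
  module

theorem Div_jm_NV_t (hn : n ≠ 0) (k i : Fin 3) :
    Div (fun γ => 𝕁 k * K.NV (Sum.inl γ) K.t i)
      = (1 / 4 : ℝ) • (Div (fun γ => 𝕁 k * 𝕁 i * K.N (Sum.inl γ) K.τ) + 𝕛 i (K.y k))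
        + 𝕛 i (𝕛 k K.m) := by
  have h : ∀ γ, 𝕁 k * K.NV (Sum.inl γ) K.t i
      = (1 / 4 : ℝ) • (𝕁 k * 𝕁 i * K.N (Sum.inl γ) K.τ - 𝕁 k * K.N (Sum.inl γ) K.τ * 𝕁 i)
        + K.N (Sum.inl γ) K.μ * 𝕁 k * 𝕁 i := fun γ => by
    rw [K.NV_t hn, mul_add, Matrix.mul_smul, mul_sub, K.N_μ_comm hn, ← mul_assoc, ← mul_assoc,
      ← mul_assoc, K.N_μ_comm hn]
  simp only [h, Div_add, Div_smul, Div_sub, Div_mul_jm]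
  rw [y, m, map_neg]
  module

/-- Mixed Ricci curvature. -/
def W (i : Fin 3) : HIdx n → 𝒜 := fun β => ∑ γ, K.RM (Sum.inl γ) (Sum.inr i) γ β

theorem trace_NV_t (hn : n ≠ 0) (a : Idx n) (i : Fin 3) : (K.NV a K.t i).trace = 0 := by
  rw [K.NV_t hn, Matrix.trace_add, Matrix.trace_smul, Matrix.trace_sub,
    Matrix.trace_mul_comm (𝕁 i), sub_self, smul_zero, zero_add]
  apply eq_zero_of_eq_neg
  nth_rewrite 1 [← Matrix.trace_transpose]
  rw [Matrix.transpose_mul, jm_transpose, N_transpose, K.μ_transpose hn, mul_neg, Matrix.trace_neg,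
    ← Matrix.trace_mul_comm]

theorem trace_jm_NV_t (hn : n ≠ 0) (a : Idx n) (i k : Fin 3) :
    (K.NV a K.t i * 𝕁 k).trace = 0 := by
  have hs : ∀ (X : Matrix (HIdx n) (HIdx n) 𝒜), Xᵀ = X → ∀ k, (X * 𝕁 k).trace = 0 := by
    intro X hX k
    apply eq_zero_of_eq_neg
    nth_rewrite 1 [← Matrix.trace_transpose]
    rw [Matrix.transpose_mul, jm_transpose, hX, neg_mul, Matrix.trace_neg, Matrix.trace_mul_comm]
  have h1 := hs (K.N a K.τ) (by rw [N_transpose, K.τ_transpose hn])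
  have h2 := hs (K.N a K.μ) (by rw [N_transpose, K.μ_transpose hn])
  have q := quatTriple_jm (n := n) (𝒜 := 𝒜) i
  rw [K.NV_t hn, K.N_μ_comm hn, add_mul, Matrix.trace_add, Matrix.smul_mul, Matrix.trace_smul,
    ← neg_sub, neg_mul, Matrix.trace_neg, trace_comm_jm, mul_assoc]
  rcases fin3_cases i k with rfl | rfl | rfl
  · simp [jm_self, trace_N, K.trace_μ hn]
  · simp [q.ab, q.ba, h1, h2]
  · simp [q.ac, q.ca, h1, h2]

/-- The trace of `bianchi_vhh_h` over the upper index and γ. One curvature term drops out by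
skewness and one torsion term because T(R_i, ·) stays trace-free under differentiation. -/
theorem W_eq (hn : n ≠ 0) (i : Fin 3) : K.W i
    = Div (fun γ => K.NV (Sum.inl γ) K.t i) - (2 : ℝ) • ∑ j, 𝕛 j (K.th j i) := by
  ext β
  have h := Finset.sum_congr rfl fun γ (_ : γ ∈ Finset.univ) => K.bianchi_vhh_h i β γ γ
  have h0 : ∀ γ, K.RM (Sum.inr i) (Sum.inl β) γ γ = 0 := fun γ =>
      eq_zero_of_eq_neg (K.R_skew _ _ _ _)
  have h1 : ∀ γ, K.RM (Sum.inl γ) (Sum.inr i) γ β = -K.RM (Sum.inr i) (Sum.inl γ) γ β :=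
      fun γ => K.R_swap _ _ _ _
  have h2 : ∑ γ, K.NV (Sum.inl β) K.t i γ γ = 0 := K.trace_NV_t hn (Sum.inl β) i
  simp only [h0, zero_sub, Finset.sum_sub_distrib, Finset.sum_add_distrib, Finset.sum_neg_distrib,
    h2, ← Finset.mul_sum] at h
  rw [Finset.sum_comm] at h
  simp only [W, h1, Finset.sum_neg_distrib, Div, Pi.sub_apply, Pi.smul_apply, Finset.sum_apply,
    jv_apply]
  simp only [Algebra.smul_def, map_ofNat]
  linear_combination h

/-- Contraction of the Bianchi identity with an almost complex structure. -/
theorem contracted_bianchi (hn : n ≠ 0) (i k : Fin 3) :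
    (fun β => (K.RM (Sum.inr i) (Sum.inl β) * 𝕁 k).trace) - 𝕛 k (K.W i) - ∑ l, 𝕛 l (K.rv i k l)
      = Div (fun γ => 𝕁 k * K.NV (Sum.inl γ) K.t i) - (2 : ℝ) • ∑ j, 𝕛 j (𝕛 k (K.th j i)) := by
  ext β
  have h := Finset.sum_congr rfl fun γ (_ : γ ∈ Finset.univ) =>
    Finset.sum_congr rfl fun δ (_ : δ ∈ Finset.univ) =>
      congrArg (fun x => 𝕁 k γ δ * x) (K.bianchi_vhh_h i β γ δ)
  have h1 : ∀ γ, K.RM (Sum.inl γ) (Sum.inr i) γ β = -K.RM (Sum.inr i) (Sum.inl γ) γ β :=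
      fun γ => K.R_swap _ _ _ _
  have h2 : ∑ γ, ∑ δ, 𝕁 k γ δ * K.RM (Sum.inr i) (Sum.inl β) δ γ
      = (K.RM (Sum.inr i) (Sum.inl β) * 𝕁 k).trace := by
    rw [Matrix.trace_mul_comm]; rfl
  -- Moving J_k to the other side of the curvature matrix turns the contraction into mixed Ricci
  -- curvature, at the cost of mixed curvature of V.
  have h3 : ∑ γ, ∑ δ, 𝕁 k γ δ * K.RM (Sum.inr i) (Sum.inl γ) δ β
      = 𝕛 k (K.W i) β + ∑ l, 𝕛 l (K.rv i k l) β := by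
    have e : ∀ γ, ∑ δ, 𝕁 k γ δ * K.RM (Sum.inr i) (Sum.inl γ) δ β
        = (K.RM (Sum.inr i) (Sum.inl γ) * 𝕁 k) γ β - ∑ l, K.rv i k l γ * 𝕁 l γ β := fun γ => by
      have := congrFun (congrFun (K.RM_jm (Sum.inr i) (Sum.inl γ) k) γ) β
      simp only [Matrix.sub_apply, Matrix.sum_apply, Matrix.smul_apply, smul_eq_mul] at this
      rw [Matrix.mul_apply (M := 𝕁 k)] at this
      simp only [rv]
      rw [← this]
      ring
    simp only [e, Finset.sum_sub_distrib, jv_apply, W, Matrix.mul_apply, Finset.mul_sum]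
    rw [sub_eq_add_neg]
    congr 1
    · rw [Finset.sum_comm]
      refine Finset.sum_congr rfl fun δ _ => Finset.sum_congr rfl fun γ _ => ?_
      rw [jm_apply_swap k β δ]
      have : K.RM (Sum.inl γ) (Sum.inr i) γ δ = -K.RM (Sum.inr i) (Sum.inl γ) γ δ := K.R_swap _ _ _ _
      rw [this]
      ring
    · rw [Finset.sum_comm, ← Finset.sum_neg_distrib]
      refine Finset.sum_congr rfl fun l _ => ?_
      rw [← Finset.sum_neg_distrib]
      refine Finset.sum_congr rfl fun γ _ => ?_
      rw [jm_apply_swap l β γ]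
      ring
  have h4 : ∑ γ, ∑ δ, 𝕁 k γ δ * K.NV (Sum.inl β) K.t i δ γ = 0 := by
    have := K.trace_jm_NV_t hn (Sum.inl β) i k
    rw [Matrix.trace_mul_comm] at this
    exact this
  have h5 : ∑ γ, ∑ δ, 𝕁 k γ δ * (2 * ∑ j, 𝕁 j β γ * K.th j i δ)
      = 2 * ∑ j, 𝕛 j (𝕛 k (K.th j i)) β := by
    simp only [jv_apply, Finset.mul_sum]
    have : ∀ γ, ∑ δ, ∑ j, 𝕁 k γ δ * (2 * (𝕁 j β γ * K.th j i δ))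
      = ∑ j, ∑ δ, 2 * (𝕁 j β γ * (𝕁 k γ δ * K.th j i δ)) := fun γ => by
      rw [Finset.sum_comm]
      exact Finset.sum_congr rfl fun _ _ => Finset.sum_congr rfl fun _ _ => by ring
    simp only [this]
    exact Finset.sum_comm
  simp only [mul_sub, mul_add, mul_neg, Finset.sum_sub_distrib, Finset.sum_add_distrib,
    Finset.sum_neg_distrib, h2, h3, h4, h5] at h
  simp only [Pi.sub_apply, Pi.smul_apply, Finset.sum_apply, Div, Matrix.mul_apply]
  simp only [Algebra.smul_def, map_ofNat]
  linear_combination h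

end FrameCalculus

end QC

/-! ### Two linear relations between p, m, a and dλ. -/

namespace QC

open Matrix

namespace FrameCalculus

set_option linter.unusedSectionVars false

variable {n : ℕ} {𝒜 : Type*} [CommRing 𝒜] [Algebra ℝ 𝒜] (K : FrameCalculus n 𝒜)

local notation "𝕁" => jm n 𝒜
local notation "𝕛" => jv n 𝒜

/-- The horizontal torsion of `V`, with the vertical two-form index dualized. -/
def av (i : Fin 3) : HIdx n → 𝒜 := (2 : ℝ) • K.th (i + 1) (i + 2)

theorem th_swap (i j : Fin 3) : K.th i j = -K.th j i := by
  ext β; exact K.T_skew _ _ _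

theorem th_eq (i j : Fin 3) : K.th i j = (1 / 2 : ℝ) • ∑ k, eps i j k • K.av k := by
  have h0 : ∀ i, K.th i i = 0 := fun i => by ext β; exact K.T_self _ _
  have a0 : K.av 0 = (2 : ℝ) • K.th 1 2 := rfl
  have a1 : K.av 1 = (2 : ℝ) • K.th 2 0 := rfl
  have a2 : K.av 2 = (2 : ℝ) • K.th 0 1 := rfl
  simp only [Fin.sum_univ_three, eps_eq, a0, a1, a2]
  fin_cases i <;> fin_cases j <;> simp [h0, K.th_swap 1 0, K.th_swap 2 1, K.th_swap 0 2]

/-- `∑ J_i a_i`. -/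
def aa : HIdx n → 𝒜 := ∑ i, 𝕛 i (K.av i)

theorem trace_RM_vec (i j k l : Fin 3) (h : k = j + 1) (h' : l = j + 2) :
    (fun β => (K.RM (Sum.inr i) (Sum.inl β) * 𝕁 l).trace) = -(2 * n : ℝ) • K.rv i j k := by
  subst h h'
  ext β
  rw [trace_RM_jm]
  simp [rv, Algebra.smul_def, map_ofNat]

theorem contracted_bianchi' (hn : n ≠ 0) (i j k l : Fin 3) (h : l = j + 1) (h' : k = j + 2) :
    -(2 * n : ℝ) • K.rv i j l - 𝕛 k (K.W i) - ∑ l, 𝕛 l (K.rv i k l)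
      = (1 / 4 : ℝ) • (Div (fun γ => 𝕁 k * 𝕁 i * K.N (Sum.inl γ) K.τ) + 𝕛 i (K.y k))
        + 𝕛 i (𝕛 k K.m) - (2 : ℝ) • ∑ j, 𝕛 j (𝕛 k (K.th j i)) := by
  rw [← K.trace_RM_vec i j l k h h', K.contracted_bianchi hn, K.Div_jm_NV_t hn]

theorem W_eq' (hn : n ≠ 0) (i : Fin 3) : K.W i
    = (1 / 4 : ℝ) • (K.y i + 𝕛 i K.p) - 𝕛 i K.m - (2 : ℝ) • ∑ j, 𝕛 j (K.th j i) := by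
  rw [K.W_eq hn, K.Div_NV_t hn]

/-- The diagonal contractions k = i, summed over i. There J_k J_i = -1 produces p, and the remaining
terms in `y` combine to the sum known from `sum_jv_y`. -/
theorem eq_two (hn : n ≠ 0) :
    (2 : ℝ) • K.p + (n + 2 : ℝ) • K.aa + (3 * n : ℝ) • K.dlam = 0 := by
  have h0 := K.contracted_bianchi' hn 0 1 0 2 rfl rfl
  have h1 := K.contracted_bianchi' hn 1 2 1 0 rfl rfl
  have h2 := K.contracted_bianchi' hn 2 0 2 1 rfl rfl
  have hy := K.sum_jv_y hn
  simp only [jm_self, neg_mul, one_mul, Div_neg] at h0 h1 h2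
  rw [← p] at h0 h1 h2
  simp only [K.W_eq' hn, K.rv_eq hn, th_eq, Fin.sum_univ_three, map_add, map_sub,
    map_smul, jv_self, jv01, jv10, jv02, jv20, jv12, jv21, eps_eq] at h0 h1 h2
  simp at h0 h1 h2
  simp only [aa, Fin.sum_univ_three]
  linear_combination (norm := module) h0 + h1 + h2 + (1 / 2 : ℝ) • hy

/-- The off-diagonal contractions: the relation for (i, k) is hit with the third structure and all
six are added with the sign of the permutation. This alternating combination again leaves `y` only
through `sum_jv_y`. -/
theorem eq_one (hn : n ≠ 0) :
    (-2 : ℝ) • K.p + (12 : ℝ) • K.m + (1 - 4 * n : ℝ) • K.aa - (3 : ℝ) • K.dlam = 0 := by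
  have h01 := congrArg (𝕛 2) (K.contracted_bianchi' hn 0 2 1 0 rfl rfl)
  have h10 := congrArg (𝕛 2) (K.contracted_bianchi' hn 1 1 0 2 rfl rfl)
  have h12 := congrArg (𝕛 0) (K.contracted_bianchi' hn 1 0 2 1 rfl rfl)
  have h21 := congrArg (𝕛 0) (K.contracted_bianchi' hn 2 2 1 0 rfl rfl)
  have h20 := congrArg (𝕛 1) (K.contracted_bianchi' hn 2 1 0 2 rfl rfl)
  have h02 := congrArg (𝕛 1) (K.contracted_bianchi' hn 0 0 2 1 rfl rfl)
  have hy := K.sum_jv_y hn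
  simp only [jm01, jm10, jm12, jm21, jm02, jm20, neg_mul, Div_neg] at h01 h10 h12 h21 h20 h02
  have hyd : ∀ k, Div (fun γ => 𝕁 k * K.N (Sum.inl γ) K.τ) = K.y k := fun _ => rfl
  simp only [hyd] at h01 h10 h12 h21 h20 h02
  simp only [K.W_eq' hn, K.rv_eq hn, th_eq, Fin.sum_univ_three, map_add, map_sub, map_neg,
    map_smul, jv_self, jv01, jv10, jv02, jv20, jv12, jv21, eps_eq] at h01 h10 h12 h21 h20 h02
  simp at h01 h10 h12 h21 h20 h02
  simp only [aa, Fin.sum_univ_three]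
  linear_combination (norm := module) h01 - h10 + h12 - h21 + h20 - h02 - (1 / 2 : ℝ) • hy

end FrameCalculus

end QC

/-! ### Evaluation at a point: orders two and three. -/

namespace QC

open Matrix

namespace FrameCalculus

set_option linter.unusedSectionVars false

variable {n : ℕ} {𝒜 : Type*} [CommRing 𝒜] [Algebra ℝ 𝒜] (K : FrameCalculus n 𝒜)

local notation "𝕁" => jm n 𝒜
local notation "𝕛" => jv n 𝒜

variable (ev : 𝒜 →ₐ[ℝ] ℝ)

theorem mapMatrix_jm (i : Fin 3) : ev.mapMatrix (𝕁 i) = J n i := by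
  ext α β; simp [jm]

/-- Horizontal part of `Q`. -/
def Qh : Matrix (HIdx n) (HIdx n) 𝒜 :=
  (1 / 2 : ℝ) • K.τ + K.μ - ((1 + 4 * n) / 4 : ℝ) • (K.lam • (1 : Matrix (HIdx n) (HIdx n) 𝒜))

/-- Mixed part of `Q`. -/
def Qm (i : Fin 3) : HIdx n → 𝒜 := (-(1 / 2) : ℝ) • K.av i - (1 / 4 : ℝ) • 𝕛 i K.aa

theorem trace_Qh (hn : n ≠ 0) : K.Qh.trace = (-(n * (1 + 4 * n)) : ℝ) • K.lam := by
  simp only [Qh, Matrix.trace_sub, Matrix.trace_add, Matrix.trace_smul, K.trace_τ hn, K.trace_μ hn,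
    trace_one, smul_zero, add_zero, zero_sub, smul_eq_mul]
  simp only [Algebra.smul_def]
  have : (4 * n : 𝒜) = algebraMap ℝ 𝒜 (4 * n) := by simp [map_ofNat]
  rw [this, mul_comm K.lam, ← mul_assoc, ← map_mul, ← neg_mul, ← map_neg]
  congr 2
  ring

/-- The algebraic torsion vanishes where `Q` does. -/
theorem lam_τ_μ_eq_zero (hn : n ≠ 0) (h : ∀ α β, ev (K.Qh α β) = 0) :
    ev K.lam = 0 ∧ ev.mapMatrix K.τ = 0 ∧ ev.mapMatrix K.μ = 0 := by
  have h0 : ev.mapMatrix K.Qh = 0 := by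
    ext α β; exact h α β
  have hl : ev K.lam = 0 := by
    have h1 : ev (K.Qh.trace) = 0 := by
      simp only [Matrix.trace, Matrix.diag, map_sum, h, Finset.sum_const_zero]
    rw [K.trace_Qh hn, map_smul, smul_eq_mul] at h1
    have hn' : (0 : ℝ) < n := by exact_mod_cast Nat.pos_of_ne_zero hn
    exact (mul_eq_zero.1 h1).resolve_left (neg_ne_zero.2 (by positivity))
  refine ⟨hl, ?_⟩
  have hz : ev.mapMatrix (K.lam • (1 : Matrix (HIdx n) (HIdx n) 𝒜)) = 0 := by
    ext α β; simp [hl]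
  rw [Qh, map_sub, map_add, map_smul, map_smul, hz, smul_zero, sub_zero] at h0
  have ht := congrArg ev.mapMatrix (K.τ_casimir hn)
  have hm : ∀ i, J n i * ev.mapMatrix K.μ * J n i = -ev.mapMatrix K.μ := fun i => by
    have := congrArg ev.mapMatrix (K.μ_comm hn i)
    rw [map_mul, map_mul, mapMatrix_jm] at this
    rw [this, mul_assoc, J_mul_self]; simp
  -- The operator X ↦ ∑ J_i X J_i has eigenvalue 1 on τ and -3 on μ, so it turns ½τ + μ into ½τ -
  -- 3μ. The difference is 4μ.
  have h1 := congrArg (fun X => ∑ i, J n i * X * J n i) h0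
  simp only [map_sum, map_mul, mapMatrix_jm] at ht
  simp only [mul_add, add_mul, Finset.sum_add_distrib, Matrix.mul_smul, Matrix.smul_mul,
    ← Finset.smul_sum, ht, hm, mul_zero, zero_mul, Finset.sum_const_zero] at h1
  rw [Fin.sum_univ_three] at h1
  have hμ : ev.mapMatrix K.μ = 0 := by
    linear_combination (norm := module) (1 / 4 : ℝ) • (h0 - h1)
  rw [hμ, add_zero] at h0
  exact ⟨(smul_eq_zero.1 h0).resolve_left (by norm_num), hμ⟩

theorem t_eq_zero (hn : n ≠ 0) (hτ : ev.mapMatrix K.τ = 0) (hμ : ev.mapMatrix K.μ = 0)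
    (i : Fin 3) : ev.mapMatrix (K.t i) = 0 := by
  rw [K.t_eq_τμ hn]
  simp [map_add, map_sub, map_mul, hτ, hμ]

/-- Evaluation of a vector. -/
def evV : (HIdx n → 𝒜) →ₗ[ℝ] (HIdx n → ℝ) := ev.toLinearMap.compLeft _

theorem evV_apply (v : HIdx n → 𝒜) (β : HIdx n) : evV ev v β = ev (v β) := rfl

theorem evV_jv (i : Fin 3) (v : HIdx n → 𝒜) : evV ev (𝕛 i v) = J n i *ᵥ evV ev v := by
  ext β
  simp [evV_apply, jv_apply, Matrix.mulVec, dotProduct, jm]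

theorem evV_jv_eq_zero {i : Fin 3} {v : HIdx n → 𝒜} (h : evV ev v = 0) : evV ev (𝕛 i v) = 0 := by
  rw [evV_jv, h, Matrix.mulVec_zero]

/-- Flat divergence at a point. -/
def dq : (HIdx n → 𝒜) →ₗ[ℝ] ℝ :=
  ∑ α, ev.toLinearMap ∘ₗ ((K.D (Sum.inl α)).toLinearMap) ∘ₗ LinearMap.proj α

theorem dq_apply (v : HIdx n → 𝒜) : K.dq ev v = ∑ α, ev (K.D (Sum.inl α) (v α)) := by
  simp [dq]

/-- Covariant derivative of a horizontal vector field. -/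
def Nv (a : Idx n) (v : HIdx n → 𝒜) : HIdx n → 𝒜 := fun β => K.D a (v β) + (K.Ω a *ᵥ v) β

/-- The connection term is linear in v. Hence, for fields already known to vanish at the point, the
covariant divergence is the flat one `dq`, which can be applied to `eq_one` and `eq_two` directly.
-/
theorem ev_Nv (a : Idx n) {v : HIdx n → 𝒜} (h : evV ev v = 0) (β : HIdx n) :
    ev (K.Nv a v β) = ev (K.D a (v β)) := by
  have : ∀ δ, ev (v δ) = 0 := fun δ => congrFun h δ
  simp [Nv, Matrix.mulVec, dotProduct, this]

theorem dq_eq_sum_Nv {v : HIdx n → 𝒜} (h : evV ev v = 0) :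
    K.dq ev v = ∑ α, ev (K.Nv (Sum.inl α) v α) := by
  simp only [K.ev_Nv ev _ h, dq_apply]

set_option linter.unusedSimpArgs false in
-- The defining equation of the mixed part of Q with the operator A written out. The quaternion
-- relations show that `Qm` is its explicit solution.
theorem av_eq_Qm (i : Fin 3) :
    K.av i = (-2 : ℝ) • (𝕛 (i + 2) (K.Qm (i + 1)) - 𝕛 (i + 1) (K.Qm (i + 2))) := by
  fin_cases i
  · change K.av 0 = (-2 : ℝ) • (𝕛 2 (K.Qm 1) - 𝕛 1 (K.Qm 2))
    simp only [Qm, aa, Fin.sum_univ_three, map_sub, map_add, map_smul, map_neg, jv_self, jv01, jv10,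
      jv02, jv20, jv12, jv21]
    module
  · change K.av 1 = (-2 : ℝ) • (𝕛 0 (K.Qm 2) - 𝕛 2 (K.Qm 0))
    simp only [Qm, aa, Fin.sum_univ_three, map_sub, map_add, map_smul, map_neg, jv_self, jv01, jv10,
      jv02, jv20, jv12, jv21]
    module
  · change K.av 2 = (-2 : ℝ) • (𝕛 1 (K.Qm 0) - 𝕛 0 (K.Qm 1))
    simp only [Qm, aa, Fin.sum_univ_three, map_sub, map_add, map_smul, map_neg, jv_self, jv01, jv10,
      jv02, jv20, jv12, jv21]
    module

theorem av_eq_zero (h : ∀ i, evV ev (K.Qm i) = 0) (i : Fin 3) : evV ev (K.av i) = 0 := by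
  rw [av_eq_Qm, map_smul, map_sub, evV_jv_eq_zero ev (h _), evV_jv_eq_zero ev (h _)]
  simp

theorem aa_eq_zero (h : ∀ i, evV ev (K.av i) = 0) : evV ev K.aa = 0 := by
  rw [aa, map_sum]
  exact Finset.sum_eq_zero fun i _ => evV_jv_eq_zero ev (h i)

theorem N_Qh (a : Idx n) : K.N a K.Qh = (1 / 2 : ℝ) • K.N a K.τ + K.N a K.μ
    - ((1 + 4 * n) / 4 : ℝ) • (K.D a K.lam • (1 : Matrix (HIdx n) (HIdx n) 𝒜)) := by
  have h1 : K.N a (1 : Matrix (HIdx n) (HIdx n) 𝒜) = 0 := by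
    have : K.DM a (1 : Matrix (HIdx n) (HIdx n) 𝒜) = 0 := by
      ext α β
      by_cases h : α = β <;> simp [DM, h]
    rw [N, this]; simp
  rw [Qh, N_sub, N_add, N_smul, N_smul, N_smul', h1, smul_zero, add_zero]

theorem Div_N_Qh : Div (fun γ => K.N (Sum.inl γ) K.Qh)
    = (1 / 2 : ℝ) • K.p + K.m - ((1 + 4 * n) / 4 : ℝ) • K.dlam := by
  simp only [N_Qh, Div_sub, Div_add, Div_smul]
  rw [← p, ← m]
  congr 2
  ext β
  simp [Div, dlam, Matrix.one_apply]

/-- Linear algebra common to the first and second derivatives. -/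
theorem eq_zero_of_system {W : Type*} [AddCommGroup W] [Module ℝ W] (hn : n ≠ 0) {P M A L : W}
    (h1 : (-2 : ℝ) • P + (12 : ℝ) • M + (1 - 4 * n : ℝ) • A - (3 : ℝ) • L = 0)
    (h2 : (2 : ℝ) • P + (n + 2 : ℝ) • A + (3 * n : ℝ) • L = 0) (hA : A = 0)
    (h3 : (-(n * (1 + 4 * n)) : ℝ) • L
      + (2 : ℝ) • ((1 / 2 : ℝ) • P + M - ((1 + 4 * n) / 4 : ℝ) • L) = 0) :
    P = 0 ∧ M = 0 ∧ L = 0 := by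
  subst hA
  have hn' : (0 : ℝ) < n := by exact_mod_cast Nat.pos_of_ne_zero hn
  -- This combination eliminates P and M. The remaining coefficient is positive.
  have h : (n * (4 * n + 5) : ℝ) • L = 0 := by
    linear_combination (norm := module) -h3 + (1 / 6 : ℝ) • h1 + (2 / 3 : ℝ) • h2
  have hL : L = 0 := (smul_eq_zero.1 h).resolve_left (by positivity)
  subst hL
  have hP : P = 0 := by linear_combination (norm := module) (1 / 2 : ℝ) • h2
  subst hP
  exact ⟨rfl, by linear_combination (norm := module) (1 / 12 : ℝ) • h1, rfl⟩

/-- The traced symmetrized derivative of Q_{αβ} is the gradient of its trace plus twice its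
divergence. This is the third equation of `eq_zero_of_system`. -/
theorem first_derivatives_eq_zero (hn : n ≠ 0) (ha : evV ev K.aa = 0)
    (h : ∀ β, ∑ α, ev (K.N (Sum.inl β) K.Qh α α + 2 * K.N (Sum.inl α) K.Qh α β) = 0) :
    evV ev K.p = 0 ∧ evV ev K.m = 0 ∧ evV ev K.dlam = 0 := by
  refine eq_zero_of_system hn (by simpa using congrArg (evV ev) (K.eq_one hn))
    (by simpa using congrArg (evV ev) (K.eq_two hn)) ha ?_
  rw [← map_smul, ← map_smul, ← map_smul, ← map_add, ← map_sub, ← map_smul, ← map_add,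
    ← K.Div_N_Qh]
  ext β
  rw [Pi.zero_apply, ← h β, evV_apply, ← map_sum]
  congr 1
  have h1 := K.trace_N (Sum.inl β) K.Qh
  rw [K.trace_Qh hn, Derivation.map_smul] at h1
  rw [Finset.sum_add_distrib, ← Finset.mul_sum]
  change _ = (K.N (Sum.inl β) K.Qh).trace + 2 * Div (fun γ => K.N (Sum.inl γ) K.Qh) β
  rw [h1]
  simp only [Pi.add_apply, Pi.smul_apply, dlam]
  congr 1
  rw [Algebra.smul_def, map_ofNat]

theorem dq_jv (i : Fin 3) (v : HIdx n → 𝒜) :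
    K.dq ev (𝕛 i v) = ∑ α, ∑ β, J n i α β * ev (K.D (Sum.inl α) (v β)) := by
  rw [dq_apply]
  refine Finset.sum_congr rfl fun α _ => ?_
  simp [jv_apply, jm]

/-- Contraction with the skew J_i sees only the commutator of second derivatives. Where dλ = 0 this
is the vertical derivative 2 ∑ J_k λ_{,k}, and tr(J_i J_k) = -4n δ_{ik}. -/
theorem dq_jv_dlam (hd : evV ev K.dlam = 0) (i : Fin 3) :
    K.dq ev (𝕛 i K.dlam) = 4 * n * ev (K.D (Sum.inr i) K.lam) := by
  have hd' : ∀ δ, ev (K.D (Sum.inl δ) K.lam) = 0 := fun δ => congrFun hd δ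
  have hc : ∀ α β, ev (K.D (Sum.inl α) (K.D (Sum.inl β) K.lam))
      - ev (K.D (Sum.inl β) (K.D (Sum.inl α) K.lam))
      = 2 * ∑ k, J n k α β * ev (K.D (Sum.inr k) K.lam) := fun α β => by
    have h := congrArg ev (K.D_comm (Sum.inl α) (Sum.inl β) K.lam)
    simp only [Fintype.sum_sum_type, map_sub, map_add, map_sum, map_mul, hd', mul_zero,
      Finset.sum_const_zero, zero_add, Γ_hv, map_zero, T_vhh', jm, Matrix.map_apply,
      AlgHom.commutes, map_neg, map_ofNat] at h
    rw [h, Finset.mul_sum]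
    exact Finset.sum_congr rfl fun k _ => by simp; ring
  have h1 : K.dq ev (𝕛 i K.dlam)
      = ∑ α, ∑ β, J n i α β * ev (K.D (Sum.inl α) (K.D (Sum.inl β) K.lam)) := K.dq_jv ev i _
  have h2 : K.dq ev (𝕛 i K.dlam)
      = -∑ α, ∑ β, J n i α β * ev (K.D (Sum.inl β) (K.D (Sum.inl α) K.lam)) := by
    rw [h1, Finset.sum_comm, ← Finset.sum_neg_distrib]
    refine Finset.sum_congr rfl fun α _ => ?_
    rw [← Finset.sum_neg_distrib]
    refine Finset.sum_congr rfl fun β _ => ?_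
    rw [J_skew i β α]; ring
  have h3 : 2 * K.dq ev (𝕛 i K.dlam)
      = ∑ α, ∑ β, J n i α β * (2 * ∑ k, J n k α β * ev (K.D (Sum.inr k) K.lam)) := by
    simp only [← hc, mul_sub, Finset.sum_sub_distrib]
    rw [two_mul]
    nth_rewrite 2 [h2]
    rw [h1]; ring
  have h4 : ∀ k, ∑ α, ∑ β, J n i α β * J n k α β = if i = k then (4 * n : ℝ) else 0 := fun k => by
    have h := trace_jm_mul (n := n) (𝒜 := ℝ) i k
    have e : ∀ i, jm n ℝ i = J n i := fun i => by ext; simp [jm]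
    simp only [e, Matrix.trace, Matrix.diag, Matrix.mul_apply] at h
    have : ∀ α β, J n i α β * J n k α β = -(J n i α β * J n k β α) := fun α β => by
      rw [J_skew k α β]; ring
    simp only [this, Finset.sum_neg_distrib, h]
    split_ifs <;> simp
  have h5 : ∑ α, ∑ β, J n i α β * (2 * ∑ k, J n k α β * ev (K.D (Sum.inr k) K.lam))
      = 2 * ∑ k, (∑ α, ∑ β, J n i α β * J n k α β) * ev (K.D (Sum.inr k) K.lam) := by
    simp only [Fin.sum_univ_three, Finset.sum_mul, Finset.mul_sum, mul_add, Finset.sum_add_distrib]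
    congr 1
    · congr 1 <;>
      exact Finset.sum_congr rfl fun _ _ => Finset.sum_congr rfl fun _ _ => by ring
    · exact Finset.sum_congr rfl fun _ _ => Finset.sum_congr rfl fun _ _ => by ring
  rw [h5] at h3
  simp only [h4, ite_mul, zero_mul, Finset.sum_ite_eq, Finset.mem_univ, if_true] at h3
  linarith

end FrameCalculus

end QC

/-! ### Evaluation at a point: order four. -/

namespace QC

open Matrix

namespace FrameCalculus

set_option linter.unusedSectionVars false

variable {n : ℕ} {𝒜 : Type*} [CommRing 𝒜] [Algebra ℝ 𝒜] (K : FrameCalculus n 𝒜)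

local notation "𝕁" => jm n 𝒜
local notation "𝕛" => jv n 𝒜

/-- The Ricci identity for endomorphisms of `H`. -/
theorem N_N_sub (a b : Idx n) (X : Matrix (HIdx n) (HIdx n) 𝒜) :
    K.N a (K.N b X) - K.N b (K.N a X)
      = K.RM a b * X - X * K.RM a b + ∑ e, K.c a b e • K.N e X := by
  have hD : K.DM a (K.DM b X) - K.DM b (K.DM a X) = ∑ e, K.c a b e • K.DM e X := by
    ext α β
    simp only [DM, Matrix.sub_apply, Matrix.map_apply, Matrix.sum_apply, Matrix.smul_apply,
      smul_eq_mul]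
    exact K.D_comm a b (X α β)
  have hN : ∑ e, K.c a b e • K.N e X = ∑ e, K.c a b e • K.DM e X
      + ((∑ e, K.c a b e • K.Ω e) * X - X * ∑ e, K.c a b e • K.Ω e) := by
    simp only [N, Finset.sum_mul, Finset.mul_sum, Matrix.smul_mul, Matrix.mul_smul, smul_sub,
      smul_add, Finset.sum_add_distrib, Finset.sum_sub_distrib]
    abel
  rw [hN, ← hD, RM_eq]
  simp only [N, DM_add, DM_sub, DM_mul]
  noncomm_ring

/-- Second covariant derivative of an endomorphism of `H`. -/
def N2 (a b : Idx n) (X : Matrix (HIdx n) (HIdx n) 𝒜) : Matrix (HIdx n) (HIdx n) 𝒜 :=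
  K.N a (K.N b X) - ∑ e, K.Γ a b e • K.N e X

theorem N2_sub (a b : Idx n) (X : Matrix (HIdx n) (HIdx n) 𝒜) :
    K.N2 a b X - K.N2 b a X = K.RM a b * X - X * K.RM a b - ∑ e, K.T e a b • K.N e X := by
  have h := K.N_N_sub a b X
  simp only [c, sub_smul, Finset.sum_sub_distrib] at h
  simp only [N2]
  linear_combination (norm := abel) h

/-- Contraction commutes with covariant differentiation: the connection terms at the two contracted
indices cancel. -/
theorem Nv_Div (a : Idx n) (X : Matrix (HIdx n) (HIdx n) 𝒜) (β : HIdx n) :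
    K.Nv a (Div fun γ => K.N (Sum.inl γ) X) β = ∑ γ, K.N2 a (Sum.inl γ) X γ β := by
  have h : ∀ γ, K.N2 a (Sum.inl γ) X γ β = K.D a (K.N (Sum.inl γ) X γ β)
      + ∑ δ, K.Ω a γ δ * K.N (Sum.inl γ) X δ β - ∑ δ, K.N (Sum.inl γ) X γ δ * K.Ω a δ β
      - ∑ δ, K.Ω a δ γ * K.N (Sum.inl δ) X γ β := fun γ => by
    rw [N2, N]
    simp only [Fintype.sum_sum_type, Γ_hv, zero_smul, Finset.sum_const_zero, add_zero,
      Matrix.sub_apply, Matrix.add_apply, Matrix.mul_apply, Matrix.sum_apply, Matrix.smul_apply,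
      smul_eq_mul, Γ_hh, DM, Matrix.map_apply]
  simp only [h, Finset.sum_sub_distrib, Finset.sum_add_distrib]
  rw [Finset.sum_comm (f := fun γ δ => K.Ω a γ δ * K.N (Sum.inl γ) X δ β)]
  simp only [Nv, Div, map_sum, Matrix.mulVec, dotProduct, Finset.mul_sum]
  rw [Finset.sum_comm (f := fun γ δ => K.N (Sum.inl γ) X γ δ * K.Ω a δ β)]
  have : ∑ δ, ∑ γ, K.N (Sum.inl γ) X γ δ * K.Ω a δ β
      = -∑ δ, ∑ γ, K.Ω a β δ * K.N (Sum.inl γ) X γ δ := by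
    simp only [← Finset.sum_neg_distrib]
    refine Finset.sum_congr rfl fun δ _ => Finset.sum_congr rfl fun γ _ => ?_
    rw [K.Ω_swap a δ β]; ring
  rw [this]
  ring

variable (ev : 𝒜 →ₐ[ℝ] ℝ)

theorem dq_p_eq_sum (h : evV ev K.p = 0) :
    K.dq ev K.p = ∑ β, ∑ γ, ev (K.N2 (Sum.inl β) (Sum.inl γ) K.τ γ β) := by
  rw [K.dq_eq_sum_Nv ev h, p]
  simp only [Nv_Div, map_sum]

theorem dq_m_eq_sum (h : evV ev K.m = 0) :
    K.dq ev K.m = ∑ β, ∑ γ, ev (K.N2 (Sum.inl β) (Sum.inl γ) K.μ γ β) := by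
  rw [K.dq_eq_sum_Nv ev h, m]
  simp only [Nv_Div, map_sum]

theorem trace_mul_J_of_symm {Z : Matrix (HIdx n) (HIdx n) ℝ} (h : Zᵀ = Z) (k : Fin 3) :
    (Z * J n k).trace = 0 := by
  have h1 : (Z * J n k).trace = -(Z * J n k).trace := by
    nth_rewrite 1 [← Matrix.trace_transpose]
    rw [Matrix.transpose_mul, J_transpose, h, neg_mul, Matrix.trace_neg, Matrix.trace_mul_comm]
  linarith

/-- The second derivatives of μ are symmetric and commute with J_i, so their product with J_i is
skew and only the commutator of derivatives contributes. By the Ricci identity with μ = 0 at the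
point, that is a vertical derivative Z_k of μ contracted with J_k. The resulting traces tr(J_k Z_k
J_i) vanish because Z_k is symmetric and trace-free. -/
theorem dq_jv_m (hn : n ≠ 0) (hμ : ev.mapMatrix K.μ = 0) (hm : evV ev K.m = 0) (i : Fin 3) :
    K.dq ev (𝕛 i K.m) = 0 := by
  set Y : HIdx n → HIdx n → Matrix (HIdx n) (HIdx n) ℝ := fun α γ =>
    ev.mapMatrix (K.N2 (Sum.inl α) (Sum.inl γ) K.μ) with hY
  set Z : Fin 3 → Matrix (HIdx n) (HIdx n) ℝ := fun k => ev.mapMatrix (K.N (Sum.inr k) K.μ) with hZ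
  have hYc : ∀ α γ, J n i * Y α γ = Y α γ * J n i := fun α γ => by
    have h : 𝕁 i * K.N2 (Sum.inl α) (Sum.inl γ) K.μ = K.N2 (Sum.inl α) (Sum.inl γ) K.μ * 𝕁 i := by
      simp only [N2, mul_sub, sub_mul, Finset.mul_sum, Finset.sum_mul, Matrix.mul_smul,
        Matrix.smul_mul, K.N_μ_comm hn, K.N_comm_jm (K.N_μ_comm hn _)]
    have := congrArg ev.mapMatrix h
    rwa [map_mul, map_mul, mapMatrix_jm] at this
  have hYt : ∀ α γ, (Y α γ)ᵀ = Y α γ := fun α γ => by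
    have h : (K.N2 (Sum.inl α) (Sum.inl γ) K.μ)ᵀ = K.N2 (Sum.inl α) (Sum.inl γ) K.μ := by
      simp only [N2, Matrix.transpose_sub, Matrix.transpose_sum, Matrix.transpose_smul,
        N_transpose, K.μ_transpose hn]
    rw [hY]
    simp only [AlgHom.mapMatrix_apply, ← Matrix.transpose_map, h]
  have hYJ : ∀ α γ, (Y α γ * J n i)ᵀ = -(Y α γ * J n i) := fun α γ => by
    rw [Matrix.transpose_mul, hYt, J_transpose, neg_mul, hYc]
  have hYs : ∀ α γ, Y α γ - Y γ α = (2 : ℝ) • ∑ k, J n k α γ • Z k := fun α γ => by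
    have h := congrArg ev.mapMatrix (K.N2_sub (Sum.inl α) (Sum.inl γ) K.μ)
    rw [map_sub, map_sub, map_sub, map_mul, map_mul, hμ, mul_zero, zero_mul, sub_self, zero_sub]
      at h
    rw [hY]
    simp only
    rw [h]
    simp only [Fintype.sum_sum_type, T_hhh, zero_smul, Finset.sum_const_zero, zero_add, T_vhh']
    ext x y
    simp [Matrix.sum_apply, jm, hZ, Finset.mul_sum, mul_assoc, map_ofNat]
  have h0 : K.dq ev (𝕛 i K.m) = -∑ α, ∑ γ, (Y α γ * J n i) γ α := by
    rw [K.dq_jv ev i K.m, ← Finset.sum_neg_distrib]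
    refine Finset.sum_congr rfl fun α _ => ?_
    simp only [← K.ev_Nv ev _ hm]
    simp only [m, Nv_Div, map_sum, Matrix.mul_apply, Finset.mul_sum]
    rw [Finset.sum_comm, ← Finset.sum_neg_distrib]
    refine Finset.sum_congr rfl fun γ _ => ?_
    rw [← Finset.sum_neg_distrib]
    refine Finset.sum_congr rfl fun β _ => ?_
    rw [J_skew i β α]
    simp only [hY, AlgHom.mapMatrix_apply, Matrix.map_apply]
    ring
  have h1 : ∑ α, ∑ γ, (Y α γ * J n i) γ α = -∑ α, ∑ γ, (Y γ α * J n i) γ α := by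
    rw [Finset.sum_comm, ← Finset.sum_neg_distrib]
    refine Finset.sum_congr rfl fun α _ => ?_
    rw [← Finset.sum_neg_distrib]
    refine Finset.sum_congr rfl fun γ _ => ?_
    exact congrFun (congrFun (hYJ γ α) γ) α
  have h2 : ∑ α, ∑ γ, (Y α γ * J n i) γ α - ∑ α, ∑ γ, (Y γ α * J n i) γ α
      = 2 * ∑ k, (J n k * (Z k * J n i)).trace := by
    simp only [← Finset.sum_sub_distrib, ← Matrix.sub_apply, ← sub_mul, hYs]
    simp only [Matrix.trace, Matrix.diag, Matrix.mul_apply (M := J n _), Fin.sum_univ_three,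
      Matrix.smul_mul, add_mul, Matrix.smul_apply, Matrix.add_apply, smul_eq_mul, mul_add,
      Finset.sum_add_distrib, Finset.mul_sum]
  have h3 : ∀ k, (J n k * (Z k * J n i)).trace = 0 := fun k => by
    have hZt : (Z k)ᵀ = Z k := by
      rw [hZ]
      simp only [AlgHom.mapMatrix_apply, ← Matrix.transpose_map, N_transpose, K.μ_transpose hn]
    have q := quatTriple_jm (n := n) (𝒜 := ℝ) i
    have e : ∀ i, jm n ℝ i = J n i := fun i => by ext; simp [jm]
    rw [e, e, e] at q
    rw [Matrix.trace_mul_comm, mul_assoc]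
    rcases fin3_cases i k with rfl | rfl | rfl
    · have ht : (Z k).trace = 0 := by
        have := congrArg ev (K.trace_N (Sum.inr k) K.μ)
        rw [K.trace_μ hn, map_zero, map_zero] at this
        rw [← this, hZ]
        simp [Matrix.trace]
      simp [J_mul_self, ht]
    · rw [q.ab]; exact trace_mul_J_of_symm hZt _
    · rw [q.ac, mul_neg, Matrix.trace_neg, trace_mul_J_of_symm hZt, neg_zero]
  simp only [h3, Finset.sum_const_zero, mul_zero] at h2
  linarith

/-- `B_ij = R_klαβ ε_kli I_jαβ`. -/
def Bm (i j : Fin 3) : 𝒜 :=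
  ∑ k, ∑ l, eps k l i • (K.RM (Sum.inr k) (Sum.inr l) * 𝕁 j).trace

/-- The quadratic torsion terms of `bianchi_vvh_h` drop out at the point. The first two terms on the
right have no trace and no J_k-trace, so they never survive a contraction. -/
theorem ev_RM_vv (hτ : ∀ i, ev.mapMatrix (K.t i) = 0) (ha : ∀ i, evV ev (K.av i) = 0)
    (i j : Fin 3) (γ δ : HIdx n) : ev (K.RM (Sum.inr i) (Sum.inr j) δ γ)
      = ev (K.NV (Sum.inr i) K.t j δ γ) - ev (K.NV (Sum.inr j) K.t i δ γ)
        + ev (K.D (Sum.inl γ) (K.th i j δ)) := by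
  have ht : ∀ i α β, ev (K.t i α β) = 0 := fun i α β => congrFun (congrFun (hτ i) α) β
  have hth : ∀ i j, evV ev (K.th i j) = 0 := fun i j => by
    simp [th_eq, map_sum, ha]
  have hth' : ∀ i j β, ev (K.th i j β) = 0 := fun i j β => congrFun (hth i j) β
  rw [bianchi_vvh_h]
  simp [ht, Matrix.mul_apply, NT, Fintype.sum_sum_type, Γ_vh, T_hvv, hth']

/-- The trace of `ev_RM_vv`: the curvature is skew and T(R_j, ·) is trace-free, so only the
divergence is left. -/
theorem dq_th (hn : n ≠ 0) (hτ : ∀ i, ev.mapMatrix (K.t i) = 0) (ha : ∀ i, evV ev (K.av i) = 0)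
    (i j : Fin 3) : K.dq ev (K.th i j) = 0 := by
  have h1 := congrArg ev (K.trace_NV_t hn (Sum.inr i) j)
  have h2 := congrArg ev (K.trace_NV_t hn (Sum.inr j) i)
  have h0 : ∀ γ, K.RM (Sum.inr i) (Sum.inr j) γ γ = 0 := fun γ =>
      eq_zero_of_eq_neg (K.R_skew _ _ _ _)
  have h3 := Finset.sum_congr rfl fun γ (_ : γ ∈ Finset.univ) => K.ev_RM_vv ev hτ ha i j γ γ
  simp only [Matrix.trace, Matrix.diag, map_sum, map_zero] at h1 h2
  simp only [h0, map_zero, Finset.sum_const_zero, Finset.sum_add_distrib, Finset.sum_sub_distrib,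
    h1, h2] at h3
  rw [dq_apply]
  linarith

theorem dq_av (hn : n ≠ 0) (hτ : ∀ i, ev.mapMatrix (K.t i) = 0) (ha : ∀ i, evV ev (K.av i) = 0)
    (i : Fin 3) : K.dq ev (K.av i) = 0 := by
  rw [av, map_smul, K.dq_th ev hn hτ ha, smul_zero]

theorem ev_trace_RM_vv (hn : n ≠ 0) (hτ : ∀ i, ev.mapMatrix (K.t i) = 0)
    (ha : ∀ i, evV ev (K.av i) = 0) (k l j : Fin 3) :
    ev (K.RM (Sum.inr k) (Sum.inr l) * 𝕁 j).trace = K.dq ev (𝕛 j (K.th k l)) := by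
  have h1 := congrArg ev (K.trace_jm_NV_t hn (Sum.inr k) l j)
  have h2 := congrArg ev (K.trace_jm_NV_t hn (Sum.inr l) k j)
  rw [Matrix.trace_mul_comm] at h1 h2
  simp only [Matrix.trace, Matrix.diag, map_sum, map_zero, Matrix.mul_apply, map_mul] at h1 h2
  rw [Matrix.trace_mul_comm, dq_jv]
  simp only [Matrix.trace, Matrix.diag, map_sum, Matrix.mul_apply, map_mul,
    K.ev_RM_vv ev hτ ha, mul_add, mul_sub, Finset.sum_add_distrib, Finset.sum_sub_distrib, h1, h2]
  simp [jm]

/-- The J_j-trace of `ev_RM_vv`, dualized with ε. It ties B to the divergences occurring in the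
differentiated relations. -/
theorem ev_Bm (hn : n ≠ 0) (hτ : ∀ i, ev.mapMatrix (K.t i) = 0) (ha : ∀ i, evV ev (K.av i) = 0)
    (i j : Fin 3) : ev (K.Bm i j) = K.dq ev (𝕛 j (K.av i)) := by
  have hav : K.av i = ∑ k, ∑ l, eps k l i • K.th k l := by
    simp only [th_eq, Fin.sum_univ_three, eps_eq]
    fin_cases i <;> simp <;> module
  simp only [Bm, map_sum, map_smul, K.ev_trace_RM_vv ev hn hτ ha]
  rw [hav]
  simp only [map_sum, map_smul]

/-- The second derivatives vanish. -/
theorem second_derivatives_eq_zero (hn : 1 < n) (hτ : ∀ i, ev.mapMatrix (K.t i) = 0)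
    (hμ : ev.mapMatrix K.μ = 0)
    (ha : ∀ i, evV ev (K.av i) = 0) (hm : evV ev K.m = 0) (hd : evV ev K.dlam = 0)
    (h4 : ∀ i, ∑ α, ev (K.N (Sum.inr i) K.Qh α α) + 2 * K.dq ev (K.Qm i) = 0)
    (hB : ∀ i j, ev (K.Bm i j) + ev (K.Bm j i) = 0)
    (h5 : (-(n * (1 + 4 * n)) : ℝ) * K.dq ev K.dlam
      + 2 * (1 / 2 * K.dq ev K.p + K.dq ev K.m - (1 + 4 * n) / 4 * K.dq ev K.dlam) = 0) :
    (∀ i, ev (K.D (Sum.inr i) K.lam) = 0) ∧ (∀ i j, ev (K.Bm i j) = 0) ∧ K.dq ev K.aa = 0 ∧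
      K.dq ev K.p = 0 ∧ K.dq ev K.m = 0 ∧ K.dq ev K.dlam = 0 := by
  have hn0 : n ≠ 0 := by omega
  have hn' : (1 : ℝ) < n := by exact_mod_cast hn
  have hja : ∀ i, K.dq ev (𝕛 i K.aa) = 4 * n * ev (K.D (Sum.inr i) K.lam) := fun i => by
    have h1 := congrArg (fun v => K.dq ev (𝕛 i v)) (K.eq_one hn0)
    have h2 := congrArg (fun v => K.dq ev (𝕛 i v)) (K.eq_two hn0)
    simp only [map_add, map_sub, map_smul, map_zero, smul_eq_mul, K.dq_jv_m ev hn0 hμ hm,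
      K.dq_jv_dlam ev hd] at h1 h2
    -- The sum of `eq_one` and `eq_two` eliminates p, and the term in m has zero divergence after
    -- J_i. The remaining factor n - 1 is where n > 1 is needed.
    have h3 : (3 * (n - 1) : ℝ) * (K.dq ev (𝕛 i K.aa) - 4 * n * ev (K.D (Sum.inr i) K.lam)) = 0 := by
      linear_combination -h1 - h2
    have h6 := (mul_eq_zero.1 h3).resolve_left (by nlinarith)
    linarith
  have hl : ∀ i, ev (K.D (Sum.inr i) K.lam) = 0 := fun i => by
    have h1 := congrArg ev (K.trace_N (Sum.inr i) K.Qh)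
    rw [K.trace_Qh hn0, Derivation.map_smul, map_smul, smul_eq_mul] at h1
    simp only [Matrix.trace, Matrix.diag, map_sum] at h1
    have h2 := h4 i
    rw [h1, Qm, map_sub, map_smul, map_smul, hja, K.dq_av ev hn0 hτ ha] at h2
    simp only [smul_eq_mul] at h2
    -- The trace of Q_{αβ,i} contributes -n(1+4n)λ_{,i}, and twice the divergence of Q_{αi}
    -- contributes -2nλ_{,i}.
    have h3 : (n * (4 * n + 3) : ℝ) * ev (K.D (Sum.inr i) K.lam) = 0 := by linear_combination -h2
    exact (mul_eq_zero.1 h3).resolve_left (by positivity)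
  have hB' := fun i j => K.ev_Bm ev hn0 hτ ha i j
  have hsk : ∀ i, K.dq ev (𝕛 i K.aa) = 0 := fun i => by rw [hja, hl, mul_zero]
  have hav := K.dq_av ev hn0 hτ ha
  have hBall : ∀ i j, ev (K.Bm i j) = 0 := by
    -- Expanding J_i a, the divergence of J_i a becomes a difference of two off-diagonal entries of
    -- B, since a_i itself is divergence-free. So B is symmetric, and its symmetric part vanishes by
    -- hypothesis.
    have s0 := hsk 0
    have s1 := hsk 1
    have s2 := hsk 2
    simp only [aa, Fin.sum_univ_three, map_add, map_neg, jv_self, jv01, jv10, jv02, jv20, jv12,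
      jv21, hav, ← hB'] at s0 s1 s2
    have b00 := hB 0 0
    have b11 := hB 1 1
    have b22 := hB 2 2
    have b01 := hB 0 1
    have b02 := hB 0 2
    have b12 := hB 1 2
    intro i j
    fin_cases i <;> fin_cases j <;> simp only [Fin.zero_eta, Fin.mk_one, Fin.reduceFinMk] <;>
      linarith
  have haa : K.dq ev K.aa = 0 := by
    rw [aa, map_sum]
    exact Finset.sum_eq_zero fun i _ => by rw [← hB', hBall]
  refine ⟨hl, hBall, haa, ?_⟩
  refine eq_zero_of_system hn0 (by simpa using congrArg (K.dq ev) (K.eq_one hn0))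
    (by simpa using congrArg (K.dq ev) (K.eq_two hn0)) haa ?_
  simpa using h5

/-- Divergence of the mixed Ricci curvature. -/
theorem sum_jv_W (hn : n ≠ 0) : ∑ i, 𝕛 i (K.W i) = -K.p + (3 : ℝ) • K.m + (2 : ℝ) • K.aa := by
  have hy := K.sum_jv_y hn
  simp only [K.W_eq' hn, th_eq, aa, Fin.sum_univ_three, map_add, map_sub, map_smul,
    jv_self, jv01, jv10, jv02, jv20, jv12, jv21, eps_eq]
  simp
  linear_combination (norm := module) (1 / 4 : ℝ) • hy

end FrameCalculus

end QC

/-! ### The algebra of smooth functions on U and the frame calculus of a frame. -/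

namespace QC

open Matrix

section SmoothAlgebra

variable {M : Type*} {U : Set M}

/-- Extension by zero of a function on `U`. -/
def extendZero (F : U → ℝ) : M → ℝ := Function.extend Subtype.val F 0

theorem extendZero_apply (F : U → ℝ) {x : M} (hx : x ∈ U) : extendZero F x = F ⟨x, hx⟩ :=
  Subtype.val_injective.extend_apply F 0 ⟨x, hx⟩

variable [TopologicalSpace M]

variable (n : ℕ) [ChartedSpace (Model n) M] [IsManifold (𝓡 (4 * n + 3)) ∞ M]

/-- The algebra of smooth functions on `U`. -/
def smoothAlg (U : Set M) : Subalgebra ℝ (U → ℝ) where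
  carrier := {F | SmoothFn (n := n) (extendZero F) U}
  mul_mem' hF hG := (SmoothFn.mul hF hG).congr fun x hx => by simp [extendZero_apply _ hx]
  add_mem' hF hG := (SmoothFn.add hF hG).congr fun x hx => by simp [extendZero_apply _ hx]
  algebraMap_mem' c := (SmoothFn.const c).congr fun x hx => by simp [extendZero_apply _ hx]

variable {n}

/-- A smooth function on `U` as an element of the algebra. -/
def toAlg (F : M → ℝ) (hF : SmoothFn (n := n) F U) : smoothAlg n U :=
  ⟨fun x => F x, hF.congr fun x hx => by rw [extendZero_apply _ hx]⟩

/-- Evaluation at a point. -/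
def evalAlg {x : M} (hx : x ∈ U) : smoothAlg n U →ₐ[ℝ] ℝ :=
  (Pi.evalAlgHom ℝ (fun _ : U => ℝ) ⟨x, hx⟩).comp (smoothAlg n U).val

theorem evalAlg_toAlg {x : M} (hx : x ∈ U) {F : M → ℝ} (hF : SmoothFn (n := n) F U) :
    evalAlg hx (toAlg F hF) = F x := rfl

theorem smoothAlg_ext {F G : smoothAlg n U}
    (h : ∀ x, ∀ hx : x ∈ U, evalAlg hx F = evalAlg hx G) : F = G :=
  Subtype.ext (funext fun x => h x.1 x.2)

theorem eval_algebraMap {x : M} (hx : x ∈ U) (c : ℝ) :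
    evalAlg hx (algebraMap ℝ (smoothAlg n U) c) = c := AlgHom.commutes _ _

/-- The smooth function represented by an element of the algebra. -/
def fnAlg (F : smoothAlg n U) : M → ℝ := extendZero F.1

theorem fnAlg_apply (F : smoothAlg n U) {x : M} (hx : x ∈ U) : fnAlg F x = evalAlg hx F :=
  extendZero_apply _ hx

theorem fnAlg_smooth (F : smoothAlg n U) : SmoothFn (n := n) (fnAlg F) U := F.2

theorem dirDeriv_congr_on {F G : M → ℝ} (hU : IsOpen U) (h : ∀ y ∈ U, F y = G y) {x : M}
    (hx : x ∈ U) (v : TangentSpace (𝓡 (4 * n + 3)) x) : dirDeriv F x v = dirDeriv G x v :=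
  dirDeriv_congr (by filter_upwards [hU.mem_nhds hx] with y hy using h y hy) v

end SmoothAlgebra

namespace SpFrame

variable {n : ℕ} {M : Type*} [TopologicalSpace M] [ChartedSpace (Model n) M]
  [IsManifold (𝓡 (4 * n + 3)) ∞ M] {P : PseudohermitianStructure n M} {U : Set M}
  (f : SpFrame P U) (C : BiquardConnection P)

/-- The derivation of the algebra of smooth functions given by a frame field. -/
def derivAlg (a : Idx n) : Derivation ℝ (smoothAlg n U) (smoothAlg n U) :=
  Derivation.mk'
    { toFun := fun F => toAlg (fun x => dirDeriv (fnAlg F) x (f.vec C a x))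
        (f.dirDeriv_smooth C a (fnAlg_smooth F))
      map_add' := fun F G => smoothAlg_ext fun x hx => by
        rw [map_add, evalAlg_toAlg, evalAlg_toAlg, evalAlg_toAlg,
          dirDeriv_congr_on f.isOpen (G := fnAlg F + fnAlg G)
            (fun y hy => by simp [fnAlg_apply _ hy]) hx]
        unfold dirDeriv
        rw [mvfderiv_add ((fnAlg_smooth F).mdiffAt f.isOpen hx)
          ((fnAlg_smooth G).mdiffAt f.isOpen hx)]
        rfl
      map_smul' := fun c F => smoothAlg_ext fun x hx => by
        rw [RingHom.id_apply, map_smul, evalAlg_toAlg, evalAlg_toAlg,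
          dirDeriv_congr_on f.isOpen (G := (fun _ => c) * fnAlg F)
            (fun y hy => by simp [fnAlg_apply _ hy]) hx]
        unfold dirDeriv
        rw [mvfderiv_mul ((SmoothFn.const c).mdiffAt f.isOpen hx)
          ((fnAlg_smooth F).mdiffAt f.isOpen hx)]
        simp [mvfderiv_const] }
    fun F G => smoothAlg_ext fun x hx => by
      simp only [LinearMap.coe_mk, AddHom.coe_mk, smul_eq_mul, map_add, map_mul]
      rw [evalAlg_toAlg, evalAlg_toAlg, evalAlg_toAlg,
          dirDeriv_congr_on f.isOpen (G := fnAlg F * fnAlg G)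
            (fun y hy => by simp [fnAlg_apply _ hy]) hx]
      unfold dirDeriv
      rw [mvfderiv_mul ((fnAlg_smooth F).mdiffAt f.isOpen hx)
          ((fnAlg_smooth G).mdiffAt f.isOpen hx)]
      simp [fnAlg_apply _ hx]

theorem eval_derivAlg (a : Idx n) (F : smoothAlg n U) {x : M} (hx : x ∈ U) :
    evalAlg hx (f.derivAlg C a F) = dirDeriv (fnAlg F) x (f.vec C a x) := rfl

/-- Derivatives of functions agreeing with elements of the algebra. -/
theorem dirDeriv_eq_eval (a : Idx n) {G : M → ℝ} {F : smoothAlg n U}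
    (h : ∀ y, ∀ hy : y ∈ U, G y = evalAlg hy F) {x : M} (hx : x ∈ U) :
    dirDeriv G x (f.vec C a x) = evalAlg hx (f.derivAlg C a F) := by
  rw [eval_derivAlg]
  exact dirDeriv_congr_on f.isOpen (fun y hy => by rw [h y hy, fnAlg_apply _ hy]) hx _

/-- The skew part of `T(R_i, ·)` is orthogonal to `sp(n)`. -/
theorem tor_skew_casimir (i : Fin 3) {x : M} (hx : x ∈ U) (b : Matrix (HIdx n) (HIdx n) ℝ)
    (hb : b = Matrix.of fun α β => f.tor C (Sum.inl α) (Sum.inr i) (Sum.inl β) x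
      - f.tor C (Sum.inl β) (Sum.inr i) (Sum.inl α) x) :
    b = ∑ j, J n j * b * J n j := by
  have q : QuatTriple (J n 0) (J n 1) (J n 2) := by
    have q := FrameCalculus.quatTriple_jm (n := n) (𝒜 := ℝ) 0
    have e : ∀ i, FrameCalculus.jm n ℝ i = J n i := fun i => by ext; simp [FrameCalculus.jm]
    rwa [e, e, e] at q
  have hbt : bᵀ = -b := by
    subst hb
    ext α β
    simp
  -- This is four times the sp(n)-component of b. It is orthogonal to b by assumption, and to each
  -- J_j b J_j because it commutes with J_j, hence to itself.
  set A := b - ∑ j, J n j * b * J n j with hA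
  have hAt : Aᵀ = -A := by
    simp only [hA, Matrix.transpose_sub, Matrix.transpose_sum, Matrix.transpose_mul, J_transpose,
      hbt, neg_mul, mul_neg, neg_neg, mul_assoc, Finset.sum_neg_distrib]
    abel
  have hAJ : ∀ k, A * J n k = J n k * A := by
    intro k
    simp only [hA, Fin.sum_univ_three, sub_mul, mul_sub, add_mul, mul_add, mul_assoc]
    fin_cases k <;>
      simp only [Fin.zero_eta, Fin.mk_one, Fin.reduceFinMk, q.aa, q.bb, q.cc, q.ab, q.ba, q.bc,
        q.cb, q.ca, q.ac, q.aa', q.bb', q.cc', q.ab', q.ba', q.bc', q.cb', q.ca', q.ac',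
        mul_neg, mul_one] <;>
      abel
  have h1 := f.tor_perp_spn C i A hAt hAJ hx
  have h2 : ∑ β, ∑ α, b α β * A α β = 0 := by
    have e1 : ∑ β, ∑ α, f.tor C (Sum.inl β) (Sum.inr i) (Sum.inl α) x * A α β
        = -∑ β, ∑ α, f.tor C (Sum.inl α) (Sum.inr i) (Sum.inl β) x * A α β := by
      rw [Finset.sum_comm]
      simp only [← Finset.sum_neg_distrib]
      refine Finset.sum_congr rfl fun α _ => Finset.sum_congr rfl fun β _ => ?_
      have := congrFun (congrFun hAt β) α
      simp only [Matrix.transpose_apply, Matrix.neg_apply] at this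
      rw [this]; ring
    simp only [hb, Matrix.of_apply, sub_mul, Finset.sum_sub_distrib, e1, h1]
    simp
  have h3 : ∀ j, ∑ β, ∑ α, (J n j * b * J n j) α β * A α β = -∑ β, ∑ α, b α β * A α β := fun j => by
    have e : ∀ X Y : Matrix (HIdx n) (HIdx n) ℝ, ∑ β, ∑ α, X α β * Y α β = (Xᵀ * Y).trace :=
      fun X Y => by simp [Matrix.trace, Matrix.mul_apply]
    rw [e, e]
    simp only [Matrix.transpose_mul, J_transpose, hbt, neg_mul, mul_neg, neg_neg, Matrix.trace_neg]
    rw [mul_assoc, mul_assoc, Matrix.trace_mul_comm, mul_assoc, mul_assoc, hAJ, ← mul_assoc (J n j),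
      J_mul_self]
    simp
  have h4 : ∑ β, ∑ α, A α β * A α β = 0 := by
    have e : ∀ α β, A α β = b α β - ∑ j, (J n j * b * J n j) α β := fun α β => by
      rw [hA, Matrix.sub_apply, Matrix.sum_apply]
    calc ∑ β, ∑ α, A α β * A α β
        = ∑ β, ∑ α, (b α β * A α β - ∑ j, (J n j * b * J n j) α β * A α β) := by
          refine Finset.sum_congr rfl fun β _ => Finset.sum_congr rfl fun α _ => ?_
          nth_rewrite 1 [e]
          rw [sub_mul, Finset.sum_mul]
      _ = 0 := by
          simp only [Finset.sum_sub_distrib, Fin.sum_univ_three, Finset.sum_add_distrib, h3, h2]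
          simp
  have h5 : A = 0 := by
    ext α β
    have h6 := (Finset.sum_eq_zero_iff_of_nonneg fun β _ =>
      Finset.sum_nonneg fun α _ => mul_self_nonneg (A α β)).1 h4 β (Finset.mem_univ _)
    have h7 := (Finset.sum_eq_zero_iff_of_nonneg fun α _ => mul_self_nonneg (A α β)).1 h6 α
      (Finset.mem_univ _)
    simpa using h7
  exact sub_eq_zero.1 (hA.symm.trans h5)

variable [T2Space M]

/-- Connection coefficients as smooth functions. -/
def connAlg (a b c : Idx n) : smoothAlg n U := toAlg _ (f.conn_smooth C a b c)

/-- Torsion components as smooth functions. -/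
def torAlg (a b c : Idx n) : smoothAlg n U := toAlg _ (f.tor_smooth C a b c)

theorem eval_connAlg (a b c : Idx n) {x : M} (hx : x ∈ U) :
    evalAlg hx (f.connAlg C a b c) = f.conn C a b c x := rfl

theorem eval_torAlg (a b c : Idx n) {x : M} (hx : x ∈ U) :
    evalAlg hx (f.torAlg C a b c) = f.tor C a b c x := rfl

theorem eval_struct (a b c : Idx n) {x : M} (hx : x ∈ U) :
    f.struct C a b c x
      = evalAlg hx (f.connAlg C a b c - f.connAlg C b a c - f.torAlg C c a b) := by
  rw [map_sub, map_sub]; rfl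

/-- The frame calculus of an `Sp(n)Sp(1)` frame. -/
def calculus : FrameCalculus n (smoothAlg n U) where
  D := f.derivAlg C
  Γ := f.connAlg C
  T := f.torAlg C
  T_skew a b c := smoothAlg_ext fun x hx => by
    rw [map_neg, eval_torAlg, eval_torAlg, tor_skew]
  D_comm a b F := smoothAlg_ext fun x hx => by
    have h := f.dirDeriv_comm C a b (fnAlg_smooth F) hx
    rw [f.dirDeriv_eq_eval C a (F := f.derivAlg C b F) (fun y hy => rfl) hx,
      f.dirDeriv_eq_eval C b (F := f.derivAlg C a F) (fun y hy => rfl) hx] at h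
    rw [map_sub, h, map_sum]
    refine Finset.sum_congr rfl fun d _ => ?_
    rw [map_mul, ← eval_struct, eval_derivAlg]
  jacobi a b c d := smoothAlg_ext fun x hx => by
    have h := f.struct_jacobi C a b c d hx
    rw [f.dirDeriv_eq_eval C a (fun y hy => f.eval_struct C b c d hy) hx,
      f.dirDeriv_eq_eval C b (fun y hy => f.eval_struct C c a d hy) hx,
      f.dirDeriv_eq_eval C c (fun y hy => f.eval_struct C a b d hy) hx] at h
    simp only [f.eval_struct C _ _ _ hx, ← map_mul, ← map_sum, ← map_add] at h
    rw [h, map_zero]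
  Γ_hv a β k := smoothAlg_ext fun x hx => by
    rw [map_zero, eval_connAlg, f.conn_inl_inr C a β k hx]
  Γ_vh a k β := smoothAlg_ext fun x hx => by
    rw [map_zero, eval_connAlg, f.conn_inr_inl C a k β hx]
  Γ_skew a β γ := smoothAlg_ext fun x hx => by
    rw [map_neg, eval_connAlg, eval_connAlg, f.conn_skew C a β γ hx]
  Γ_J a j β ε := smoothAlg_ext fun x hx => by
    simp only [map_add, map_sum, map_mul, eval_connAlg, eval_algebraMap]
    exact f.conn_J C a j β ε hx
  T_hhh α β γ := smoothAlg_ext fun x hx => by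
    rw [map_zero, eval_torAlg, f.tor_inl_inl_inl C α β γ hx]
  T_vvh i j β := smoothAlg_ext fun x hx => by
    rw [map_zero, eval_torAlg, f.tor_inr_inr_inl C i j β hx]
  T_vhh i α β := smoothAlg_ext fun x hx => by
    rw [eval_torAlg, f.tor_inr_inl_inl C i α β hx, map_mul, eval_algebraMap, map_neg, map_ofNat]
  T_trace_J i k := smoothAlg_ext fun x hx => by
    simp only [map_sum, map_mul, map_zero, eval_torAlg, eval_algebraMap]
    exact f.tor_trace_J C i k hx
  T_spn i b hb := by
    ext1 α β
    refine smoothAlg_ext fun x hx => ?_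
    have h := f.tor_skew_casimir C i hx ((evalAlg hx).mapMatrix b) (by
      subst hb
      ext α β
      simp [eval_torAlg])
    have h2 := congrFun (congrFun h α) β
    rw [AlgHom.mapMatrix_apply, Matrix.map_apply] at h2
    rw [h2, Matrix.sum_apply, Matrix.sum_apply, map_sum]
    refine Finset.sum_congr rfl fun j _ => ?_
    simp [Matrix.mul_apply]

end SpFrame

end QC

/-! ### Sums over permutations and covariant derivatives of component tensors. -/

namespace QC

open Matrix

section Vectors

variable {ι S : Type*}

theorem init_vec1 (a : ι) : Fin.init ![a] = (![] : Fin 0 → ι) := by ext j; exact j.elim0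
theorem init_vec2 (a b : ι) : Fin.init ![a, b] = ![a] := by ext j; fin_cases j; rfl
theorem init_vec3 (a b c : ι) : Fin.init ![a, b, c] = ![a, b] := by ext j; fin_cases j <;> rfl
theorem init_vec4 (a b c d : ι) : Fin.init ![a, b, c, d] = ![a, b, c] := by
  ext j; fin_cases j <;> rfl
theorem init_vec5 (a b c d e : ι) : Fin.init ![a, b, c, d, e] = ![a, b, c, d] := by
  ext j; fin_cases j <;> rfl

theorem update_vec1 (a x : ι) : Function.update ![a] 0 x = ![x] := by ext j; fin_cases j; rfl
theorem update_vec2 (a b x : ι) : Function.update ![a, b] 0 x = ![x, b] ∧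
    Function.update ![a, b] 1 x = ![a, x] := by
  constructor <;> (ext j; fin_cases j <;> rfl)
theorem update_vec3 (a b c x : ι) : Function.update ![a, b, c] 0 x = ![x, b, c] ∧
    Function.update ![a, b, c] 1 x = ![a, x, c] ∧ Function.update ![a, b, c] 2 x = ![a, b, x] := by
  refine ⟨?_, ?_, ?_⟩ <;> (ext j; fin_cases j <;> rfl)
theorem update_vec4 (a b c d x : ι) : Function.update ![a, b, c, d] 0 x = ![x, b, c, d] ∧
    Function.update ![a, b, c, d] 1 x = ![a, x, c, d] ∧
    Function.update ![a, b, c, d] 2 x = ![a, b, x, d] ∧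
    Function.update ![a, b, c, d] 3 x = ![a, b, c, x] := by
  refine ⟨?_, ?_, ?_, ?_⟩ <;> (ext j; fin_cases j <;> rfl)

variable [AddCommMonoid S]

/-- Sums over permutations, by the value at zero. -/
theorem sum_perm_succ {k : ℕ} (G : (Fin (k + 1) → ι) → S) (A : Fin (k + 1) → ι) :
    ∑ σ : Equiv.Perm (Fin (k + 1)), G (A ∘ σ)
      = ∑ p, ∑ e : Equiv.Perm (Fin k),
        G (Matrix.vecCons (A p) ((fun j => A (Equiv.swap 0 p j.succ)) ∘ e)) := by
  rw [← Equiv.sum_comp (Equiv.Perm.decomposeFin (n := k)).symm, Fintype.sum_prod_type]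
  refine Finset.sum_congr rfl fun p _ => Finset.sum_congr rfl fun e _ => congrArg G ?_
  ext j
  refine Fin.cases ?_ (fun j => ?_) j
  · simp
  · simp [Equiv.Perm.decomposeFin_symm_apply_succ]

theorem sum_perm_one (G : (Fin 1 → ι) → S) (A : Fin 1 → ι) :
    ∑ σ : Equiv.Perm (Fin 1), G (A ∘ σ) = G A := by
  rw [Fintype.sum_unique]; rfl

theorem sum_perm_two (G : (Fin 2 → ι) → S) (a b : ι) :
    ∑ σ : Equiv.Perm (Fin 2), G (![a, b] ∘ σ) = G ![a, b] + G ![b, a] := by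
  rw [sum_perm_succ, Fin.sum_univ_two]
  rw [sum_perm_one (fun v => G (Matrix.vecCons _ v)), sum_perm_one (fun v => G (Matrix.vecCons _ v))]
  congr 2; ext j; fin_cases j <;> rfl

theorem sum_perm_three (G : (Fin 3 → ι) → S) (a b c : ι) :
    ∑ σ : Equiv.Perm (Fin 3), G (![a, b, c] ∘ σ) = G ![a, b, c] + G ![a, c, b]
      + (G ![b, a, c] + G ![b, c, a]) + (G ![c, b, a] + G ![c, a, b]) := by
  have h0 : (fun j : Fin 2 => ![a, b, c] (Equiv.swap 0 0 j.succ)) = ![b, c] := by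
    ext j; fin_cases j <;> rfl
  have h1 : (fun j : Fin 2 => ![a, b, c] (Equiv.swap 0 1 j.succ)) = ![a, c] := by
    ext j; fin_cases j <;> rfl
  have h2 : (fun j : Fin 2 => ![a, b, c] (Equiv.swap 0 2 j.succ)) = ![b, a] := by
    ext j; fin_cases j <;> rfl
  rw [sum_perm_succ, Fin.sum_univ_three, h0, h1, h2, sum_perm_two (fun v => G (Matrix.vecCons _ v)),
    sum_perm_two (fun v => G (Matrix.vecCons _ v)), sum_perm_two (fun v => G (Matrix.vecCons _ v))]
  rfl

theorem sum_perm_four (G : (Fin 4 → ι) → S) (a b c d : ι) :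
    ∑ σ : Equiv.Perm (Fin 4), G (![a, b, c, d] ∘ σ)
      = (G ![a, b, c, d] + G ![a, b, d, c] + (G ![a, c, b, d] + G ![a, c, d, b])
          + (G ![a, d, c, b] + G ![a, d, b, c]))
        + (G ![b, a, c, d] + G ![b, a, d, c] + (G ![b, c, a, d] + G ![b, c, d, a])
          + (G ![b, d, c, a] + G ![b, d, a, c]))
        + (G ![c, b, a, d] + G ![c, b, d, a] + (G ![c, a, b, d] + G ![c, a, d, b])
          + (G ![c, d, a, b] + G ![c, d, b, a]))
        + (G ![d, b, c, a] + G ![d, b, a, c] + (G ![d, c, b, a] + G ![d, c, a, b])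
          + (G ![d, a, c, b] + G ![d, a, b, c])) := by
  have h0 : (fun j : Fin 3 => ![a, b, c, d] (Equiv.swap 0 0 j.succ)) = ![b, c, d] := by
    ext j; fin_cases j <;> rfl
  have h1 : (fun j : Fin 3 => ![a, b, c, d] (Equiv.swap 0 1 j.succ)) = ![a, c, d] := by
    ext j; fin_cases j <;> rfl
  have h2 : (fun j : Fin 3 => ![a, b, c, d] (Equiv.swap 0 2 j.succ)) = ![b, a, d] := by
    ext j; fin_cases j <;> rfl
  have h3 : (fun j : Fin 3 => ![a, b, c, d] (Equiv.swap 0 3 j.succ)) = ![b, c, a] := by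
    ext j; fin_cases j <;> rfl
  rw [sum_perm_succ, Fin.sum_univ_four, h0, h1, h2, h3,
    sum_perm_three (fun v => G (Matrix.vecCons _ v)),
    sum_perm_three (fun v => G (Matrix.vecCons _ v)),
    sum_perm_three (fun v => G (Matrix.vecCons _ v)),
    sum_perm_three (fun v => G (Matrix.vecCons _ v))]
  rfl

end Vectors

namespace FrameCalculus

set_option linter.unusedSectionVars false

variable {n : ℕ} {𝒜 : Type*} [CommRing 𝒜] [Algebra ℝ 𝒜] (K : FrameCalculus n 𝒜)

/-- Covariant derivative of a tensor, given by its components. -/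
def cd {k : ℕ} (F : (Fin k → Idx n) → 𝒜) : (Fin (k + 1) → Idx n) → 𝒜 := fun A =>
  K.D (A (Fin.last k)) (F (Fin.init A))
    - ∑ j : Fin k, ∑ d, K.Γ (A (Fin.last k)) (Fin.init A j) d
        * F (Function.update (Fin.init A) j d)

theorem cd_one (F : (Fin 0 → Idx n) → 𝒜) (a : Idx n) : K.cd F ![a] = K.D a (F ![]) := by
  rw [cd, init_vec1]
  simp only [Fin.sum_univ_zero, sub_zero]
  rfl

theorem cd_two (F : (Fin 1 → Idx n) → 𝒜) (b a : Idx n) :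
    K.cd F ![b, a] = K.D a (F ![b]) - ∑ d, K.Γ a b d * F ![d] := by
  rw [cd, init_vec2, Fin.sum_univ_one]
  simp only [update_vec1]
  rfl

theorem cd_three (F : (Fin 2 → Idx n) → 𝒜) (b c a : Idx n) :
    K.cd F ![b, c, a] = K.D a (F ![b, c]) - ∑ d, K.Γ a b d * F ![d, c]
      - ∑ d, K.Γ a c d * F ![b, d] := by
  rw [cd, init_vec3, Fin.sum_univ_two]
  simp only [update_vec2, sub_sub]
  rfl

theorem cd_four (F : (Fin 3 → Idx n) → 𝒜) (b c d a : Idx n) :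
    K.cd F ![b, c, d, a] = K.D a (F ![b, c, d]) - ∑ e, K.Γ a b e * F ![e, c, d]
      - ∑ e, K.Γ a c e * F ![b, e, d] - ∑ e, K.Γ a d e * F ![b, c, e] := by
  rw [cd, init_vec4, Fin.sum_univ_three]
  simp only [update_vec3, sub_sub, add_assoc]
  rfl

theorem cd_five (F : (Fin 4 → Idx n) → 𝒜) (b c d e a : Idx n) :
    K.cd F ![b, c, d, e, a] = K.D a (F ![b, c, d, e]) - ∑ x, K.Γ a b x * F ![x, c, d, e]
      - ∑ x, K.Γ a c x * F ![b, x, d, e] - ∑ x, K.Γ a d x * F ![b, c, x, e]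
      - ∑ x, K.Γ a e x * F ![b, c, d, x] := by
  rw [cd, init_vec5, Fin.sum_univ_four]
  simp only [update_vec4, sub_sub, add_assoc]
  rfl

theorem cd_hh {F : (Fin 2 → Idx n) → 𝒜} {X : Matrix (HIdx n) (HIdx n) 𝒜}
    (hF : ∀ α β, F ![Sum.inl α, Sum.inl β] = X α β) (α β : HIdx n) (a : Idx n) :
    K.cd F ![Sum.inl α, Sum.inl β, a] = K.N a X α β := by
  rw [cd_three]
  simp only [Fintype.sum_sum_type, Γ_hv, zero_mul, Finset.sum_const_zero, add_zero, hF, Γ_hh, N, DM,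
    Matrix.sub_apply, Matrix.add_apply, Matrix.mul_apply, Matrix.map_apply, K.Ω_swap a _ α,
    neg_mul, Finset.sum_neg_distrib, mul_comm (X α _)]
  ring

theorem cd_cd_hh {F : (Fin 2 → Idx n) → 𝒜} {X : Matrix (HIdx n) (HIdx n) 𝒜}
    (hF : ∀ α β, F ![Sum.inl α, Sum.inl β] = X α β) (α β : HIdx n) (b a : Idx n) :
    K.cd (K.cd F) ![Sum.inl α, Sum.inl β, b, a] = K.N2 a b X α β := by
  rw [cd_four]
  have h : K.N2 a b X α β = K.N a (K.N b X) α β - ∑ e, K.Γ a b e * K.N e X α β := by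
    simp [N2, Matrix.sum_apply]
  rw [h, Fintype.sum_sum_type (fun e => K.Γ a (Sum.inl α) e * _),
    Fintype.sum_sum_type (fun e => K.Γ a (Sum.inl β) e * _), N]
  simp only [Γ_hv, zero_mul, Finset.sum_const_zero, add_zero, K.cd_hh hF, Γ_hh, DM,
    Matrix.sub_apply, Matrix.add_apply, Matrix.mul_apply, Matrix.map_apply, K.Ω_swap a _ α,
    neg_mul, Finset.sum_neg_distrib, mul_comm (K.N b X α _)]
  ring

theorem cd_hv {F : (Fin 2 → Idx n) → 𝒜} {v : Fin 3 → HIdx n → 𝒜}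
    (hF : ∀ α i, F ![Sum.inl α, Sum.inr i] = v i α) (α : HIdx n) (i : Fin 3) (a : Idx n) :
    K.cd F ![Sum.inl α, Sum.inr i, a] = K.Nv a (v i) α - ∑ j, K.γ a i j * v j α := by
  rw [cd_three]
  simp only [Fintype.sum_sum_type, Γ_hv, Γ_vh, zero_mul, Finset.sum_const_zero, add_zero, zero_add,
    hF, Γ_hh, Γ_vv, Nv, Matrix.mulVec, dotProduct, K.Ω_swap a _ α, neg_mul, Finset.sum_neg_distrib]
  ring

theorem cd_vh {F : (Fin 2 → Idx n) → 𝒜} {v : Fin 3 → HIdx n → 𝒜}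
    (hF : ∀ α i, F ![Sum.inr i, Sum.inl α] = v i α) (α : HIdx n) (i : Fin 3) (a : Idx n) :
    K.cd F ![Sum.inr i, Sum.inl α, a] = K.Nv a (v i) α - ∑ j, K.γ a i j * v j α := by
  rw [cd_three]
  simp only [Fintype.sum_sum_type, Γ_hv, Γ_vh, zero_mul, Finset.sum_const_zero, add_zero, zero_add,
    hF, Γ_hh, Γ_vv, Nv, Matrix.mulVec, dotProduct, K.Ω_swap a _ α, neg_mul, Finset.sum_neg_distrib]
  ring

theorem cd_cd_scalar (F : (Fin 0 → Idx n) → 𝒜) (α β : HIdx n) :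
    K.cd (K.cd F) ![Sum.inl α, Sum.inl β]
      = K.Nv (Sum.inl β) (fun α => K.D (Sum.inl α) (F ![])) α := by
  rw [cd_two]
  simp only [cd_one, Fintype.sum_sum_type, Γ_hv, zero_mul, Finset.sum_const_zero, add_zero, Γ_hh,
    Nv, Matrix.mulVec, dotProduct, K.Ω_swap _ _ α, neg_mul, Finset.sum_neg_distrib]
  ring

/-- Covariant derivative of the mixed Ricci curvature. -/
theorem sum_cd_R (F : (Fin 4 → Idx n) → 𝒜) (hF : ∀ a b c d, F ![a, b, c, d] = K.R a b c d)
    (i : Fin 3) (β : HIdx n) (a : Idx n) :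
    ∑ γ, K.cd F ![Sum.inl γ, Sum.inr i, Sum.inl β, Sum.inl γ, a]
      = K.Nv a (K.W i) β - ∑ j, K.γ a i j * K.W j β := by
  have h1 : ∑ γ, ∑ δ, K.Ω a δ γ * K.RM (Sum.inl δ) (Sum.inr i) γ β
      + ∑ γ, ∑ δ, K.Ω a δ γ * K.RM (Sum.inl γ) (Sum.inr i) δ β = 0 := by
    rw [Finset.sum_comm]
    simp only [← Finset.sum_add_distrib]
    refine Finset.sum_eq_zero fun γ _ => Finset.sum_eq_zero fun δ _ => ?_
    rw [K.Ω_swap a γ δ]; ring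
  have h2 : ∑ γ, ∑ δ, K.Ω a δ β * K.RM (Sum.inl γ) (Sum.inr i) γ δ
      = -∑ δ, K.Ω a β δ * ∑ γ, K.RM (Sum.inl γ) (Sum.inr i) γ δ := by
    rw [Finset.sum_comm, ← Finset.sum_neg_distrib]
    refine Finset.sum_congr rfl fun δ _ => ?_
    rw [K.Ω_swap a δ β, ← Finset.mul_sum]; ring
  have h3 : ∑ γ, ∑ j, K.γ a i j * K.RM (Sum.inl γ) (Sum.inr j) γ β
      = ∑ j, K.γ a i j * ∑ γ, K.RM (Sum.inl γ) (Sum.inr j) γ β := by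
    rw [Finset.sum_comm]
    simp only [Finset.mul_sum]
  simp only [cd_five, hF, Fintype.sum_sum_type, Γ_hv, Γ_vh, zero_mul, Finset.sum_const_zero,
    add_zero, zero_add, Γ_hh, Γ_vv, R_hh, Finset.sum_sub_distrib, h2, h3, Nv, W, Matrix.mulVec,
    dotProduct, map_sum]
  linear_combination -h1

theorem Nv_jv (a : Idx n) (i : Fin 3) (v : HIdx n → 𝒜) :
    K.Nv a (jv n 𝒜 i v) = jv n 𝒜 i (K.Nv a v) + ∑ j, K.γ a i j • jv n 𝒜 j v := by
  have h := congrArg (fun X => X *ᵥ v) (K.Ω_jm a i)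
  simp only [Matrix.sub_mulVec, Matrix.sum_mulVec, Matrix.smul_mulVec, ← Matrix.mulVec_mulVec] at h
  ext β
  have hβ := congrFun h β
  have hD : K.D a ((jm n 𝒜 i *ᵥ v) β) = (jm n 𝒜 i *ᵥ fun γ => K.D a (v γ)) β := by
    simp [Matrix.mulVec, dotProduct, jm]
  have e : K.Nv a v = (fun γ => K.D a (v γ)) + K.Ω a *ᵥ v := rfl
  rw [Pi.add_apply, e, map_add]
  simp only [jv_eq, Nv, Pi.add_apply, Pi.sub_apply, hD] at hβ ⊢
  rw [← hβ]
  ring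

/-- Contraction of a vertical index with the J_i is parallel: the derivative of J_i cancels the
connection term at the vertical index since the connection on V is skew. -/
theorem sum_jv_Nv_W (hn : n ≠ 0) (a : Idx n) :
    ∑ i, jv n 𝒜 i (fun β => K.Nv a (K.W i) β - ∑ j, K.γ a i j * K.W j β)
      = K.Nv a (∑ i, jv n 𝒜 i (K.W i)) := by
  have h1 : ∀ i, (fun β => K.Nv a (K.W i) β - ∑ j, K.γ a i j * K.W j β)
      = K.Nv a (K.W i) - ∑ j, K.γ a i j • K.W j := fun i => by
    ext β; simp
  have h2 : ∀ v w, K.Nv a (v + w) = K.Nv a v + K.Nv a w := fun v w => by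
    ext β; simp only [Nv, Pi.add_apply, map_add, Matrix.mulVec_add]; ring
  have h3 : ∀ i (c : 𝒜) v, jv n 𝒜 i (c • v) = c • jv n 𝒜 i v := fun i c v => by
    simp [jv_eq, Matrix.mulVec_smul]
  simp only [h1]
  simp only [Fin.sum_univ_three, h2, Nv_jv, map_sub, map_add, h3, K.γ_skew hn a 1 0,
    K.γ_skew hn a 2 0, K.γ_skew hn a 2 1, eq_zero_of_eq_neg (K.γ_skew hn a _ _), zero_smul,
    neg_smul]
  abel

end FrameCalculus

end QC

/-! ### The geometric tensors as elements of the algebra. -/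

namespace QC

open Matrix

section SymPart

variable {n : ℕ} {M : Type*}

theorem sum_perm_eq_zero {k : ℕ} {F : Tensor n M k} {A : Fin k → Idx n} {x : M}
    (h : symPart F A x = 0) : ∑ σ : Equiv.Perm (Fin k), F (A ∘ σ) x = 0 := by
  rw [symPart] at h
  refine (mul_eq_zero.1 h).resolve_left (inv_ne_zero ?_)
  exact_mod_cast k.factorial_ne_zero

end SymPart

namespace SpFrame

set_option linter.unusedSectionVars false

variable {n : ℕ} {M : Type*} [TopologicalSpace M] [ChartedSpace (Model n) M]
  [IsManifold (𝓡 (4 * n + 3)) ∞ M] {P : PseudohermitianStructure n M} {U : Set M}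
  (f : SpFrame P U) (C : BiquardConnection P)

/-- The components of the tensor `F` are the given elements of the algebra. -/
def Represents {k : ℕ} (F : Tensor n M k) (G : (Fin k → Idx n) → smoothAlg n U) : Prop :=
  ∀ A x, ∀ hx : x ∈ U, F A x = evalAlg hx (G A)

variable [T2Space M]

/-- Agreement on the open set U suffices for derivatives to agree on U, whatever the functions do
elsewhere. Being closed under this operation, representation extends to iterated derivatives. -/
theorem Represents.covD {k : ℕ} {F : Tensor n M k} {G : (Fin k → Idx n) → smoothAlg n U}
    (h : Represents F G) : Represents (f.covD C F) ((f.calculus C).cd G) := by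
  intro A x hx
  rw [SpFrame.covD, FrameCalculus.cd, map_sub, map_sum]
  rw [f.dirDeriv_eq_eval C _ (fun y hy => h (Fin.init A) y hy) hx]
  congr 1
  refine Finset.sum_congr rfl fun j _ => ?_
  rw [map_sum]
  refine Finset.sum_congr rfl fun d _ => ?_
  rw [map_mul, h _ x hx]
  rfl

theorem eval_R (a b c d : Idx n) {x : M} (hx : x ∈ U) :
    f.curv C ![a, b, c, d] x = evalAlg hx ((f.calculus C).R a b c d) := by
  rw [f.curv_eq C a b c d hx, FrameCalculus.R]
  rw [f.dirDeriv_eq_eval C a (fun y hy => (f.eval_connAlg C b c d hy).symm) hx,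
    f.dirDeriv_eq_eval C b (fun y hy => (f.eval_connAlg C a c d hy).symm) hx]
  simp only [f.eval_struct C _ _ _ hx, ← f.eval_connAlg C _ _ _ hx, ← map_mul, ← map_sum,
    ← map_add, ← map_sub]
  rfl

theorem represents_curv : Represents (f.curv C)
    (fun A => (f.calculus C).R (A 0) (A 1) (A 2) (A 3)) := fun A _ hx =>
  f.eval_R C (A 0) (A 1) (A 2) (A 3) hx

theorem eval_ric (α β : HIdx n) {x : M} (hx : x ∈ U) :
    f.ricci C α β x = evalAlg hx ((f.calculus C).ric α β) := by
  simp only [ricci, FrameCalculus.ric, Matrix.of_apply, map_sum, f.eval_R C _ _ _ _ hx]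
  rfl

theorem eval_scal (hn : n ≠ 0) {x : M} (hx : x ∈ U) :
    f.scal C x = evalAlg hx ((-(8 * n * (n + 2)) : ℝ) • (f.calculus C).lam) := by
  have h := congrArg (evalAlg hx) ((f.calculus C).trace_ric hn)
  simp only [Matrix.trace, Matrix.diag, map_sum, ← f.eval_ric C _ _ hx] at h
  rw [scal, h]
  simp [map_ofNat]

theorem eval_s (i : Fin 3) (α β : HIdx n) {x : M} (hx : x ∈ U) :
    f.torSym C i α β x = evalAlg hx ((f.calculus C).s i α β) := by
  simp only [torSym, FrameCalculus.s, Matrix.smul_apply, map_smul, Matrix.add_apply, map_add,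
    Matrix.transpose_apply, ← f.eval_torAlg C _ _ _ hx, smul_eq_mul]
  rw [div_eq_inv_mul, one_div]
  rfl

theorem eval_b (i : Fin 3) (α β : HIdx n) {x : M} (hx : x ∈ U) :
    f.torSkew C i α β x = evalAlg hx ((f.calculus C).b i α β) := by
  simp only [torSkew, FrameCalculus.b, Matrix.smul_apply, map_smul, Matrix.sub_apply, map_sub,
    Matrix.transpose_apply, ← f.eval_torAlg C _ _ _ hx, smul_eq_mul]
  rw [div_eq_inv_mul, one_div]
  rfl

theorem eval_jm (i : Fin 3) (α β : HIdx n) {x : M} (hx : x ∈ U) :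
    f.acs i α β x = evalAlg hx (FrameCalculus.jm n (smoothAlg n U) i α β) := by
  rw [f.acs_eq i α β hx, FrameCalculus.jm, Matrix.map_apply, eval_algebraMap]

theorem eval_τ (α β : HIdx n) {x : M} (hx : x ∈ U) :
    f.τ C α β x = evalAlg hx ((f.calculus C).τ α β) := by
  simp only [τ, FrameCalculus.τ, Matrix.sum_apply, Matrix.mul_apply, map_sum, map_mul,
    ← f.eval_s C _ _ _ hx, ← f.eval_jm _ _ _ hx]

theorem eval_μ (α β : HIdx n) {x : M} (hx : x ∈ U) :
    f.μ C α β x = evalAlg hx ((f.calculus C).μ α β) := by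
  simp only [μ, FrameCalculus.μ, Matrix.smul_apply, Matrix.sum_apply, Matrix.mul_apply, map_smul,
    map_sum, map_mul, ← f.eval_b C _ _ _ hx, ← f.eval_jm _ _ _ hx, smul_eq_mul]

theorem eval_B (i j : Fin 3) {x : M} (hx : x ∈ U) :
    f.B C i j x = evalAlg hx ((f.calculus C).Bm i j) := by
  simp only [B, FrameCalculus.Bm, map_sum, map_smul, Matrix.trace, Matrix.diag, Matrix.mul_apply,
    map_mul, ← f.eval_jm _ _ _ hx, smul_eq_mul, Finset.mul_sum]
  refine Finset.sum_congr rfl fun k _ => Finset.sum_congr rfl fun l _ => ?_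
  rw [Finset.sum_comm]
  refine Finset.sum_congr rfl fun δ _ => Finset.sum_congr rfl fun β _ => ?_
  rw [f.eval_R C _ _ _ _ hx, FrameCalculus.RM, Matrix.of_apply]
  ring

theorem eval_av (j : Fin 3) (β : HIdx n) {x : M} (hx : x ∈ U) :
    ∑ k, ∑ l, f.tor C (Sum.inl β) (Sum.inr k) (Sum.inr l) x * eps j k l
      = evalAlg hx ((f.calculus C).av j β) := by
  have e : ∀ k l, evalAlg hx ((f.calculus C).th k l β)
      = f.tor C (Sum.inl β) (Sum.inr k) (Sum.inr l) x := fun k l => rfl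
  rw [FrameCalculus.av, Pi.smul_apply, map_smul, e]
  have s := f.tor_skew C (Sum.inl β)
  simp only [Fin.sum_univ_three, eps_eq]
  fin_cases j
  · simp [s (Sum.inr 2) (Sum.inr 1)]; ring
  · simp [s (Sum.inr 0) (Sum.inr 2)]; ring
  · simp [s (Sum.inr 1) (Sum.inr 0)]; ring

theorem jm_real (i : Fin 3) : FrameCalculus.jm n ℝ i = J n i := by ext; simp [FrameCalculus.jm]

theorem matA_mulVec (v : Fin 3 × HIdx n → ℝ) (i : Fin 3) (α : HIdx n) {x : M} (hx : x ∈ U) :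
    (f.matA x *ᵥ v) (i, α) = 2 * ∑ j, ∑ k, eps j k i
      * FrameCalculus.jv n ℝ k (fun β => v (j, β)) α := by
  simp only [Matrix.mulVec, dotProduct, matA, Matrix.of_apply, f.acs_eq _ _ _ hx,
    FrameCalculus.jv_apply, jm_real]
  rw [Fintype.sum_prod_type, Finset.mul_sum]
  refine Finset.sum_congr rfl fun j _ => ?_
  simp only [Finset.mul_sum, Finset.sum_mul]
  rw [Finset.sum_comm]
  exact Finset.sum_congr rfl fun k _ => Finset.sum_congr rfl fun β _ => by ring

/-- Applying J_i to the i-th equation of the kernel makes the sum of J_j w_j over the two indices j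
≠ i vanish. All pairwise sums being zero, each J_j w_j is zero. -/
theorem isUnit_matA {x : M} (hx : x ∈ U) : IsUnit (f.matA x) := by
  rw [← Matrix.mulVec_injective_iff_isUnit]
  rw [← Matrix.coe_mulVecLin, ← LinearMap.ker_eq_bot, LinearMap.ker_eq_bot']
  intro v hv
  set w : Fin 3 → HIdx n → ℝ := fun j β => v (j, β) with hw
  have h : ∀ i, ∑ j, ∑ k, eps j k i • FrameCalculus.jv n ℝ k (w j) = 0 := fun i => by
    ext α
    have h1 := congrFun hv (i, α)
    rw [Matrix.mulVecLin_apply, f.matA_mulVec v i α hx] at h1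
    have h2 := (mul_eq_zero.1 h1).resolve_left two_ne_zero
    simpa [Finset.sum_apply] using h2
  have h0 := congrArg (FrameCalculus.jv n ℝ 0) (h 0)
  have h1 := congrArg (FrameCalculus.jv n ℝ 1) (h 1)
  have h2 := congrArg (FrameCalculus.jv n ℝ 2) (h 2)
  simp only [Fin.sum_univ_three, eps_eq] at h0 h1 h2
  simp [FrameCalculus.jv01, FrameCalculus.jv10, FrameCalculus.jv12,
    FrameCalculus.jv21, FrameCalculus.jv02, FrameCalculus.jv20] at h0 h1 h2
  have g : ∀ i, FrameCalculus.jv n ℝ i (w i) = 0 := by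
    intro i
    fin_cases i
    · change FrameCalculus.jv n ℝ 0 (w 0) = 0
      linear_combination (norm := module) (1 / 2 : ℝ) • h0 - (1 / 2 : ℝ) • h1 - (1 / 2 : ℝ) • h2
    · change FrameCalculus.jv n ℝ 1 (w 1) = 0
      linear_combination (norm := module) (1 / 2 : ℝ) • h1 - (1 / 2 : ℝ) • h0 - (1 / 2 : ℝ) • h2
    · change FrameCalculus.jv n ℝ 2 (w 2) = 0
      linear_combination (norm := module) (1 / 2 : ℝ) • h2 - (1 / 2 : ℝ) • h0 - (1 / 2 : ℝ) • h1
  have g' : ∀ i, w i = 0 := fun i => by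
    have := congrArg (FrameCalculus.jv n ℝ i) (g i)
    simpa [FrameCalculus.jv_self] using this
  ext ⟨i, α⟩
  exact congrFun (g' i) α

theorem eval_jv (i : Fin 3) (v : HIdx n → smoothAlg n U) (α : HIdx n) {x : M} (hx : x ∈ U) :
    evalAlg hx (FrameCalculus.jv n (smoothAlg n U) i v α)
      = FrameCalculus.jv n ℝ i (fun β => evalAlg hx (v β)) α := by
  simp only [FrameCalculus.jv_apply, map_sum, map_mul, FrameCalculus.jm, Matrix.map_apply,
    eval_algebraMap]
  simp

/-- `av_eq_Qm` says that A applied to the explicit vector is minus the dualized torsion, and A is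
invertible. -/
theorem eval_Qm (i : Fin 3) (α : HIdx n) {x : M} (hx : x ∈ U) :
    f.Qmixed C i α x = evalAlg hx ((f.calculus C).Qm i α) := by
  set q : Fin 3 × HIdx n → ℝ := fun p => evalAlg hx ((f.calculus C).Qm p.1 p.2) with hq
  set w : Fin 3 × HIdx n → ℝ := fun p => evalAlg hx ((f.calculus C).av p.1 p.2) with hw
  have h1 : f.Qmixed C i α x = -((f.matA x)⁻¹ *ᵥ w) (i, α) := by
    rw [Qmixed]
    simp only [f.eval_av C _ _ hx, Matrix.mulVec, dotProduct, Fintype.sum_prod_type, hw]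
  have h2 : w = -(f.matA x *ᵥ q) := by
    ext ⟨i, α⟩
    rw [Pi.neg_apply, f.matA_mulVec q i α hx, hw]
    simp only [FrameCalculus.av_eq_Qm, Pi.smul_apply, Pi.sub_apply, map_smul, map_sub,
      eval_jv _ _ _ hx, Fin.sum_univ_three, eps_eq, smul_eq_mul, hq]
    fin_cases i
    · simp; ring
    · simp; ring
    · simp; ring
  have h3 : (f.matA x)⁻¹ *ᵥ (f.matA x *ᵥ q) = q := by
    rw [Matrix.mulVec_mulVec, Matrix.nonsing_inv_mul _
      ((Matrix.isUnit_iff_isUnit_det _).1 (f.isUnit_matA hx)), Matrix.one_mulVec]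
  rw [h1, h2, Matrix.mulVec_neg, h3]
  simp [hq]

/-- The components of `Q` as smooth functions. -/
def QAlg (A : Fin 2 → Idx n) : smoothAlg n U :=
  match A 0, A 1 with
  | Sum.inl α, Sum.inl β => (f.calculus C).Qh α β
  | Sum.inl α, Sum.inr i => (f.calculus C).Qm i α
  | Sum.inr i, Sum.inl α => (f.calculus C).Qm i α
  | Sum.inr i, Sum.inr j =>
    (-(1 / (16 * n)) * (1 / 2) : ℝ) • ((f.calculus C).Bm i j + (f.calculus C).Bm j i)

/-- With S = -8n(n+2)λ the two multiples of g in Q_{αβ} add up to -¼(1+4n)λ. -/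
theorem represents_Q (hn : n ≠ 0) : Represents (f.Q C) (f.QAlg C) := by
  intro A x hx
  have hn' : (n : ℝ) ≠ 0 := by exact_mod_cast hn
  have hn2 : (n + 2 : ℝ) ≠ 0 := by positivity
  unfold Q QAlg
  rcases A 0 with α | i <;> rcases A 1 with β | j
  · simp only [L, f.eval_τ C _ _ hx, f.eval_μ C _ _ hx, f.eval_scal C hn hx, FrameCalculus.Qh,
      Matrix.sub_apply, Matrix.add_apply, Matrix.smul_apply, map_sub, map_add, map_smul,
      smul_eq_mul, Matrix.one_apply]
    by_cases h : α = β
    · simp only [h, if_true, mul_one]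
      field_simp
      ring
    · simp only [h, if_false, mul_zero, map_zero]
      ring
  · exact f.eval_Qm C j α hx
  · exact f.eval_Qm C i β hx
  · simp only [f.eval_B C _ _ hx, map_smul, map_add, smul_eq_mul]
    ring

theorem represents_scal (hn : n ≠ 0) : Represents (scalar (f.scal C))
    (fun _ => (-(8 * n * (n + 2)) : ℝ) • (f.calculus C).lam) := fun _ _ hx => f.eval_scal C hn hx

/-- A horizontal two-tensor over the algebra. -/
def horAlg (X : Matrix (HIdx n) (HIdx n) (smoothAlg n U)) (A : Fin 2 → Idx n) : smoothAlg n U :=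
  match A 0, A 1 with
  | Sum.inl α, Sum.inl β => X α β
  | _, _ => 0

theorem represents_horizontal {F : HIdx n → HIdx n → M → ℝ}
    {X : Matrix (HIdx n) (HIdx n) (smoothAlg n U)}
    (h : ∀ α β x, ∀ hx : x ∈ U, F α β x = evalAlg hx (X α β)) :
    Represents (horizontal F) (horAlg X) := by
  intro A x hx
  unfold horizontal horAlg
  rcases A 0 with α | i <;> rcases A 1 with β | j
  · exact h α β x hx
  all_goals simp

end SpFrame

end QC

/-! ### Traces of the hypothesis on Q and components of the conclusion. -/

namespace QC

open Matrix

namespace FrameCalculus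

variable {n : ℕ} {𝒜 : Type*} [CommRing 𝒜] [Algebra ℝ 𝒜] (K : FrameCalculus n 𝒜)

theorem Qh_transpose (hn : n ≠ 0) : K.Qhᵀ = K.Qh := by
  simp only [Qh, Matrix.transpose_sub, Matrix.transpose_add, Matrix.transpose_smul,
    K.τ_transpose hn, K.μ_transpose hn, Matrix.transpose_one]

theorem N_symm {X : Matrix (HIdx n) (HIdx n) 𝒜} (h : Xᵀ = X) (a : Idx n) (α β : HIdx n) :
    K.N a X α β = K.N a X β α := by
  have := K.N_transpose a X
  rw [h] at this
  exact congrFun (congrFun this β) α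

theorem N2_symm {X : Matrix (HIdx n) (HIdx n) 𝒜} (h : Xᵀ = X) (a b : Idx n) (α β : HIdx n) :
    K.N2 a b X α β = K.N2 a b X β α := by
  have : (K.N2 a b X)ᵀ = K.N2 a b X := by
    simp only [N2, Matrix.transpose_sub, Matrix.transpose_sum, Matrix.transpose_smul,
      N_transpose, h]
  exact congrFun (congrFun this β) α

variable (ev : 𝒜 →ₐ[ℝ] ℝ)

/-- The trace commutes with covariant derivatives and reduces Q to a multiple of λ. Since dλ = 0 at
the point, the covariant Laplacian is the flat one. -/
theorem sum_trace_N2_Qh (hn : n ≠ 0) (hd : evV ev K.dlam = 0) :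
    ∑ α, ∑ γ, ev (K.N2 (Sum.inl γ) (Sum.inl γ) K.Qh α α)
      = (-(n * (1 + 4 * n)) : ℝ) * K.dq ev K.dlam := by
  have hd' : ∀ δ, ev (K.D (Sum.inl δ) K.lam) = 0 := fun δ => congrFun hd δ
  have h : ∀ γ, ∑ α, K.N2 (Sum.inl γ) (Sum.inl γ) K.Qh α α
      = (-(n * (1 + 4 * n)) : ℝ) • (K.D (Sum.inl γ) (K.D (Sum.inl γ) K.lam)
        - ∑ δ, K.Γ (Sum.inl γ) (Sum.inl γ) (Sum.inl δ) * K.D (Sum.inl δ) K.lam) := fun γ => by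
    change (K.N2 (Sum.inl γ) (Sum.inl γ) K.Qh).trace = _
    rw [N2, Matrix.trace_sub, Matrix.trace_sum]
    simp only [Fintype.sum_sum_type, Γ_hv, zero_mul, Finset.sum_const_zero, add_zero,
      Matrix.trace_smul, trace_N, K.trace_Qh hn, Derivation.map_smul, smul_eq_mul, mul_smul_comm,
      ← Finset.smul_sum, smul_sub]
  rw [Finset.sum_comm]
  simp only [← map_sum, h, map_smul, map_sub]
  rw [dq_apply, Finset.mul_sum]
  refine Finset.sum_congr rfl fun γ _ => ?_
  simp [map_sum, hd', dlam]

theorem sum_N2_Qh (hp : evV ev K.p = 0) (hm : evV ev K.m = 0) (hd : evV ev K.dlam = 0) :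
    ∑ α, ∑ γ, ev (K.N2 (Sum.inl γ) (Sum.inl α) K.Qh α γ)
      = 1 / 2 * K.dq ev K.p + K.dq ev K.m - (1 + 4 * n) / 4 * K.dq ev K.dlam := by
  have h0 : evV ev (Div fun γ => K.N (Sum.inl γ) K.Qh) = 0 := by
    rw [Div_N_Qh, map_sub, map_add, map_smul, map_smul, hp, hm, hd]
    simp
  have h1 := K.dq_eq_sum_Nv ev h0
  simp only [Nv_Div, map_sum] at h1
  rw [Finset.sum_comm, ← h1, Div_N_Qh]
  simp [map_sub, map_add, map_smul]

/-- The double trace of the complete symmetrization of a four-tensor symmetric in its first two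
arguments. -/
theorem sum_symm_four {ι κ : Type*} [Fintype κ] (e : κ → ι) (G : (Fin 4 → ι) → ℝ)
    (hG : ∀ a b c d, G ![e a, e b, e c, e d] = G ![e b, e a, e c, e d])
    (h : ∀ a c, ∑ σ : Equiv.Perm (Fin 4), G (![e a, e a, e c, e c] ∘ σ) = 0) :
    ∑ a, ∑ c, G ![e a, e a, e c, e c] + 2 * ∑ a, ∑ c, G ![e a, e c, e a, e c] = 0 := by
  -- Each of the six arrangements of a, a, c, c arises from four permutations. Symmetry in the first
  -- two slots merges the four alternating ones into two, so second derivatives never have to be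
  -- commuted.
  have h1 : ∀ a c, G ![e a, e a, e c, e c] + G ![e c, e c, e a, e a]
      + 2 * (G ![e a, e c, e a, e c] + G ![e c, e a, e c, e a]) = 0 := fun a c => by
    have := h a c
    rw [sum_perm_four] at this
    linear_combination (1 / 4 : ℝ) * this + hG a c a c + hG c a c a
  have h2 := Finset.sum_eq_zero fun a (_ : a ∈ Finset.univ) =>
    Finset.sum_eq_zero fun c (_ : c ∈ Finset.univ) => h1 a c
  simp only [Finset.sum_add_distrib, ← Finset.mul_sum] at h2
  rw [Finset.sum_comm (f := fun a c => G ![e c, e c, e a, e a]),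
    Finset.sum_comm (f := fun a c => G ![e c, e a, e c, e a])] at h2
  linarith

end FrameCalculus

namespace SpFrame

variable {n : ℕ} {M : Type*} [TopologicalSpace M] [ChartedSpace (Model n) M]
  [IsManifold (𝓡 (4 * n + 3)) ∞ M] [T2Space M] {P : PseudohermitianStructure n M} {U : Set M}
  {f : SpFrame P U} {C : BiquardConnection P} {q : M}

namespace SymDerivQVanish

theorem sum_two {N : ℕ} (hQ : f.SymDerivQVanish C N q) (hn : n ≠ 0) (hq : q ∈ U) (a b : Idx n)
    (h : idxOrder a + idxOrder b ≤ N) :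
    evalAlg hq (f.QAlg C ![a, b]) + evalAlg hq (f.QAlg C ![b, a]) = 0 := by
  have h0 := sum_perm_eq_zero (hQ 0 ![a, b] (by simpa [order, Fin.sum_univ_two] using h))
  have h1 := sum_perm_two (fun A => f.Q C A q) a b
  simp only [f.represents_Q C hn _ q hq] at h1
  rw [← h1, ← h0]
  exact Finset.sum_congr rfl fun σ _ => (f.represents_Q C hn _ q hq).symm

theorem sum_three {N : ℕ} (hQ : f.SymDerivQVanish C N q) (hn : n ≠ 0) (hq : q ∈ U) (a b c : Idx n)
    (h : idxOrder a + idxOrder b + idxOrder c ≤ N) :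
    ∑ σ : Equiv.Perm (Fin 3), evalAlg hq ((f.calculus C).cd (f.QAlg C) (![a, b, c] ∘ σ)) = 0 := by
  have h0 := sum_perm_eq_zero (hQ 1 ![a, b, c] (by
    change ∑ j : Fin 3, _ ≤ _
    simpa [Fin.sum_univ_three] using h))
  rw [← h0]
  exact Finset.sum_congr rfl fun σ _ => ((f.represents_Q C hn).covD f C _ q hq).symm

theorem sum_four {N : ℕ} (hQ : f.SymDerivQVanish C N q) (hn : n ≠ 0) (hq : q ∈ U)
    (a b c d : Idx n) (h : idxOrder a + idxOrder b + idxOrder c + idxOrder d ≤ N) :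
    ∑ σ : Equiv.Perm (Fin 4),
      evalAlg hq ((f.calculus C).cd ((f.calculus C).cd (f.QAlg C)) (![a, b, c, d] ∘ σ)) = 0 := by
  have h0 := sum_perm_eq_zero (hQ 2 ![a, b, c, d] (by
    change ∑ j : Fin 4, _ ≤ _
    simpa [Fin.sum_univ_four] using h))
  rw [← h0]
  exact Finset.sum_congr rfl fun σ _ => (((f.represents_Q C hn).covD f C).covD f C _ q hq).symm

theorem Qh_eq_zero (hQ : f.SymDerivQVanish C 4 q) (hn : n ≠ 0) (hq : q ∈ U) (α β : HIdx n) :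
    evalAlg hq ((f.calculus C).Qh α β) = 0 := by
  have h : _ + evalAlg hq ((f.calculus C).Qhᵀ α β) = 0 :=
    hQ.sum_two hn hq (Sum.inl α) (Sum.inl β) (by simp [idxOrder])
  rw [(f.calculus C).Qh_transpose hn] at h
  exact self_eq_neg.1 (eq_neg_of_add_eq_zero_left h)

theorem Qm_eq_zero (hQ : f.SymDerivQVanish C 4 q) (hn : n ≠ 0) (hq : q ∈ U) (i : Fin 3) :
    FrameCalculus.evV (evalAlg hq) ((f.calculus C).Qm i) = 0 := by
  ext α
  exact self_eq_neg.1 (eq_neg_of_add_eq_zero_left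
    (hQ.sum_two hn hq (Sum.inl α) (Sum.inr i) (by simp [idxOrder])))

theorem Bm_add_Bm (hQ : f.SymDerivQVanish C 4 q) (hn : n ≠ 0) (hq : q ∈ U) (i j : Fin 3) :
    evalAlg hq ((f.calculus C).Bm i j) + evalAlg hq ((f.calculus C).Bm j i) = 0 := by
  have h := hQ.sum_two hn hq (Sum.inr i) (Sum.inr j) (by simp [idxOrder])
  simp only [QAlg, Matrix.cons_val_zero, Matrix.cons_val_one, map_smul, map_add, smul_eq_mul] at h
  have hn' : (n : ℝ) ≠ 0 := by exact_mod_cast hn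
  field_simp at h
  linarith

theorem trace_three (hQ : f.SymDerivQVanish C 4 q) (hn : n ≠ 0) (hq : q ∈ U) (β : HIdx n) :
    ∑ α, evalAlg hq ((f.calculus C).N (Sum.inl β) (f.calculus C).Qh α α
      + 2 * (f.calculus C).N (Sum.inl α) (f.calculus C).Qh α β) = 0 := by
  refine Finset.sum_eq_zero fun α _ => ?_
  have h := hQ.sum_three hn hq (Sum.inl α) (Sum.inl α) (Sum.inl β) (by simp [idxOrder])
  rw [sum_perm_three (fun A => evalAlg hq ((f.calculus C).cd (f.QAlg C) A))] at h
  simp only [(f.calculus C).cd_hh (F := f.QAlg C) (X := (f.calculus C).Qh) (fun α β => rfl),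
    (f.calculus C).N_symm ((f.calculus C).Qh_transpose hn) _ β α] at h
  rw [map_add, map_mul, map_ofNat]
  linarith

/-- A multiindex ααi has order exactly 4. Its symmetrization also contains Q_{αi,α}, whose trace is
the flat divergence because Q_{αi} vanishes at q. -/
theorem trace_three_vertical (hQ : f.SymDerivQVanish C 4 q) (hn : n ≠ 0) (hq : q ∈ U) (i : Fin 3) :
    ∑ α, evalAlg hq ((f.calculus C).N (Sum.inr i) (f.calculus C).Qh α α)
      + 2 * (f.calculus C).dq (evalAlg hq) ((f.calculus C).Qm i) = 0 := by
  have h0 := hQ.Qm_eq_zero hn hq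
  have h0' : ∀ j α, evalAlg hq ((f.calculus C).Qm j α) = 0 := fun j α => congrFun (h0 j) α
  rw [(f.calculus C).dq_eq_sum_Nv _ (h0 i), Finset.mul_sum, ← Finset.sum_add_distrib]
  refine Finset.sum_eq_zero fun α _ => ?_
  have h := hQ.sum_three hn hq (Sum.inl α) (Sum.inl α) (Sum.inr i) (by simp [idxOrder])
  rw [sum_perm_three (fun A => evalAlg hq ((f.calculus C).cd (f.QAlg C) A))] at h
  simp only [(f.calculus C).cd_hh (F := f.QAlg C) (X := (f.calculus C).Qh) (fun α β => rfl),
    (f.calculus C).cd_hv (F := f.QAlg C) (v := (f.calculus C).Qm) (fun α β => rfl),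
    (f.calculus C).cd_vh (F := f.QAlg C) (v := (f.calculus C).Qm) (fun α β => rfl), map_sub, map_sum, map_mul, h0',
    mul_zero, Finset.sum_const_zero, sub_zero] at h
  linarith

theorem trace_four (hQ : f.SymDerivQVanish C 4 q) (hn : n ≠ 0) (hq : q ∈ U) :
    ∑ α, ∑ γ, evalAlg hq ((f.calculus C).N2 (Sum.inl γ) (Sum.inl γ) (f.calculus C).Qh α α)
      + 2 * ∑ α, ∑ γ, evalAlg hq
        ((f.calculus C).N2 (Sum.inl γ) (Sum.inl α) (f.calculus C).Qh α γ) = 0 := by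
  have h := FrameCalculus.sum_symm_four (Sum.inl : HIdx n → Idx n)
    (fun A => evalAlg hq ((f.calculus C).cd ((f.calculus C).cd (f.QAlg C)) A))
    (fun α β γ δ => by
      simp only [(f.calculus C).cd_cd_hh (F := f.QAlg C) (X := (f.calculus C).Qh) (fun α β => rfl)]
      rw [(f.calculus C).N2_symm ((f.calculus C).Qh_transpose hn)])
    (fun α γ => hQ.sum_four hn hq _ _ _ _ (by simp [idxOrder]))
  simpa only [(f.calculus C).cd_cd_hh (F := f.QAlg C) (X := (f.calculus C).Qh) (fun α β => rfl)] using h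

end SymDerivQVanish

variable (f C)

theorem sum_covD_horizontal {F : HIdx n → HIdx n → M → ℝ}
    {X : Matrix (HIdx n) (HIdx n) (smoothAlg n U)}
    (h : ∀ α β x, ∀ hx : x ∈ U, F α β x = evalAlg hx (X α β)) (hq : q ∈ U) (β : HIdx n) :
    ∑ α, f.covD C (horizontal F) ![Sum.inl α, Sum.inl β, Sum.inl α] q
      = evalAlg hq (FrameCalculus.Div (fun γ => (f.calculus C).N (Sum.inl γ) X) β) := by
  simp only [(represents_horizontal h).covD f C _ q hq,
    (f.calculus C).cd_hh (F := horAlg X) (X := X) (fun α β => rfl), FrameCalculus.Div, map_sum]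

theorem sum_covD_covD_horizontal {F : HIdx n → HIdx n → M → ℝ}
    {X : Matrix (HIdx n) (HIdx n) (smoothAlg n U)}
    (h : ∀ α β x, ∀ hx : x ∈ U, F α β x = evalAlg hx (X α β)) (hq : q ∈ U) :
    ∑ α, ∑ β, f.covD C (f.covD C (horizontal F)) ![Sum.inl α, Sum.inl β, Sum.inl α, Sum.inl β] q
      = ∑ β, ∑ γ, evalAlg hq ((f.calculus C).N2 (Sum.inl β) (Sum.inl γ) X γ β) := by
  rw [Finset.sum_comm]
  simp only [((represents_horizontal h).covD f C).covD f C _ q hq,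
    (f.calculus C).cd_cd_hh (F := horAlg X) (X := X) (fun α β => rfl)]

theorem covD_scal (hn : n ≠ 0) (hq : q ∈ U) (a : Idx n) :
    f.covD C (scalar (f.scal C)) ![a] q
      = (-(8 * n * (n + 2)) : ℝ) * evalAlg hq ((f.calculus C).D a (f.calculus C).lam) := by
  rw [(f.represents_scal C hn).covD f C _ q hq, FrameCalculus.cd_one]
  simp only [Derivation.map_smul, map_smul, smul_eq_mul]

theorem sum_covD_covD_scal (hn : n ≠ 0) (hq : q ∈ U)
    (hd : FrameCalculus.evV (evalAlg hq) (f.calculus C).dlam = 0) :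
    ∑ α, f.covD C (f.covD C (scalar (f.scal C))) ![Sum.inl α, Sum.inl α] q
      = (-(8 * n * (n + 2)) : ℝ) * (f.calculus C).dq (evalAlg hq) (f.calculus C).dlam := by
  have hv : (fun α => (f.calculus C).D (Sum.inl α) ((-(8 * n * (n + 2)) : ℝ) • (f.calculus C).lam))
      = (-(8 * n * (n + 2)) : ℝ) • (f.calculus C).dlam := by
    ext1 α
    rw [Derivation.map_smul]
    rfl
  simp only [((f.represents_scal C hn).covD f C).covD f C _ q hq, FrameCalculus.cd_cd_scalar, hv]
  rw [← (f.calculus C).dq_eq_sum_Nv _ (by rw [map_smul, hd, smul_zero]), map_smul, smul_eq_mul]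

/-- Contraction with the J_i may be carried out before differentiating, by `sum_jv_Nv_W`. The sign
comes from exchanging the indices of the skew J_i. -/
theorem sum_covD_curv_mul_acs (hn : n ≠ 0) (hq : q ∈ U)
    (h : FrameCalculus.evV (evalAlg hq)
      (∑ i, FrameCalculus.jv n (smoothAlg n U) i ((f.calculus C).W i)) = 0) :
    ∑ i, ∑ α, ∑ β, ∑ γ, f.covD C (f.curv C)
        ![Sum.inl γ, Sum.inr i, Sum.inl β, Sum.inl γ, Sum.inl α] q * f.acs i β α q
      = -(f.calculus C).dq (evalAlg hq)
          (∑ i, FrameCalculus.jv n (smoothAlg n U) i ((f.calculus C).W i)) := by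
  have hR := (f.represents_curv C).covD f C
  rw [(f.calculus C).dq_eq_sum_Nv _ h]
  simp only [← FrameCalculus.sum_jv_Nv_W _ hn, Finset.sum_apply, map_sum]
  rw [Finset.sum_comm, ← Finset.sum_neg_distrib]
  refine Finset.sum_congr rfl fun α _ => ?_
  rw [← Finset.sum_neg_distrib]
  refine Finset.sum_congr rfl fun i _ => ?_
  rw [FrameCalculus.jv_apply, map_sum, ← Finset.sum_neg_distrib]
  refine Finset.sum_congr rfl fun β _ => ?_
  rw [← Finset.sum_mul, ← (f.calculus C).sum_cd_R
      (fun A => (f.calculus C).R (A 0) (A 1) (A 2) (A 3)) (fun a b c d => rfl), map_mul,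
    ← f.eval_jm i α β hq, f.acs_eq _ _ _ hq, f.acs_eq _ _ _ hq, J_skew i β α, map_sum]
  simp only [hR _ q hq]
  ring

end SpFrame

end QC

end

theorem theorem3p11 {n : ℕ} (hn : 1 < n) {M : Type*} [TopologicalSpace M] [T2Space M]
    [SecondCountableTopology M] [ChartedSpace (QC.Model n) M]
    [IsManifold (modelWithCornersSelf ℝ (QC.Model n)) ∞ M]
    (P : QC.PseudohermitianStructure n M) (C : QC.BiquardConnection P)
    {U : Set M} (f : QC.SpFrame P U) (q : M) (hq : q ∈ U)
    (hQ : f.SymDerivQVanish C 4 q) :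
    f.scal C q = 0 ∧
    (∀ α β, f.τ C α β q = 0) ∧
    (∀ α β, f.μ C α β q = 0) ∧
    (∀ α β, f.L C α β q = 0) ∧
    (∀ α β, f.ricci C α β q = 0) ∧
    (∀ α i β, f.tor C (Sum.inl α) (Sum.inr i) (Sum.inl β) q = 0) ∧
    (∀ i j k, f.tor C (Sum.inr i) (Sum.inr j) (Sum.inr k) q = 0) ∧
    (∀ α j k, f.tor C (Sum.inl α) (Sum.inr j) (Sum.inr k) q = 0) ∧
    (∀ β, f.covD C (QC.scalar (f.scal C)) ![Sum.inl β] q = 0) ∧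
    (∀ β, ∑ α, f.covD C (QC.horizontal (f.μ C)) ![Sum.inl α, Sum.inl β, Sum.inl α] q = 0) ∧
    (∀ β, ∑ α, f.covD C (QC.horizontal (f.τ C)) ![Sum.inl α, Sum.inl β, Sum.inl α] q = 0) ∧
    (∀ i j, f.B C i j q = 0) ∧
    (∀ i, f.covD C (QC.scalar (f.scal C)) ![Sum.inr i] q = 0) ∧
    (∑ α, f.covD C (f.covD C (QC.scalar (f.scal C))) ![Sum.inl α, Sum.inl α] q = 0) ∧
    (∑ α, ∑ β, f.covD C (f.covD C (QC.horizontal (f.τ C)))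
      ![Sum.inl α, Sum.inl β, Sum.inl α, Sum.inl β] q = 0) ∧
    (∑ α, ∑ β, f.covD C (f.covD C (QC.horizontal (f.μ C)))
      ![Sum.inl α, Sum.inl β, Sum.inl α, Sum.inl β] q = 0) ∧
    (∑ i, ∑ α, ∑ β, ∑ γ, f.covD C (f.curv C)
      ![Sum.inl γ, Sum.inr i, Sum.inl β, Sum.inl γ, Sum.inl α] q * f.acs i β α q = 0) := by
  have hn0 : n ≠ 0 := by omega
  set K := f.calculus C
  set ev := QC.evalAlg (n := n) hq
  have hQm := hQ.Qm_eq_zero hn0 hq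
  obtain ⟨hl, hτ, hμ⟩ := K.lam_τ_μ_eq_zero ev hn0 (hQ.Qh_eq_zero hn0 hq)
  have ht := K.t_eq_zero ev hn0 hτ hμ
  have ha := K.av_eq_zero ev hQm
  have haa := K.aa_eq_zero ev ha
  obtain ⟨hp, hm, hd⟩ := K.first_derivatives_eq_zero ev hn0 haa (hQ.trace_three hn0 hq)
  have h5 := hQ.trace_four hn0 hq
  -- The order-4 trace can be expressed by flat divergences only now that p, m and dλ are known to
  -- vanish at q.
  rw [K.sum_trace_N2_Qh ev hn0 hd, K.sum_N2_Qh ev hp hm hd] at h5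
  obtain ⟨hlv, hB, hqa, hqp, hqm, hqd⟩ := K.second_derivatives_eq_zero ev hn ht hμ ha hm hd
    (hQ.trace_three_vertical hn0 hq) (hQ.Bm_add_Bm hn0 hq) h5
  have hS : f.scal C q = 0 := by
    rw [f.eval_scal C hn0 hq, map_smul, hl, smul_zero]
  have hτ' : ∀ α β, f.τ C α β q = 0 := fun α β =>
    (f.eval_τ C α β hq).trans (congrFun (congrFun hτ α) β)
  have hμ' : ∀ α β, f.μ C α β q = 0 := fun α β =>
    (f.eval_μ C α β hq).trans (congrFun (congrFun hμ α) β)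
  have ht' : ∀ i α β, ev (K.t i α β) = 0 := fun i α β => congrFun (congrFun (ht i) α) β
  refine ⟨hS, hτ', hμ', fun α β => ?_, fun α β => ?_, fun α i β => ht' i α β, fun i j k => ?_,
    fun α j k => ?_, fun β => ?_, fun β => ?_, fun β => ?_, fun i j => ?_, fun i => ?_, ?_, ?_, ?_,
    ?_⟩
  · simp [QC.SpFrame.L, hS, hτ', hμ']
  · rw [f.eval_ric C α β hq]
    exact K.ric_eq_zero hn0 ev ht' hl α β
  · change ev (K.tv i j k) = 0
    rw [K.tv_eq hn0, map_smul, hl, smul_zero]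
  · change QC.FrameCalculus.evV ev (K.th j k) α = 0
    simp [K.th_eq, ha]
  · rw [f.covD_scal C hn0 hq]
    exact mul_eq_zero_of_right _ (congrFun hd β)
  · rw [f.sum_covD_horizontal C (fun α β x hx => f.eval_μ C α β hx) hq]
    exact congrFun hm β
  · rw [f.sum_covD_horizontal C (fun α β x hx => f.eval_τ C α β hx) hq]
    exact congrFun hp β
  · rw [f.eval_B C i j hq]
    exact hB i j
  · rw [f.covD_scal C hn0 hq]
    exact mul_eq_zero_of_right _ (hlv i)
  · rw [f.sum_covD_covD_scal C hn0 hq hd]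
    exact mul_eq_zero_of_right _ hqd
  · rw [f.sum_covD_covD_horizontal C (fun α β x hx => f.eval_τ C α β hx) hq]
    exact (K.dq_p_eq_sum ev hp).symm.trans hqp
  · rw [f.sum_covD_covD_horizontal C (fun α β x hx => f.eval_μ C α β hx) hq]
    exact (K.dq_m_eq_sum ev hm).symm.trans hqm
  -- The field ∑ J_i W_i is a combination of p, m and a, so both its value and its divergence at q
  -- are already known to vanish.
  · have h1 : QC.FrameCalculus.evV ev (∑ i, QC.FrameCalculus.jv n _ i (K.W i)) = 0 := by
      rw [K.sum_jv_W hn0]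
      simp [hp, hm, haa]
    have h2 : K.dq ev (∑ i, QC.FrameCalculus.jv n _ i (K.W i)) = 0 := by
      rw [K.sum_jv_W hn0]
      simp [hqp, hqm, hqa]
    exact (f.sum_covD_curv_mul_acs C hn0 hq h1).trans (neg_eq_zero.2 h2)
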